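/- Let $q\ge 1$, and write $\mathrm{uchol}(A)$ for the upper-triangular Cholesky factor (with positive diagonal, $A=\mathrm{uchol}(A)'\,\mathrm{uchol}(A)$) of a symmetric positive-definite $q\times q$ matrix $A$. For $k>q-1$, $\mathrm{Wishart}_q(k,S)$ has density $2^{-kq/2}|S|^{-k/2}\Gamma_q(k/2)^{-1}|A|^{(k-q-1)/2}e^{-\mathrm{tr}(S^{-1}A)/2}$ with respect to Lebesgue measure $\prod_{i\le j}da_{ij}$ on symmetric positive-definite matrices; for an integer $0<k<q$ it is the law of $XX'$, where $X$ is $q\times k$ with independent $N_q(0,S)$ columns, and its density is taken with respect to the image of Lebesgue measure on $\mathbb R^{q\times k}$ under $X\mapsto XX'$. If $A_1\sim \mathrm{Wishart}_q(n,I)$ and $A_2\sim\mathrm{Wishart}_q(k,I)$ are independent and $T=\mathrm{uchol}(A_1+A_2)$, then $\mathrm{MatrixBeta}_q(n/2,k/2)$ is the law of $(T^{-1})'A_1T^{-1}$. **Uhlig extended (UE) model**, with hyperparameters $(n,k,\lambda,D_0)$, where $n>q-1$, $k$ is a positive integer less than $q$ or a real number greater than $q-1$, $0<\lambda<1$, and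 $D_0$ is symmetric positive definite: $\Phi_0\sim \mathrm{Wishart}_q(n+k,(kD_0)^{-1})$; for $t\ge1$, $\Phi_t=\mathrm{uchol}(\Phi_{t-1})'\,\Psi_t\,\mathrm{uchol}(\Phi_{t-1})/\lambda$, with $\Psi_t\sim\mathrm{MatrixBeta}_q(n/2,k/2)$ independent of the past; and $y_t$ given $\Phi_t$ and the past is $\mathrm{Wishart}_q(k,(k\Phi_t)^{-1})$. Put $D_t=\lambda D_{t-1}+y_t$ for $t\ge 1$. **Beta-Bartlett (BB) model**, with hyperparameters $(k_0,k,\beta,b,D_0)$, where $k_0>0$, $k$ is as above, $0<\beta<1$, $0<b<1$, $D_0$ is symmetric positive definite, and, with $k_t=\beta k_{t-1}+k$, $\beta k_t>q-1$ for all $t\ge 0$: $\Phi_0\sim\mathrm{Wishart}_q(k_0,(kD_0)^{-1})$; for $t\ge1$, with $D_{t}=bD_{t-1}+y_{t}$, $P_{t-1}=\mathrm{uchol}((kD_{t-1})^{-1})$ and $U_{t-1}=\mathrm{uchol}(\Phi_{t-1})P_{t-1}^{-1}$, $\Phi_t=(\tilde U_tP_{t-1})'\tilde U_tP_{t-1}/b$,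 where $\tilde U_t$ is $U_{t-1}$ with its $i$-th diagonal entry multiplied by $\sqrt{\eta_{i,t}}$, and the $\eta_{i,t}\sim\mathrm{Beta}((\beta k_{t-1}-i+1)/2,(1-\beta)k_{t-1}/2)$, $1\le i\le q$, are independent of each other and of the past; and $y_t$ given $\Phi_t$ and the past is $\mathrm{Wishart}_q(k,(k\Phi_t)^{-1})$. The marginal likelihood of $y_{1:T}$ is, in either model, $\int\prod_{t=1}^Tp(y_t\mid\Phi_t)\,p(d\Phi_0)\prod_{t=1}^Tp(d\Phi_t\mid\Phi_{t-1},y_{1:t-1})$, where $p(y_t\mid\Phi_t)$ is the Wishart density above. **(a)** Let $(n,k,\lambda,D_0)$ be UE hyperparameters, and take the BB model with the same $k$ and with $$k_0=n+k,\qquad \beta=\frac{n}{n+k},\qquad b=\lambda,\qquad D_0^B=D_0^U=D_0 .$$ Then both models have, for every $t\ge0$, the prior $\Phi_{t+1}\mid y_{1:t}\sim\mathrm{Wishart}_q(n,(k\lambda D_t)^{-1})$, the forward-filtered posterior $\Phi_t\mid y_{1:t}\sim \mathrm{Wishart}_q(n+k,(kD_t)^{-1})$ (for $t=0$, the initial prior),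 and the same one-step-ahead forecast distribution $y_{t+1}\mid y_{1:t}$, namely the mixture of $\mathrm{Wishart}_q(k,(k\Phi)^{-1})$ over $\Phi\sim\mathrm{Wishart}_q(n,(k\lambda D_t)^{-1})$. For every $T$, the law of $y_{1:T}$ is the same in both models; the two marginal likelihoods are densities of this law with respect to the product of the reference measures of the Wishart densities, and they are equal at every $T$-tuple of positive-semidefinite matrices. **(b)** The map $(n,k,\lambda,D_0)\mapsto(n+k,\,k,\,n/(n+k),\,\lambda,\,D_0)$ is a bijection from the UE hyperparameters onto the BB hyperparameters that satisfy $k_0=k/(1-\beta)$. **(c)** Consequently, for all positive-semidefinite $y_1,\dots,y_T$ and every set $S$ of UE hyperparameters, the maximisers of the BB marginal likelihood over the image of $S$ under this map are exactly the images of the maximisers of the UE marginal likelihood over $S$. -/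

import Mathlib

open MeasureTheory ProbabilityTheory Set
open scoped ENNReal Matrix

noncomputable section

namespace StochVol

/-- Real `q × q` matrices. -/
abbrev Mat (q : ℕ) : Type := Matrix (Fin q) (Fin q) ℝ

/-- Entrywise (product) sigma-algebra on matrices; here it is the Borel sigma-algebra. -/
instance instMeasurableSpaceMat (m n : Type) : MeasurableSpace (Matrix m n ℝ) :=
  MeasurableSpace.pi

/-! ### Wishart and matrix beta distributions -/

/-- The multivariate gamma function
`Γ_q(a) = π^{q(q-1)/4} ∏_{i=1}^{q} Γ(a - (i-1)/2)`. -/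
def multiGamma (q : ℕ) (a : ℝ) : ℝ :=
  Real.pi ^ ((q : ℝ) * ((q : ℝ) - 1) / 4) * ∏ i : Fin q, Real.Gamma (a - (i : ℝ) / 2)

/-- The symmetric matrix with prescribed entries on and above the diagonal. -/
def symOfUpper (q : ℕ) (v : {p : Fin q × Fin q // p.1 ≤ p.2} → ℝ) : Mat q :=
  Matrix.of fun i j => v ⟨(min i j, max i j), min_le_max⟩

/-- Lebesgue measure `∏_{i ≤ j} da_{ij}` on the cone of symmetric positive definite matrices. -/
def lebesguePosDef (q : ℕ) : Measure (Mat q) :=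
  ((volume : Measure ({p : Fin q × Fin q // p.1 ≤ p.2} → ℝ)).map (symOfUpper q)).restrict
    {A | A.PosDef}

/-- Image of Lebesgue measure on `q × m` matrices under `X ↦ X X'`. It lives on positive
semidefinite matrices of rank at most `m`. -/
def gramLebesgue (q m : ℕ) : Measure (Mat q) :=
  (volume : Measure (Fin q → Fin m → ℝ)).map fun X => Matrix.of X * (Matrix.of X)ᵀ

/-- Admissible degrees of freedom of a `q × q` Wishart distribution: a positive integer less
than `q`, or a real number greater than `q - 1`. -/
def WishartDof (q : ℕ) (k : ℝ) : Prop :=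
  (∃ m : ℕ, 0 < m ∧ m < q ∧ k = m) ∨ (q : ℝ) - 1 < k

/-- Reference measure of the Wishart distributions with `k` degrees of freedom: Lebesgue measure
on positive definite matrices if `k > q - 1`; in the rank-deficient case of an integer `k < q`,
the image under `X ↦ X X'` of Lebesgue measure on `q × k` matrices. -/
def wishartBase (q : ℕ) (k : ℝ) : Measure (Mat q) :=
  if (q : ℝ) - 1 < k then lebesguePosDef q else gramLebesgue q ⌊k⌋₊

/-- Density of `Wishart_q(k, S)` with respect to `wishartBase q k`. For `k > q - 1` this is
`2^{-kq/2} |S|^{-k/2} Γ_q(k/2)^{-1} |A|^{(k-q-1)/2} exp(-tr(S⁻¹A)/2)`. For an integer `k < q`,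
`Wishart_q(k, S)` is the law of `X X'` where the `k` columns of `X` are independent `N_q(0, S)`,
and the joint Gaussian density of the columns,
`(2π)^{-kq/2} |S|^{-k/2} exp(-tr(S⁻¹ X X')/2)`, depends on `X` through `A = X X'` only. -/
def wishartPDF (q : ℕ) (k : ℝ) (S A : Mat q) : ℝ :=
  if (q : ℝ) - 1 < k then
    2 ^ (-(k * q / 2)) * S.det ^ (-(k / 2)) * (multiGamma q (k / 2))⁻¹ *
      A.det ^ ((k - q - 1) / 2) * Real.exp (-(S⁻¹ * A).trace / 2)
  else
    (2 * Real.pi) ^ (-(k * q / 2)) * S.det ^ (-(k / 2)) * Real.exp (-(S⁻¹ * A).trace / 2)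

/-- The distribution `Wishart_q(k, S)`. -/
def wishart (q : ℕ) (k : ℝ) (S : Mat q) : Measure (Mat q) :=
  (wishartBase q k).withDensity fun A => ENNReal.ofReal (wishartPDF q k S A)

/-- `R` is the upper-triangular Cholesky factor of `A`. -/
def IsUpperCholesky {q : ℕ} (A R : Mat q) : Prop :=
  (∀ i j, j < i → R i j = 0) ∧ (∀ i, 0 < R i i) ∧ Rᵀ * R = A

open Classical in
/-- `uchol A`, the upper-triangular Cholesky factor of a symmetric positive definite matrix
(and `0` for all other matrices). -/
def uchol {q : ℕ} (A : Mat q) : Mat q :=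
  if h : ∃ R, IsUpperCholesky A R then h.choose else 0

/-- `MatrixBeta_q(n/2, k/2)`: the law of `(T⁻¹)' A₁ T⁻¹`, `T = uchol (A₁ + A₂)`, where
`A₁ ∼ Wishart_q(n, I)` and `A₂ ∼ Wishart_q(k, I)` are independent. (Replacing `I` by another
positive definite scale matrix, common to `A₁` and `A₂`, gives the same law.)
The arguments `n`, `k` are twice the two parameters of the distribution. -/
def matrixBeta (q : ℕ) (n k : ℝ) : Measure (Mat q) :=
  ((wishart q n 1).prod (wishart q k 1)).map fun A =>
    ((uchol (A.1 + A.2))⁻¹)ᵀ * A.1 * (uchol (A.1 + A.2))⁻¹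

/-! ### State-space models -/

/-- `(Φ_{0:t}, y_{1:t})`. The observation `y_{j+1}` is stored at index `j`. -/
abbrev Path (q t : ℕ) : Type := (Fin (t + 1) → Mat q) × (Fin t → Mat q)

/-- Append the next state `Φ_{t+1}` and the next observation `y_{t+1}`. -/
def Path.extend {q t : ℕ} (h : Path q t) (Φ y : Mat q) : Path q (t + 1) :=
  (Fin.snoc (α := fun _ => Mat q) h.1 Φ, Fin.snoc (α := fun _ => Mat q) h.2 y)

/-- Joint law of `(Φ_{0:t}, y_{1:t})` when `Φ_0 ∼ init`, `Φ_{t+1}` given the past has law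
`trans t y_{1:t} Φ_t`, and `y_{t+1}` given the past and `Φ_{t+1}` has law `obs Φ_{t+1}`. -/
def ssmLaw {q : ℕ} (init : Measure (Mat q))
    (trans : (t : ℕ) → (Fin t → Mat q) → Mat q → Measure (Mat q))
    (obs : Mat q → Measure (Mat q)) : (t : ℕ) → Measure (Path q t)
  | 0 => init.map fun Φ => (fun _ => Φ, Fin.elim0)
  | t + 1 => (ssmLaw init trans obs t).bind fun h =>
      (trans t h.2 (h.1 (Fin.last t))).bind fun Φ => (obs Φ).map fun y => h.extend Φ y

/-- Law of the states `Φ_{0:t}` generated by `init` and the evolution `trans`, with the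
observations that enter the evolution held fixed at `y_{1:t}`. -/
def stateLaw {q : ℕ} (init : Measure (Mat q))
    (trans : (t : ℕ) → (Fin t → Mat q) → Mat q → Measure (Mat q)) :
    (t : ℕ) → (Fin t → Mat q) → Measure (Fin (t + 1) → Mat q)
  | 0, _ => init.map fun Φ _ => Φ
  | t + 1, y => (stateLaw init trans t (Fin.init y)).bind fun h =>
      (trans t (Fin.init y) (h (Fin.last t))).map fun Φ =>
        Fin.snoc (α := fun _ => Mat q) h Φ

/-- The marginal likelihood `p(y_{1:t}) = ∫ ∏_j p(y_j | Φ_j) p(Φ_0) ∏_j p(dΦ_j | Φ_{j-1}, y_{1:j-1})`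
of the Wishart observation model `y_j | Φ_j ∼ Wishart_q(k, (k Φ_j)⁻¹)`. -/
def marginalLikelihood {q : ℕ} (k : ℝ) (init : Measure (Mat q))
    (trans : (t : ℕ) → (Fin t → Mat q) → Mat q → Measure (Mat q))
    (t : ℕ) (y : Fin t → Mat q) : ℝ≥0∞ :=
  ∫⁻ Φ, ∏ j : Fin t, ENNReal.ofReal (wishartPDF q k (k • Φ j.succ)⁻¹ (y j))
    ∂(stateLaw init trans t y)

/-- The recursion `D_t = c D_{t-1} + y_t` started at `D_0`. -/
def scale {q : ℕ} (c : ℝ) (D0 : Mat q) : (t : ℕ) → (Fin t → Mat q) → Mat q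
  | 0, _ => D0
  | t + 1, y => c • scale c D0 t (Fin.init y) + y (Fin.last t)

/-- Under `P`, the regular conditional distribution of `Y` given `X = x` is the probability
measure `κ x`, for almost every value `x` of `X`. -/
def HasCondLaw {Ω E F : Type*} [MeasurableSpace Ω] [MeasurableSpace E] [MeasurableSpace F]
    (Y : Ω → E) (X : Ω → F) (κ : F → Measure E) (P : Measure Ω) : Prop :=
  ∃ K : Kernel F E, IsMarkovKernel K ∧ HasCondDistrib Y X K P ∧ ∀ᵐ x ∂(P.map X), K x = κ x

/-! ### The Uhlig extended process -/

/-- Hyperparameters of the Uhlig extended model. -/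
structure UEParam (q : ℕ) where
  n : ℝ
  k : ℝ
  lam : ℝ
  D0 : Mat q

namespace UEParam

variable {q : ℕ}

/-- The parameter range of the Uhlig extended model. -/
def Admissible (θ : UEParam q) : Prop :=
  (q : ℝ) - 1 < θ.n ∧ WishartDof q θ.k ∧ 0 < θ.lam ∧ θ.lam < 1 ∧ θ.D0.PosDef

/-- `Φ_0 ∼ Wishart_q(n + k, (k D_0)⁻¹)`. -/
def init (θ : UEParam q) : Measure (Mat q) := wishart q (θ.n + θ.k) (θ.k • θ.D0)⁻¹

/-- Law of `Φ_t = (U P)' Ψ_t (U P) / λ` given `Φ_{t-1} = (U P)' (U P)`, where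
`Ψ_t ∼ MatrixBeta_q(n/2, k/2)`. In the Bartlett decomposition `U` and `P` are upper triangular
with positive diagonal, so that `U P = uchol Φ_{t-1}`. -/
def trans (θ : UEParam q) (_t : ℕ) (_y : Fin _t → Mat q) (Φ : Mat q) : Measure (Mat q) :=
  (matrixBeta q θ.n θ.k).map fun Ψ => θ.lam⁻¹ • ((uchol Φ)ᵀ * Ψ * uchol Φ)

/-- Joint law of `(Φ_{0:t}, y_{1:t})` in the Uhlig extended model. -/
def law (θ : UEParam q) (t : ℕ) : Measure (Path q t) :=
  ssmLaw θ.init θ.trans (fun Φ => wishart q θ.k (θ.k • Φ)⁻¹) t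

/-- Marginal likelihood of `y_{1:t}` in the Uhlig extended model. -/
def likelihood (θ : UEParam q) (t : ℕ) (y : Fin t → Mat q) : ℝ≥0∞ :=
  marginalLikelihood θ.k θ.init θ.trans t y

end UEParam

/-! ### The beta-Bartlett process -/

/-- Hyperparameters of the beta-Bartlett model. -/
structure BBParam (q : ℕ) where
  k0 : ℝ
  k : ℝ
  β : ℝ
  b : ℝ
  D0 : Mat q

namespace BBParam

variable {q : ℕ}

/-- `k_t = β k_{t-1} + k`. -/
def dof (ϑ : BBParam q) : ℕ → ℝ
  | 0 => ϑ.k0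
  | t + 1 => ϑ.β * dof ϑ t + ϑ.k

/-- The parameter range of the beta-Bartlett model. The last condition says that all the beta
distributions in the evolution have positive parameters. -/
def Admissible (ϑ : BBParam q) : Prop :=
  0 < ϑ.k0 ∧ WishartDof q ϑ.k ∧ 0 < ϑ.β ∧ ϑ.β < 1 ∧ 0 < ϑ.b ∧ ϑ.b < 1 ∧ ϑ.D0.PosDef ∧
    ∀ t, (q : ℝ) - 1 < ϑ.β * ϑ.dof t

/-- `Φ_0 ∼ Wishart_q(k_0, (k D_0)⁻¹)`. -/
def init (ϑ : BBParam q) : Measure (Mat q) := wishart q ϑ.k0 (ϑ.k • ϑ.D0)⁻¹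

/-- `P_t = uchol ((k D_t)⁻¹)`, where `D_t = b D_{t-1} + y_t`. -/
def bartlettP (ϑ : BBParam q) (t : ℕ) (y : Fin t → Mat q) : Mat q :=
  uchol (ϑ.k • scale ϑ.b ϑ.D0 t y)⁻¹

/-- The factor `U_t` of the Bartlett decomposition `Φ_t = (U_t P_t)' (U_t P_t)`. -/
def bartlettU (ϑ : BBParam q) (t : ℕ) (y : Fin t → Mat q) (Φ : Mat q) : Mat q :=
  uchol Φ * (ϑ.bartlettP t y)⁻¹

/-- The matrix with off-diagonal entries `u_{ij}` and diagonal entries `√η_i u_{ii}`. -/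
def shrinkDiag (η : Fin q → ℝ) (U : Mat q) : Mat q :=
  Matrix.of fun i j => if i = j then √(η i) * U i i else U i j

/-- Law of `Φ_{t+1} = (Ũ P_t)' (Ũ P_t) / b` given `Φ_t = (U_t P_t)' (U_t P_t)`, where `Ũ` is
`U_t` with its diagonal entries multiplied by `√η_i`, and the `η_i`, `1 ≤ i ≤ q`, are
independent `Beta((β k_t - i + 1)/2, (1 - β) k_t / 2)`. -/
def trans (ϑ : BBParam q) (t : ℕ) (y : Fin t → Mat q) (Φ : Mat q) : Measure (Mat q) :=
  (Measure.pi fun i : Fin q =>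
    betaMeasure ((ϑ.β * ϑ.dof t - (i : ℝ)) / 2) ((1 - ϑ.β) * ϑ.dof t / 2)).map fun η =>
      ϑ.b⁻¹ • ((shrinkDiag η (ϑ.bartlettU t y Φ) * ϑ.bartlettP t y)ᵀ *
        (shrinkDiag η (ϑ.bartlettU t y Φ) * ϑ.bartlettP t y))

/-- Joint law of `(Φ_{0:t}, y_{1:t})` in the beta-Bartlett model. -/
def law (ϑ : BBParam q) (t : ℕ) : Measure (Path q t) :=
  ssmLaw ϑ.init ϑ.trans (fun Φ => wishart q ϑ.k (ϑ.k • Φ)⁻¹) t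

/-- Marginal likelihood of `y_{1:t}` in the beta-Bartlett model. -/
def likelihood (ϑ : BBParam q) (t : ℕ) (y : Fin t → Mat q) : ℝ≥0∞ :=
  marginalLikelihood ϑ.k ϑ.init ϑ.trans t y

end BBParam

/-- The change of hyperparameters `k_0 = n + k`, `β = n / (n + k)`, `b = λ`, `D₀ᴮ = D₀ᵁ`
(with the same `k` in both likelihoods). -/
def UEParam.toBB {q : ℕ} (θ : UEParam q) : BBParam q where
  k0 := θ.n + θ.k
  k := θ.k
  β := θ.n / (θ.n + θ.k)
  b := θ.lam
  D0 := θ.D0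

/-- The law `L` of `(Φ_{0:t+1}, y_{1:t+1})` has `Φ_{t+1} | y_{1:t} ∼ κ(y_{1:t})`. -/
def HasPrior {q t : ℕ} (L : Measure (Path q (t + 1))) (κ : (Fin t → Mat q) → Measure (Mat q)) :
    Prop :=
  HasCondLaw (fun h => h.1 (Fin.last (t + 1))) (fun h => (Fin.init h.2 : Fin t → Mat q)) κ L

/-- The law `L` of `(Φ_{0:t}, y_{1:t})` has `Φ_t | y_{1:t} ∼ κ(y_{1:t})`. -/
def HasPosterior {q t : ℕ} (L : Measure (Path q t)) (κ : (Fin t → Mat q) → Measure (Mat q)) :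
    Prop :=
  HasCondLaw (fun h => h.1 (Fin.last t)) (fun h => h.2) κ L

/-- The law `L` of `(Φ_{0:t+1}, y_{1:t+1})` has `y_{t+1} | y_{1:t} ∼ κ(y_{1:t})`. -/
def HasForecast {q t : ℕ} (L : Measure (Path q (t + 1)))
    (κ : (Fin t → Mat q) → Measure (Mat q)) : Prop :=
  HasCondLaw (fun h => h.2 (Fin.last t)) (fun h => (Fin.init h.2 : Fin t → Mat q)) κ L

end StochVol

end

/-! Both models run the same Bayesian recursion on Wishart laws and differ only in how the state
moves. If the filtered law of `Φ_t` is `Wishart(n + k, S)` with `S = (k D_t)⁻¹`, each evolution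
carries it to `Wishart(n, S/λ)`. Observing `y_{t+1}` multiplies this prior by a Wishart likelihood
in the precision, which returns `Wishart(n + k, (k D_{t+1})⁻¹)` with `D_{t+1} = λ D_t + y_{t+1}`.

Uhlig evolution (`wishart_bind_matrixBeta`). Let `A₁` and `A₂` be independent with laws `Wishart(n,
S)` and `Wishart(k, S)`. Their sum is `Wishart(n + k, S)` and is independent of the ratio `(T⁻¹)' A₁
T⁻¹`, whose law does not depend on `S` (`map_sumRatio`). So `(Φ, Ψ)` may be replaced by (sum,
ratio), and `uchol(Φ)' Ψ uchol(Φ)` becomes `A₁`. The singular case `k < q` is covered by working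
with a measure that scales by `|T|^{-k}` under `A ↦ T'AT` (`lintegral_wishartHom_congr`), available
for both kinds of degrees of freedom.

Beta-Bartlett evolution (`wishart_bind_shrinkDiag`). With `S = P'P`, a `Wishart(n + k, S)` matrix is
`(UP)'(UP)` with independent entries in `U`: standard normal above the diagonal, chi with `n + k -
i` degrees of freedom at the `i`-th diagonal place, `i` counted from `0` (`wishart_one_eq_map`). The
product of independent Beta and Gamma variables being Gamma, the factor `√η_i` lowers the degrees of
freedom to `n - i`. Under the change of hyperparameters `β k_t = n` and `(1 - β) k_t = k` for all
`t`, so these are the beta laws of the model.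

The two kernels are never compared with each other. `UEParam.IsConjugateEvolution` records only that
an evolution sends the filtered law to the prior. Induction then shows, for every fixed positive
semidefinite data sequence, that the likelihood-weighted law of the last state is a scalar times the
filtered law, the scalar being a product of forecast densities
(`IsConjugateEvolution.lintegral_stateLaw`). Priors, posteriors, forecasts, the law of the data and
the pointwise equality of likelihoods follow from this. Part (b) is algebra: `k_0 = k/(1 - β)` says
that `k_0` is the fixed point of `k_t = β k_{t-1} + k`. Part (c) is formal. -/

noncomputable section

namespace StochVol

variable {q : ℕ}

/-! ### Measurability of matrix operations; the Cholesky factor. -/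

/-- Upper triangular matrices with positive diagonal. -/
def IsPosUpper {q : ℕ} (R : Mat q) : Prop :=
  (∀ i j, j < i → R i j = 0) ∧ ∀ i, 0 < R i i

instance instBorelSpaceMat (m n : Type) [Finite m] [Finite n] : BorelSpace (Matrix m n ℝ) :=
  have := Fintype.ofFinite m
  have := Fintype.ofFinite n
  inferInstanceAs (BorelSpace (m → n → ℝ))

instance instSecondCountableMat (m n : Type) [Finite m] [Finite n] :
    SecondCountableTopology (Matrix m n ℝ) :=
  have := Fintype.ofFinite m
  have := Fintype.ofFinite n
  inferInstanceAs (SecondCountableTopology (m → n → ℝ))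

section Measurability

variable {m n : Type} {α : Type*} [MeasurableSpace α]

lemma measurable_matrix_iff {f : α → Matrix m n ℝ} :
    Measurable f ↔ ∀ i j, Measurable fun x => f x i j := by
  constructor
  · intro h i j
    exact (measurable_pi_apply j).comp ((measurable_pi_apply (X := fun _ => n → ℝ) i).comp h)
  · intro h
    exact measurable_pi_lambda _ fun i => measurable_pi_lambda _ fun j => h i j

lemma measurable_entry (i : m) (j : n) : Measurable fun A : Matrix m n ℝ => A i j :=
  measurable_matrix_iff.1 measurable_id i j

lemma measurable_matrix_mul {l : Type} [Fintype m] {f : α → Matrix l m ℝ}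
    {g : α → Matrix m n ℝ} (hf : Measurable f) (hg : Measurable g) :
    Measurable fun x => f x * g x := by
  rw [measurable_matrix_iff] at *
  intro i j
  simp only [Matrix.mul_apply]
  exact Finset.measurable_sum _ fun k _ => (hf i k).mul (hg k j)

lemma measurable_matrix_transpose {f : α → Matrix m n ℝ} (hf : Measurable f) :
    Measurable fun x => (f x)ᵀ := by
  rw [measurable_matrix_iff] at *
  exact fun i j => hf j i

lemma measurable_matrix_add {f g : α → Matrix m n ℝ} (hf : Measurable f) (hg : Measurable g) :
    Measurable fun x => f x + g x := by
  rw [measurable_matrix_iff] at *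
  exact fun i j => (hf i j).add (hg i j)

lemma measurable_matrix_sub {f g : α → Matrix m n ℝ} (hf : Measurable f) (hg : Measurable g) :
    Measurable fun x => f x - g x := by
  rw [measurable_matrix_iff] at *
  exact fun i j => (hf i j).sub (hg i j)

lemma measurable_matrix_smul {c : ℝ} {f : α → Matrix m n ℝ} (hf : Measurable f) :
    Measurable fun x => c • f x := by
  rw [measurable_matrix_iff] at *
  exact fun i j => (hf i j).const_mul c

variable [Fintype n]

lemma measurable_matrix_trace {f : α → Matrix n n ℝ} (hf : Measurable f) :
    Measurable fun x => (f x).trace :=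
  (continuous_id.matrix_trace (A := fun A : Matrix n n ℝ => A)).measurable.comp hf

variable [DecidableEq n]

lemma measurable_matrix_det {f : α → Matrix n n ℝ} (hf : Measurable f) :
    Measurable fun x => (f x).det :=
  (continuous_id.matrix_det (A := fun A : Matrix n n ℝ => A)).measurable.comp hf

lemma measurable_matrix_inv {f : α → Matrix n n ℝ} (hf : Measurable f) :
    Measurable fun x => (f x)⁻¹ := by
  have : Measurable fun A : Matrix n n ℝ => A⁻¹ := by
    rw [measurable_matrix_iff]
    intro i j
    simp only [Matrix.inv_def, Matrix.smul_apply, smul_eq_mul, Ring.inverse_eq_inv']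
    exact (measurable_matrix_det measurable_id).inv.mul
      ((measurable_entry i j).comp
        (continuous_id.matrix_adjugate (A := fun A : Matrix n n ℝ => A)).measurable)
  exact this.comp hf

end Measurability

lemma measurableSet_posSemidef : MeasurableSet {A : Mat q | A.PosSemidef} := by
  have : {A : Mat q | A.PosSemidef} =
      {A | Aᵀ = A} ∩ ⋂ x : Fin q → ℝ, {A | 0 ≤ x ⬝ᵥ A *ᵥ x} := by
    ext A
    simp [Matrix.posSemidef_iff_dotProduct_mulVec, Matrix.IsHermitian]
  rw [this]
  refine IsClosed.measurableSet (IsClosed.inter ?_ (isClosed_iInter fun x => ?_))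
  · exact isClosed_eq (continuous_id.matrix_transpose) continuous_id
  · refine isClosed_le continuous_const ?_
    exact continuous_const.dotProduct (continuous_id.matrix_mulVec continuous_const)

lemma measurableSet_posDef : MeasurableSet {A : Mat q | A.PosDef} := by
  have : {A : Mat q | A.PosDef} = {A | A.PosSemidef} ∩ {A | A.det ≠ 0} := by
    ext A
    constructor
    · intro h
      exact ⟨h.posSemidef, h.det_pos.ne'⟩
    · rintro ⟨h, h'⟩
      exact h.posDef_iff_det_ne_zero.2 h'
  rw [this]
  exact measurableSet_posSemidef.inter
    ((measurable_matrix_det measurable_id) (measurableSet_singleton 0).compl)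

namespace IsPosUpper

lemma det_eq {R : Mat q} (h : IsPosUpper R) : R.det = ∏ i, R i i :=
  Matrix.det_of_isUpperTriangular fun i j hij => h.1 i j hij

lemma det_pos {R : Mat q} (h : IsPosUpper R) : 0 < R.det := by
  rw [h.det_eq]
  exact Finset.prod_pos fun i _ => h.2 i

lemma isUnit_det {R : Mat q} (h : IsPosUpper R) : IsUnit R.det := h.det_pos.ne'.isUnit

lemma mul_apply_diag {R Q : Mat q} (hR : IsPosUpper R) (hQ : IsPosUpper Q) (i : Fin q) :
    (R * Q) i i = R i i * Q i i := by
  rw [Matrix.mul_apply]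
  refine Finset.sum_eq_single i (fun k _ hk => ?_) (by simp)
  rcases lt_or_gt_of_ne hk with h | h
  · rw [hR.1 i k h, zero_mul]
  · rw [hQ.1 k i h, mul_zero]

lemma mul {R Q : Mat q} (hR : IsPosUpper R) (hQ : IsPosUpper Q) : IsPosUpper (R * Q) := by
  constructor
  · intro i j hij
    rw [Matrix.mul_apply]
    refine Finset.sum_eq_zero fun k _ => ?_
    rcases lt_or_ge k i with h | h
    · rw [hR.1 i k h, zero_mul]
    · rw [hQ.1 k j (hij.trans_le h), mul_zero]
  · intro i
    rw [hR.mul_apply_diag hQ]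
    exact mul_pos (hR.2 i) (hQ.2 i)

lemma smul_one {c : ℝ} (hc : 0 < c) : IsPosUpper (c • (1 : Mat q)) := by
  constructor
  · intro i j hij
    simp [Matrix.one_apply_ne hij.ne']
  · intro i
    simpa using hc

lemma mulVec_injective {R : Mat q} (h : IsPosUpper R) : Function.Injective R.mulVec :=
  Matrix.mulVec_injective_iff_isUnit.2 ((Matrix.isUnit_iff_isUnit_det R).2 h.isUnit_det)

lemma isUnit {R : Mat q} (h : IsPosUpper R) : IsUnit R :=
  (Matrix.isUnit_iff_isUnit_det R).2 h.isUnit_det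

lemma posDef {R : Mat q} (h : IsPosUpper R) : (Rᵀ * R).PosDef := by
  have := Matrix.PosDef.conjTranspose_mul_self R h.mulVec_injective
  rwa [Matrix.conjTranspose_eq_transpose_of_trivial] at this

lemma posDef_conj {R A : Mat q} (h : IsPosUpper R) (hA : A.PosDef) : (Rᵀ * A * R).PosDef := by
  have := hA.conjTranspose_mul_mul_same h.mulVec_injective
  rwa [Matrix.conjTranspose_eq_transpose_of_trivial] at this

lemma posDef_conj_iff {R A : Mat q} (h : IsPosUpper R) : (Rᵀ * A * R).PosDef ↔ A.PosDef := by
  have := Matrix.IsUnit.posDef_star_left_conjugate_iff (x := A) h.isUnit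
  rwa [Matrix.star_eq_conjTranspose, Matrix.conjTranspose_eq_transpose_of_trivial] at this

/-- The entries of `R'R` on and above the diagonal, for upper triangular `R`. -/
lemma gram_apply {R : Mat q} (h : ∀ i j, j < i → R i j = 0) (i j : Fin q) :
    (Rᵀ * R) i j = ∑ l ∈ Finset.Iio i, R l i * R l j + R i i * R i j := by
  rw [Matrix.mul_apply, ← Finset.sum_subset (Finset.subset_univ (Finset.Iic i)),
    ← Finset.Iio_insert, Finset.sum_insert (by simp), add_comm]
  · rfl
  · intro l _ hl
    simp only [Finset.mem_Iic, not_le] at hl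
    simp [h l i hl]

end IsPosUpper

lemma isUpperCholesky_iff {A R : Mat q} : IsUpperCholesky A R ↔ IsPosUpper R ∧ Rᵀ * R = A := by
  simp [IsUpperCholesky, IsPosUpper, and_assoc]

/-- Induction on rows: once the earlier rows agree, row `i` of `R'R` gives the products `R i i * R i
j`. The case `j = i` fixes `R i i`, by positivity, and then the rest of the row. -/
lemma IsPosUpper.gram_injective {R Q : Mat q} (hR : IsPosUpper R) (hQ : IsPosUpper Q)
    (h : Rᵀ * R = Qᵀ * Q) : R = Q := by
  have key : ∀ i : Fin q, ∀ j, R i j = Q i j := by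
    intro i
    induction i using WellFoundedLT.induction with
    | ind i ih =>
      have e : ∀ j, R i i * R i j = Q i i * Q i j := by
        intro j
        have h1 := congrFun (congrFun h i) j
        rw [IsPosUpper.gram_apply hR.1, IsPosUpper.gram_apply hQ.1] at h1
        have h2 : ∑ l ∈ Finset.Iio i, R l i * R l j = ∑ l ∈ Finset.Iio i, Q l i * Q l j :=
          Finset.sum_congr rfl fun l hl => by rw [ih l (Finset.mem_Iio.1 hl), ih l (Finset.mem_Iio.1 hl)]
        linarith
      have hd : R i i = Q i i := by
        have := e i
        nlinarith [hR.2 i, hQ.2 i]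
      intro j
      have := e j
      rw [hd] at this
      exact mul_left_cancel₀ (hQ.2 i).ne' this
  ext i j
  exact key i j

lemma exists_posUpper {A : Mat q} (hA : A.PosDef) : ∃ R, IsPosUpper R ∧ Rᵀ * R = A := by
  set L := LDL.lower hA
  have hinv : Invertible (LDL.lowerInv hA) := inferInstance
  have hL : ∀ i j, i < j → L i j = 0 := by
    have h1 : (LDL.lowerInv hA).BlockTriangular OrderDual.toDual := fun i j hij =>
      LDL.lowerInv_triangular hA hij
    have h2 := Matrix.blockTriangular_inv_of_blockTriangular h1
    exact fun i j hij => h2 hij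
  have hD : (LDL.diag hA).PosDef := by
    rw [LDL.diag_eq_lowerInv_conj hA]
    have := hA.conjTranspose_mul_mul_same (B := (LDL.lowerInv hA)ᴴ)
      (Matrix.mulVec_injective_iff_isUnit.2
        ((Matrix.isUnit_conjTranspose _).2 (isUnit_of_invertible (LDL.lowerInv hA))))
    simpa using this
  have hd : ∀ i, 0 < LDL.diagEntries hA i := by
    simpa [LDL.diag, Matrix.posDef_diagonal_iff] using hD
  have hLd : ∀ i, L i i ≠ 0 := by
    have hdet : L.det ≠ 0 := by
      have : IsUnit L := by
        simp only [L, LDL.lower]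
        exact (Matrix.isUnit_nonsing_inv_iff).2 (isUnit_of_invertible (LDL.lowerInv hA))
      exact ((Matrix.isUnit_iff_isUnit_det L).1 this).ne_zero
    rw [Matrix.det_of_isLowerTriangular L fun i j hij => hL i j hij] at hdet
    exact fun i => Finset.prod_ne_zero_iff.1 hdet i (Finset.mem_univ i)
  -- From `A = L D L'`, the candidate is `√D L'`. Its diagonal is only known to be nonzero, so row
  -- `i` is also multiplied by the sign of `L i i`; this leaves the Gram matrix unchanged.
  refine ⟨Matrix.of fun i j => SignType.sign (L i i) * √(LDL.diagEntries hA i) * L j i,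
    ⟨fun i j hij => by simp [hL j i hij], fun i => ?_⟩, ?_⟩
  · have h1 : (SignType.sign (L i i) : ℝ) * L i i = |L i i| := sign_mul_self _
    have h2 := Real.sqrt_pos.2 (hd i)
    have h3 := abs_pos.2 (hLd i)
    simp only [Matrix.of_apply]
    calc 0 < √(LDL.diagEntries hA i) * |L i i| := mul_pos h2 h3
      _ = _ := by rw [← h1]; ring
  · conv_rhs => rw [← LDL.lower_conj_diag hA]
    ext i j
    rw [Matrix.mul_apply, Matrix.mul_apply]
    refine Finset.sum_congr rfl fun l _ => ?_
    simp only [Matrix.transpose_apply, Matrix.of_apply, LDL.diag, Matrix.mul_diagonal,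
      Matrix.conjTranspose_apply, star_trivial]
    have h1 : (SignType.sign (L l l) : ℝ) * SignType.sign (L l l) = 1 := by
      rcases lt_or_gt_of_ne (hLd l) with h | h <;> simp [h]
    have h2 := Real.mul_self_sqrt (hd l).le
    calc _ = ((SignType.sign (L l l) : ℝ) * SignType.sign (L l l)) *
          (√(LDL.diagEntries hA l) * √(LDL.diagEntries hA l)) * (L i l * L j l) := by ring
      _ = _ := by rw [h1, h2]; ring

lemma uchol_spec {A : Mat q} (hA : A.PosDef) :
    IsPosUpper (uchol A) ∧ (uchol A)ᵀ * uchol A = A := by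
  have h : ∃ R, IsUpperCholesky A R := by
    obtain ⟨R, hR⟩ := exists_posUpper hA
    exact ⟨R, isUpperCholesky_iff.2 hR⟩
  rw [uchol, dif_pos h]
  exact isUpperCholesky_iff.1 h.choose_spec

lemma uchol_of_not_posDef {A : Mat q} (hA : ¬ A.PosDef) : uchol A = 0 := by
  rw [uchol, dif_neg]
  rintro ⟨R, hR⟩
  obtain ⟨h1, h2⟩ := isUpperCholesky_iff.1 hR
  exact hA (h2 ▸ h1.posDef)

lemma uchol_gram {R : Mat q} (hR : IsPosUpper R) : uchol (Rᵀ * R) = R :=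
  (uchol_spec hR.posDef).1.gram_injective hR (uchol_spec hR.posDef).2

/-- `uchol` is defined by choice, so measurability rests on the explicit recursion satisfied by its
entries: each row is obtained from the earlier rows by a square root and a division. Off the
positive definite matrices `uchol` is `0`. -/
lemma measurable_uchol : Measurable (uchol : Mat q → Mat q) := by
  classical
  rw [measurable_matrix_iff]
  intro i
  induction i using WellFoundedLT.induction with
  | ind i ih =>
    have hd : Measurable fun A : Mat q => uchol A i i := by
      have : (fun A : Mat q => uchol A i i) = fun A => if A.PosDef then
          √(A i i - ∑ l ∈ Finset.Iio i, uchol A l i * uchol A l i) else 0 := by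
        ext A
        split_ifs with h
        · obtain ⟨h1, h2⟩ := uchol_spec h
          have h3 := congrFun (congrFun h2 i) i
          rw [IsPosUpper.gram_apply h1.1] at h3
          rw [← h3, add_sub_cancel_left, Real.sqrt_mul_self (h1.2 i).le]
        · simp [uchol_of_not_posDef h]
      rw [this]
      refine Measurable.ite measurableSet_posDef ?_ measurable_const
      refine ((measurable_entry i i).sub (Finset.measurable_sum _ fun l hl => ?_)).sqrt
      exact (ih l (Finset.mem_Iio.1 hl) i).mul (ih l (Finset.mem_Iio.1 hl) i)
    intro j
    have : (fun A : Mat q => uchol A i j) = fun A => if A.PosDef then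
        (A i j - ∑ l ∈ Finset.Iio i, uchol A l i * uchol A l j) / uchol A i i else 0 := by
      ext A
      split_ifs with h
      · obtain ⟨h1, h2⟩ := uchol_spec h
        have h3 := congrFun (congrFun h2 i) j
        rw [IsPosUpper.gram_apply h1.1] at h3
        rw [← h3, add_sub_cancel_left, mul_div_cancel_left₀ _ (h1.2 i).ne']
      · simp [uchol_of_not_posDef h]
    rw [this]
    refine Measurable.ite measurableSet_posDef (Measurable.div ?_ hd) measurable_const
    refine (measurable_entry i j).sub (Finset.measurable_sum _ fun l hl => ?_)
    exact (ih l (Finset.mem_Iio.1 hl) i).mul (ih l (Finset.mem_Iio.1 hl) j)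

/-! ### Triangular coordinates on symmetric matrices and their Jacobians. -/

/-- Index set of the entries on and above the diagonal. -/
abbrev UpperIndex (q : ℕ) : Type := {p : Fin q × Fin q // p.1 ≤ p.2}

section UpperIndexProducts

variable {M : Type*} [CommMonoid M]

lemma prod_upperIndex (F : Fin q → Fin q → M) :
    ∏ p : UpperIndex q, F p.1.1 p.1.2 = ∏ i, ∏ j, if i ≤ j then F i j else 1 := by
  rw [← Fintype.prod_prod_type' (f := fun i j => if i ≤ j then F i j else 1),
    ← Finset.prod_filter (fun p : Fin q × Fin q => p.1 ≤ p.2) (fun p => F p.1 p.2)]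
  exact (Finset.prod_subtype (p := fun p : Fin q × Fin q => p.1 ≤ p.2) _ (fun p => by simp)
    fun p => F p.1 p.2).symm

lemma prod_upperIndex_fst (f : Fin q → M) :
    ∏ p : UpperIndex q, f p.1.1 = ∏ i : Fin q, f i ^ (q - (i : ℕ)) := by
  rw [prod_upperIndex fun i _ => f i]
  refine Finset.prod_congr rfl fun i _ => ?_
  rw [← Finset.prod_filter, Finset.prod_const]
  congr 1
  rw [show (Finset.univ.filter fun j => i ≤ j) = Finset.Ici i by ext; simp, Fin.card_Ici]

lemma prod_upperIndex_snd (f : Fin q → M) :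
    ∏ p : UpperIndex q, f p.1.2 = ∏ i : Fin q, f i ^ ((i : ℕ) + 1) := by
  rw [prod_upperIndex fun _ j => f j, Finset.prod_comm]
  refine Finset.prod_congr rfl fun i _ => ?_
  rw [← Finset.prod_filter, Finset.prod_const]
  congr 1
  rw [show (Finset.univ.filter fun j => j ≤ i) = Finset.Iic i by ext; simp, Fin.card_Iic]

end UpperIndexProducts

/-- The congruence map and the derivative of `R ↦ R'R` are both triangular for the lexicographic
order on index pairs, so their determinants reduce to a product over the diagonal. -/
lemma det_of_lexTriangular (f : (UpperIndex q → ℝ) →ₗ[ℝ] UpperIndex q → ℝ)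
    (h : ∀ p r : UpperIndex q, toLex p.1 < toLex r.1 → f (Pi.single r 1) p = 0) :
    LinearMap.det f = ∏ p, f (Pi.single p 1) p := by
  rw [← LinearMap.det_toMatrix']
  let o : LinearOrder (UpperIndex q) := LinearOrder.lift' (fun p => toLex p.1)
    (fun p r hpr => Subtype.ext (toLex.injective hpr))
  have := @Matrix.det_of_isLowerTriangular (UpperIndex q) ℝ _ _ _ o (LinearMap.toMatrix' f)
    (fun p r hpr => by
      rw [LinearMap.toMatrix'_apply]
      convert! h p r hpr using 2)
  rw [this]
  exact Finset.prod_congr rfl fun p _ => by rw [LinearMap.toMatrix'_apply]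

lemma symOfUpper_single (r : UpperIndex q) (l m : Fin q) :
    symOfUpper q (Pi.single r 1) l m = if (min l m, max l m) = r.1 then 1 else 0 := by
  simp [symOfUpper, Pi.single_apply, Subtype.ext_iff]

lemma symOfUpper_transpose (v : UpperIndex q → ℝ) : (symOfUpper q v)ᵀ = symOfUpper q v := by
  ext i j
  simp [symOfUpper, min_comm, max_comm]

/-- The entries on and above the diagonal. -/
def upperEntries (A : Mat q) : UpperIndex q → ℝ := fun p => A p.1.1 p.1.2

lemma upperEntries_symOfUpper (v : UpperIndex q → ℝ) : upperEntries (symOfUpper q v) = v := by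
  ext p
  simp [upperEntries, symOfUpper, min_eq_left p.2, max_eq_right p.2]

lemma symOfUpper_upperEntries {A : Mat q} (hA : Aᵀ = A) : symOfUpper q (upperEntries A) = A := by
  ext i j
  simp only [upperEntries, symOfUpper, Matrix.of_apply]
  rcases le_total i j with h | h
  · rw [min_eq_left h, max_eq_right h]
  · rw [min_eq_right h, max_eq_left h]
    exact congrFun (congrFun hA i) j

lemma measurable_symOfUpper : Measurable (symOfUpper q) := by
  rw [measurable_matrix_iff]
  intro i j
  exact measurable_pi_apply _

lemma measurable_upperEntries : Measurable (upperEntries : Mat q → _) :=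
  measurable_pi_lambda _ fun _ => measurable_entry _ _

lemma symOfUpper_add (v w : UpperIndex q → ℝ) :
    symOfUpper q (v + w) = symOfUpper q v + symOfUpper q w := rfl

lemma symOfUpper_smul (c : ℝ) (v : UpperIndex q → ℝ) :
    symOfUpper q (c • v) = c • symOfUpper q v := rfl

/-- The congruence `A ↦ T'AT` of symmetric matrices, in the coordinates on and above the
diagonal. -/
def congrMap (T : Mat q) : (UpperIndex q → ℝ) →ₗ[ℝ] UpperIndex q → ℝ where
  toFun v := upperEntries (Tᵀ * symOfUpper q v * T)
  map_add' v w := by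
    rw [symOfUpper_add, Matrix.mul_add, Matrix.add_mul]
    rfl
  map_smul' c v := by
    rw [symOfUpper_smul, Matrix.mul_smul, Matrix.smul_mul]
    rfl

lemma symOfUpper_congrMap (T : Mat q) (v : UpperIndex q → ℝ) :
    symOfUpper q (congrMap T v) = Tᵀ * symOfUpper q v * T := by
  have h : (Tᵀ * symOfUpper q v * T)ᵀ = Tᵀ * symOfUpper q v * T := by
    simp [Matrix.transpose_mul, symOfUpper_transpose, Matrix.mul_assoc]
  exact symOfUpper_upperEntries h

/-- For triangular `T`, the entry `(i, j)` of `T'AT` involves only `A l m` with `l ≤ i`, `m ≤ j`,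
whence lexicographic triangularity, with diagonal coefficient `T i i * T j j`. Each index `i` occurs
`q - i` times as a row and `i + 1` times as a column, hence the exponent `q + 1`. -/
lemma det_congrMap {T : Mat q} (hT : IsPosUpper T) :
    LinearMap.det (congrMap T) = T.det ^ (q + 1) := by
  have hentry : ∀ p r : UpperIndex q, congrMap T (Pi.single r 1) p =
      ∑ m, ∑ l, T l p.1.1 * (if (min l m, max l m) = r.1 then 1 else 0) * T m p.1.2 := by
    intro p r
    simp only [congrMap, LinearMap.coe_mk, AddHom.coe_mk, upperEntries, Matrix.mul_apply,
      Matrix.transpose_apply, symOfUpper_single, Finset.sum_mul]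
  rw [det_of_lexTriangular]
  · have hdiag : ∀ p : UpperIndex q, congrMap T (Pi.single p 1) p = T p.1.1 p.1.1 * T p.1.2 p.1.2 := by
      rintro ⟨⟨i, j⟩, hij⟩
      rw [hentry]
      dsimp only at hij ⊢
      rw [Finset.sum_eq_single j, Finset.sum_eq_single i]
      · simp [min_eq_left hij, max_eq_right hij]
      · intro l _ hl
        by_cases h : l ≤ i
        · rw [if_neg, mul_zero, zero_mul]
          intro e
          rw [Prod.mk.injEq, min_eq_left (h.trans hij)] at e
          exact hl e.1
        · rw [hT.1 l i (not_le.1 h), zero_mul, zero_mul]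
      · simp
      · intro m _ hm
        refine Finset.sum_eq_zero fun l _ => ?_
        by_cases h : l ≤ i
        · by_cases h' : m ≤ j
          · rw [if_neg, mul_zero, zero_mul]
            intro e
            rw [Prod.mk.injEq] at e
            rcases le_total l m with h1 | h1
            · rw [max_eq_right h1] at e
              exact hm e.2
            · rw [max_eq_left h1, min_eq_right h1] at e
              have : m = j := le_antisymm h' (by rw [← e.2]; exact h.trans (e.1 ▸ le_rfl))
              exact hm this
          · rw [hT.1 m j (not_le.1 h'), mul_zero]
        · rw [hT.1 l i (not_le.1 h), zero_mul, zero_mul]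
      · simp
    rw [Finset.prod_congr rfl fun p _ => hdiag p, Finset.prod_mul_distrib,
      prod_upperIndex_fst (fun i => T i i), prod_upperIndex_snd (fun i => T i i),
      ← Finset.prod_mul_distrib, hT.det_eq, ← Finset.prod_pow]
    refine Finset.prod_congr rfl fun i _ => ?_
    rw [← pow_add]
    congr 1
    have := i.2
    omega
  · rintro ⟨⟨i, j⟩, hij⟩ ⟨⟨a, b⟩, hab⟩ hlt
    rw [hentry]
    refine Finset.sum_eq_zero fun m _ => Finset.sum_eq_zero fun l _ => ?_
    rw [Prod.Lex.toLex_lt_toLex] at hlt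
    dsimp only at hij hab hlt ⊢
    by_cases h : l ≤ i
    · by_cases h' : m ≤ j
      · rw [if_neg, mul_zero, zero_mul]
        intro e
        rw [Prod.mk.injEq] at e
        rcases le_total l m with h1 | h1
        · rw [max_eq_right h1, min_eq_left h1] at e
          omega
        · rw [max_eq_left h1, min_eq_right h1] at e
          omega
      · rw [hT.1 m j (not_le.1 h'), mul_zero]
    · rw [hT.1 l i (not_le.1 h), zero_mul, zero_mul]

/-- The upper triangular matrix with prescribed entries on and above the diagonal. -/
def triOfUpper (v : UpperIndex q → ℝ) : Mat q :=
  Matrix.of fun i j => if h : i ≤ j then v ⟨(i, j), h⟩ else 0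

lemma triOfUpper_lower (v : UpperIndex q → ℝ) (i j : Fin q) (h : j < i) :
    triOfUpper v i j = 0 := by
  simp [triOfUpper, not_le.2 h]

lemma triOfUpper_apply (v : UpperIndex q → ℝ) (p : UpperIndex q) :
    triOfUpper v p.1.1 p.1.2 = v p := by
  simp [triOfUpper, p.2]

lemma triOfUpper_single (r : UpperIndex q) (l m : Fin q) :
    triOfUpper (Pi.single r 1) l m = if (l, m) = r.1 then 1 else 0 := by
  by_cases h : l ≤ m
  · simp [triOfUpper, h, Pi.single_apply, Subtype.ext_iff]
  · rw [triOfUpper_lower _ _ _ (not_le.1 h), if_neg]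
    intro e
    have := r.2
    rw [← e] at this
    exact h this

lemma measurable_triOfUpper : Measurable (triOfUpper : (UpperIndex q → ℝ) → Mat q) := by
  rw [measurable_matrix_iff]
  intro i j
  simp only [triOfUpper, Matrix.of_apply]
  split_ifs
  · exact measurable_pi_apply _
  · exact measurable_const

/-- Coordinates of the upper triangular matrices with positive diagonal. -/
def posUpperSet (q : ℕ) : Set (UpperIndex q → ℝ) := {v | ∀ i, 0 < v ⟨(i, i), le_rfl⟩}

lemma measurableSet_posUpperSet : MeasurableSet (posUpperSet q) := by
  simp only [posUpperSet, ofPred_forall]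
  exact MeasurableSet.iInter fun i => measurableSet_lt measurable_const (measurable_pi_apply _)

lemma isPosUpper_triOfUpper {v : UpperIndex q → ℝ} (hv : v ∈ posUpperSet q) :
    IsPosUpper (triOfUpper v) :=
  ⟨triOfUpper_lower v, fun i => by simpa [triOfUpper] using hv i⟩

/-- `R ↦ R'R` in the coordinates on and above the diagonal. -/
def gramMap (v : UpperIndex q → ℝ) : UpperIndex q → ℝ :=
  upperEntries ((triOfUpper v)ᵀ * triOfUpper v)

lemma symOfUpper_gramMap (v : UpperIndex q → ℝ) :
    symOfUpper q (gramMap v) = (triOfUpper v)ᵀ * triOfUpper v :=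
  symOfUpper_upperEntries (by simp [Matrix.transpose_mul])

/-- The derivative of `gramMap`. -/
def gramDeriv (v : UpperIndex q → ℝ) : (UpperIndex q → ℝ) →ₗ[ℝ] UpperIndex q → ℝ where
  toFun h p := ∑ l, (triOfUpper v l p.1.1 * triOfUpper h l p.1.2 +
    triOfUpper v l p.1.2 * triOfUpper h l p.1.1)
  map_add' h h' := by
    ext p
    simp only [Pi.add_apply, ← Finset.sum_add_distrib]
    refine Finset.sum_congr rfl fun l _ => ?_
    have : ∀ a b, triOfUpper (h + h') a b = triOfUpper h a b + triOfUpper h' a b := by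
      intro a b
      simp only [triOfUpper, Matrix.of_apply]
      split_ifs <;> simp
    rw [this, this]
    ring
  map_smul' c h := by
    ext p
    simp only [Pi.smul_apply, smul_eq_mul, RingHom.id_apply, Finset.mul_sum]
    refine Finset.sum_congr rfl fun l _ => ?_
    have : ∀ a b, triOfUpper (c • h) a b = c * triOfUpper h a b := by
      intro a b
      simp only [triOfUpper, Matrix.of_apply]
      split_ifs <;> simp
    rw [this, this]
    ring

lemma hasFDerivAt_gramMap (v : UpperIndex q → ℝ) :
    HasFDerivAt gramMap (LinearMap.toContinuousLinearMap (gramDeriv v)) v := by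
  let e : Fin q → Fin q → ((UpperIndex q → ℝ) →L[ℝ] ℝ) := fun a b =>
    if h : a ≤ b then ContinuousLinearMap.proj ⟨(a, b), h⟩ else 0
  have he : ∀ a b w, e a b w = triOfUpper w a b := by
    intro a b w
    simp only [e, triOfUpper, Matrix.of_apply]
    split_ifs <;> simp
  have hd : ∀ a b, HasFDerivAt (fun w : UpperIndex q → ℝ => triOfUpper w a b) (e a b) v := by
    intro a b
    have := (e a b).hasFDerivAt (x := v)
    refine this.congr_of_eventuallyEq (Filter.Eventually.of_forall fun w => (he a b w).symm)
  rw [hasFDerivAt_pi']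
  intro p
  have := HasFDerivAt.fun_sum (u := Finset.univ) fun l (_ : l ∈ Finset.univ) =>
    (hd l p.1.1).mul (hd l p.1.2)
  convert! this using 1
  ext h
  simp only [ContinuousLinearMap.coe_comp, Function.comp_apply,
    LinearMap.coe_toContinuousLinearMap', ContinuousLinearMap.proj_apply, gramDeriv,
    LinearMap.coe_mk, AddHom.coe_mk, sum_apply, add_apply,
    smul_apply, smul_eq_mul, he]

/-- In `(R'R) i j` the lexicographically last variable is `R i j`. Its coefficient in the derivative
is `R i i`, doubled on the diagonal, where `R i i` enters squared. -/
lemma det_gramDeriv (v : UpperIndex q → ℝ) :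
    LinearMap.det (gramDeriv v) =
      ∏ p : UpperIndex q, (if p.1.1 = p.1.2 then 2 else 1) * v ⟨(p.1.1, p.1.1), le_rfl⟩ := by
  have hentry : ∀ p r : UpperIndex q, gramDeriv v (Pi.single r 1) p =
      ∑ l, (triOfUpper v l p.1.1 * (if (l, p.1.2) = r.1 then 1 else 0) +
        triOfUpper v l p.1.2 * (if (l, p.1.1) = r.1 then 1 else 0)) := by
    intro p r
    simp only [gramDeriv, LinearMap.coe_mk, AddHom.coe_mk, triOfUpper_single]
  rw [det_of_lexTriangular]
  · refine Finset.prod_congr rfl ?_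
    rintro ⟨⟨i, j⟩, hij⟩ -
    rw [hentry]
    dsimp only at hij ⊢
    rw [Finset.sum_eq_single i]
    · have : triOfUpper v i i = v ⟨(i, i), le_rfl⟩ := by simp [triOfUpper]
      by_cases h : i = j
      · subst h
        simp [this]
        ring
      · simp [this, h]
    · intro l _ hl
      simp [hl]
    · simp
  · rintro ⟨⟨i, j⟩, hij⟩ ⟨⟨a, b⟩, hab⟩ hlt
    rw [hentry]
    refine Finset.sum_eq_zero fun l _ => ?_
    rw [Prod.Lex.toLex_lt_toLex] at hlt
    dsimp only at hij hab hlt ⊢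
    have h1 : triOfUpper v l i * (if (l, j) = (a, b) then 1 else 0) = 0 := by
      by_cases h : l ≤ i
      · rw [if_neg, mul_zero]
        intro e
        rw [Prod.mk.injEq] at e
        omega
      · rw [triOfUpper_lower v l i (not_le.1 h), zero_mul]
    have h2 : triOfUpper v l j * (if (l, i) = (a, b) then 1 else 0) = 0 := by
      rw [if_neg, mul_zero]
      intro e
      rw [Prod.mk.injEq] at e
      omega
    rw [h1, h2, add_zero]

/-- Lebesgue measure on the symmetric matrices. -/
def lebesgueSym (q : ℕ) : Measure (Mat q) :=
  (volume : Measure (UpperIndex q → ℝ)).map (symOfUpper q)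

lemma lintegral_lebesgueSym {f : Mat q → ℝ≥0∞} (hf : Measurable f) :
    ∫⁻ A, f A ∂lebesgueSym q = ∫⁻ v, f (symOfUpper q v) :=
  lintegral_map hf measurable_symOfUpper

lemma lebesguePosDef_eq : lebesguePosDef q = (lebesgueSym q).restrict {A | A.PosDef} := rfl

lemma lintegral_lebesgueSym_congr {T : Mat q} (hT : IsPosUpper T) {f : Mat q → ℝ≥0∞}
    (hf : Measurable f) :
    ∫⁻ A, f (Tᵀ * A * T) ∂lebesgueSym q =
      ENNReal.ofReal (T.det ^ (-((q : ℝ) + 1))) * ∫⁻ A, f A ∂lebesgueSym q := by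
  have hdet : LinearMap.det (congrMap T) ≠ 0 := by
    rw [det_congrMap hT]
    exact pow_ne_zero _ hT.det_pos.ne'
  have hm := Real.map_linearMap_volume_pi_eq_smul_volume_pi hdet
  have hmeas : Measurable fun A : Mat q => Tᵀ * A * T :=
    measurable_matrix_mul (measurable_matrix_mul measurable_const measurable_id) measurable_const
  have hc : Measurable (congrMap T) := (LinearMap.continuous_of_finiteDimensional _).measurable
  rw [lintegral_lebesgueSym hf, lintegral_lebesgueSym (f := fun A => f (Tᵀ * A * T)) (hf.comp hmeas)]
  simp only [← symOfUpper_congrMap]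
  rw [← lintegral_map (f := fun v => f (symOfUpper q v)) (hf.comp measurable_symOfUpper) hc, hm, lintegral_smul_measure, smul_eq_mul,
    det_congrMap hT, abs_of_pos (inv_pos.2 (pow_pos hT.det_pos _)), Real.rpow_neg hT.det_pos.le]
  norm_cast

lemma lintegral_lebesgueSym_add {B : Mat q} (hB : Bᵀ = B) {f : Mat q → ℝ≥0∞}
    (hf : Measurable f) :
    ∫⁻ A, f (A + B) ∂lebesgueSym q = ∫⁻ A, f A ∂lebesgueSym q := by
  have hmeas : Measurable fun A : Mat q => A + B :=
    measurable_matrix_add measurable_id measurable_const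
  rw [lintegral_lebesgueSym hf, lintegral_lebesgueSym (f := fun A => f (A + B)) (hf.comp hmeas)]
  rw [← lintegral_add_right_eq_self (fun v => f (symOfUpper q v)) (upperEntries B)]
  simp only [symOfUpper_add, symOfUpper_upperEntries hB]

lemma injOn_gramMap : InjOn gramMap (posUpperSet q) := by
  intro v hv w hw h
  have h1 : (triOfUpper v)ᵀ * triOfUpper v = (triOfUpper w)ᵀ * triOfUpper w := by
    rw [← symOfUpper_gramMap, ← symOfUpper_gramMap, h]
  have h2 := (isPosUpper_triOfUpper hv).gram_injective (isPosUpper_triOfUpper hw) h1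
  ext p
  rw [← triOfUpper_apply v, ← triOfUpper_apply w, h2]

lemma image_gramMap : gramMap '' posUpperSet q = {v | (symOfUpper q v).PosDef} := by
  ext v
  constructor
  · rintro ⟨w, hw, rfl⟩
    change (symOfUpper q (gramMap w)).PosDef
    rw [symOfUpper_gramMap]
    exact (isPosUpper_triOfUpper hw).posDef
  · intro hv
    obtain ⟨h1, h2⟩ := uchol_spec (A := symOfUpper q v) hv
    refine ⟨upperEntries (uchol (symOfUpper q v)), fun i => h1.2 i, ?_⟩
    have : triOfUpper (upperEntries (uchol (symOfUpper q v))) = uchol (symOfUpper q v) := by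
      ext i j
      by_cases h : i ≤ j
      · simp [triOfUpper, upperEntries, h]
      · rw [triOfUpper_lower _ _ _ (not_le.1 h), h1.1 i j (not_le.1 h)]
    rw [gramMap, this, h2, upperEntries_symOfUpper]

/-- Integration over positive definite matrices in Cholesky coordinates. -/
lemma lintegral_lebesguePosDef {f : Mat q → ℝ≥0∞} (hf : Measurable f) :
    ∫⁻ A, f A ∂lebesguePosDef q = ∫⁻ v in posUpperSet q,
      ENNReal.ofReal (∏ p : UpperIndex q, (if p.1.1 = p.1.2 then 2 else 1) *
        v ⟨(p.1.1, p.1.1), le_rfl⟩) * f ((triOfUpper v)ᵀ * triOfUpper v) := by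
  rw [lebesguePosDef_eq, lebesgueSym, Measure.restrict_map measurable_symOfUpper
    measurableSet_posDef, lintegral_map hf measurable_symOfUpper]
  have : symOfUpper q ⁻¹' {A | A.PosDef} = gramMap '' posUpperSet q := image_gramMap.symm
  rw [this, lintegral_image_eq_lintegral_abs_det_fderiv_mul volume measurableSet_posUpperSet
    (fun v _ => (hasFDerivAt_gramMap v).hasFDerivWithinAt) injOn_gramMap]
  refine setLIntegral_congr_fun measurableSet_posUpperSet fun v hv => ?_
  have e : (LinearMap.toContinuousLinearMap (gramDeriv v)).det = LinearMap.det (gramDeriv v) := rfl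
  simp only [symOfUpper_gramMap, e, det_gramDeriv]
  rw [abs_of_nonneg]
  refine Finset.prod_nonneg fun p _ => mul_nonneg (by split_ifs <;> norm_num) (hv _).le

instance : SigmaFinite (lebesgueSym q) := by
  have e : MeasurableEmbedding (symOfUpper q) :=
    MeasurableEmbedding.of_measurable_inverse measurable_symOfUpper
      (by
        have : range (symOfUpper q) = {A | Aᵀ = A} := by
          ext A
          exact ⟨by rintro ⟨v, rfl⟩; exact symOfUpper_transpose v,
            fun h => ⟨_, symOfUpper_upperEntries h⟩⟩
        rw [this]
        exact (isClosed_eq continuous_id.matrix_transpose continuous_id).measurableSet)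
      measurable_upperEntries upperEntries_symOfUpper
  exact e.sigmaFinite_map

instance : SigmaFinite (lebesguePosDef q) := by
  rw [lebesguePosDef_eq]
  infer_instance

/-! ### Densities on product spaces; the chi distribution. -/

section Pi

variable {ι : Type*} [Fintype ι] {X : ι → Type*} [∀ i, MeasurableSpace (X i)]
  (μ : ∀ i, Measure (X i))

/-- Tonelli's theorem for products of functions of one coordinate. -/
lemma lintegral_pi_prod [∀ i, SigmaFinite (μ i)] {f : ∀ i, X i → ℝ≥0∞}
    (hf : ∀ i, Measurable (f i)) :
    ∫⁻ x, ∏ i, f i (x i) ∂Measure.pi μ = ∏ i, ∫⁻ x, f i x ∂μ i := by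
  classical
  have hm : Measurable fun x : ∀ i, X i => ∏ i, f i (x i) :=
    Finset.measurable_prod _ fun i _ => (hf i).comp (measurable_pi_apply i)
  -- The coordinates are integrated out one at a time; the factors not yet integrated stay frozen at
  -- the base point `x`.
  have key : ∀ (s : Finset ι) (x : ∀ i, X i),
      (∫⋯∫⁻_s, fun x => ∏ i, f i (x i) ∂μ) x =
        (∏ i ∈ s, ∫⁻ x, f i x ∂μ i) * ∏ i ∈ sᶜ, f i (x i) := by
    intro s
    induction s using Finset.induction_on with
    | empty => simp
    | insert j s hj ih =>
      intro x
      rw [lmarginal_insert _ hm hj]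
      have hc : sᶜ = insert j (insert j s)ᶜ := by
        ext a
        simp only [Finset.mem_compl, Finset.mem_insert, not_or]
        by_cases h : a = j
        · simp [h, hj]
        · simp [h]
      have : ∀ y, (∫⋯∫⁻_s, fun x => ∏ i, f i (x i) ∂μ) (Function.update x j y) =
          (∏ i ∈ s, ∫⁻ x, f i x ∂μ i) * (∏ i ∈ (insert j s)ᶜ, f i (x i)) * f j y := by
        intro y
        rw [ih, hc, Finset.prod_insert (by simp), Function.update_self, mul_assoc]
        congr 1
        rw [mul_comm]
        congr 1
        refine Finset.prod_congr rfl fun i hi => ?_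
        rw [Function.update_of_ne]
        rintro rfl
        simp at hi
      simp only [this]
      rw [lintegral_const_mul _ (hf j), Finset.prod_insert hj]
      ring
  -- Iterated marginals need a base point; without one some factor space is empty and both sides
  -- vanish.
  by_cases hne : Nonempty (∀ i, X i)
  · obtain ⟨x⟩ := hne
    rw [lintegral_eq_lmarginal_univ x, key]
    simp
  · have : IsEmpty (∀ i, X i) := not_nonempty_iff.1 hne
    obtain ⟨i, hi⟩ : ∃ i, IsEmpty (X i) := by
      by_contra! h
      exact hne ⟨fun i => (h i).some⟩
    rw [lintegral_of_isEmpty, eq_comm]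
    exact Finset.prod_eq_zero (Finset.mem_univ i) (lintegral_of_isEmpty _ _)

lemma pi_withDensity [∀ i, SigmaFinite (μ i)] {f : ∀ i, X i → ℝ≥0∞}
    (hf : ∀ i, Measurable (f i)) [∀ i, SigmaFinite ((μ i).withDensity (f i))] :
    Measure.pi (fun i => (μ i).withDensity (f i)) =
      (Measure.pi μ).withDensity fun x => ∏ i, f i (x i) := by
  refine Measure.pi_eq fun s hs => ?_
  rw [withDensity_apply _ (MeasurableSet.univ_pi hs), ← lintegral_indicator (MeasurableSet.univ_pi hs)]
  have : ∀ x : ∀ i, X i, (univ.pi s).indicator (fun x => ∏ i, f i (x i)) x =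
      ∏ i, (s i).indicator (f i) (x i) := by
    intro x
    by_cases hx : x ∈ univ.pi s
    · rw [indicator_of_mem hx]
      exact Finset.prod_congr rfl fun i _ => (indicator_of_mem (hx i (mem_univ i)) _).symm
    · rw [indicator_of_notMem hx, eq_comm]
      simp only [mem_univ_pi, not_forall] at hx
      obtain ⟨i, hi⟩ := hx
      exact Finset.prod_eq_zero (Finset.mem_univ i) (indicator_of_notMem hi _)
  simp only [this]
  rw [lintegral_pi_prod _ fun i => (hf i).indicator (hs i)]
  exact Finset.prod_congr rfl fun i _ => by
    rw [withDensity_apply _ (hs i), lintegral_indicator (hs i)]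

end Pi

section Chi

/-- The chi distribution with `a` degrees of freedom. -/
def chiMeasure (a : ℝ) : Measure ℝ := (gammaMeasure (a / 2) (1 / 2)).map Real.sqrt

lemma isProbabilityMeasure_chiMeasure {a : ℝ} (ha : 0 < a) :
    IsProbabilityMeasure (chiMeasure a) := by
  have := isProbabilityMeasure_gammaMeasure (half_pos ha) (half_pos one_pos)
  exact Measure.isProbabilityMeasure_map Real.continuous_sqrt.measurable.aemeasurable

/-- The density of the chi distribution. -/
def chiPDF (a r : ℝ) : ℝ≥0∞ :=
  (Ioi 0).indicator (fun r => ENNReal.ofReal (2 * r * gammaPDFReal (a / 2) (1 / 2) (r ^ 2))) r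

lemma measurable_chiPDF (a : ℝ) : Measurable (chiPDF a) := by
  refine Measurable.indicator ?_ measurableSet_Ioi
  exact ENNReal.measurable_ofReal.comp ((measurable_id.const_mul 2).mul
    ((measurable_gammaPDFReal _ _).comp (measurable_id.pow_const 2)))

lemma lintegral_Ioi_sq (h : ℝ → ℝ≥0∞) :
    ∫⁻ u in Ioi 0, h u = ∫⁻ r in Ioi 0, ENNReal.ofReal (2 * r) * h (r ^ 2) := by
  have himg : (fun r : ℝ => r ^ 2) '' Ioi 0 = Ioi 0 := by
    ext u
    constructor
    · rintro ⟨r, hr, rfl⟩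
      exact pow_pos (show (0 : ℝ) < r from hr) 2
    · intro hu
      exact ⟨√u, Real.sqrt_pos.2 hu, Real.sq_sqrt (le_of_lt hu)⟩
  have := lintegral_image_eq_lintegral_abs_deriv_mul (f := fun r : ℝ => r ^ 2)
    (f' := fun r => 2 * r) measurableSet_Ioi
    (fun x _ => by simpa using (hasDerivAt_pow 2 x).hasDerivWithinAt (s := Ioi 0))
    (fun x hx y hy hxy => (pow_left_inj₀ (le_of_lt hx) (le_of_lt hy) two_ne_zero).1 hxy) h
  rw [himg] at this
  rw [this]
  refine setLIntegral_congr_fun measurableSet_Ioi fun r hr => ?_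
  have : (0 : ℝ) < r := hr
  rw [abs_of_pos (by linarith)]

lemma lintegral_gammaMeasure {a r : ℝ} {f : ℝ → ℝ≥0∞} (hf : Measurable f) :
    ∫⁻ u, f u ∂gammaMeasure a r =
      ∫⁻ u in Ioi 0, ENNReal.ofReal (gammaPDFReal a r u) * f u := by
  have hm : Measurable (gammaPDF a r) := (measurable_gammaPDFReal a r).ennreal_ofReal
  rw [gammaMeasure, lintegral_withDensity_eq_lintegral_mul _ hm hf,
    ← setLIntegral_congr Ioi_ae_eq_Ici.symm, ← lintegral_indicator measurableSet_Ici]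
  refine lintegral_congr fun u => ?_
  by_cases hu : 0 ≤ u
  · rw [indicator_of_mem (show u ∈ Ici 0 from hu)]
    rfl
  · rw [indicator_of_notMem (show u ∉ Ici 0 from hu), Pi.mul_apply, gammaPDF_of_neg (not_le.1 hu), zero_mul]

lemma chiMeasure_eq (a : ℝ) : chiMeasure a = volume.withDensity (chiPDF a) := by
  refine Measure.ext_of_lintegral _ fun f hf => ?_
  rw [chiMeasure, lintegral_map hf Real.continuous_sqrt.measurable,
    lintegral_gammaMeasure (f := fun u => f (√u)) (hf.comp Real.continuous_sqrt.measurable),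
    lintegral_withDensity_eq_lintegral_mul _ (measurable_chiPDF a) hf, lintegral_Ioi_sq,
    ← lintegral_indicator measurableSet_Ioi]
  refine lintegral_congr fun r => ?_
  by_cases hr : r ∈ Ioi (0 : ℝ)
  · have hr' : (0 : ℝ) < r := hr
    rw [indicator_of_mem hr, Pi.mul_apply, chiPDF, indicator_of_mem hr, ← mul_assoc,
      ← ENNReal.ofReal_mul (by linarith), Real.sqrt_sq hr'.le]
  · rw [indicator_of_notMem hr, Pi.mul_apply, chiPDF, indicator_of_notMem hr, zero_mul]

end Chi

/-! ### Relative invariance of the Wishart reference measures. -/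

/-- The relatively invariant measure underlying the Wishart distributions with `k` degrees of
freedom. -/
def wishartHom (q : ℕ) (k : ℝ) : Measure (Mat q) :=
  if (q : ℝ) - 1 < k then
    (lebesguePosDef q).withDensity fun A => ENNReal.ofReal (A.det ^ ((k - q - 1) / 2))
  else gramLebesgue q ⌊k⌋₊

/-- The normalizing constant of the Wishart distributions. -/
def wishartConst (q : ℕ) (k : ℝ) : ℝ :=
  if (q : ℝ) - 1 < k then 2 ^ (-(k * q / 2)) * (multiGamma q (k / 2))⁻¹
  else (2 * Real.pi) ^ (-(k * q / 2))

lemma multiGamma_pos {k : ℝ} (hk : (q : ℝ) - 1 < k) : 0 < multiGamma q (k / 2) := by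
  refine mul_pos (Real.rpow_pos_of_pos Real.pi_pos _) (Finset.prod_pos fun i _ => ?_)
  refine Real.Gamma_pos_of_pos ?_
  have : ((i : ℕ) : ℝ) + 1 ≤ q := by exact_mod_cast i.2
  linarith

lemma wishartConst_pos (q : ℕ) (k : ℝ) : 0 < wishartConst q k := by
  rw [wishartConst]
  split_ifs with h
  · exact mul_pos (Real.rpow_pos_of_pos two_pos _) (inv_pos.2 (multiGamma_pos h))
  · exact Real.rpow_pos_of_pos (by positivity) _

lemma measurable_gram (q m : ℕ) :
    Measurable fun X : Fin q → Fin m → ℝ => Matrix.of X * (Matrix.of X)ᵀ := by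
  have : Measurable fun X : Matrix (Fin q) (Fin m) ℝ => X * Xᵀ :=
    measurable_matrix_mul measurable_id (measurable_matrix_transpose measurable_id)
  exact this

lemma trace_gram {m : ℕ} (X : Fin q → Fin m → ℝ) :
    (Matrix.of X * (Matrix.of X)ᵀ).trace = ∑ i, ∑ j, X i j ^ 2 := by
  simp [Matrix.trace, Matrix.mul_apply, sq]

/-- A pushforward of a σ-finite measure need not be σ-finite. Here it is, since `tr XX'` is the sum
of the squared entries of `X`, so that the sets `tr A ≤ N` have bounded preimages. The radius `N +
1` serves because `x² ≤ N` implies `|x| ≤ N + 1`. -/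
instance (q m : ℕ) : SigmaFinite (gramLebesgue q m) := by
  refine ⟨⟨⟨fun N => {A | A.trace ≤ N}, fun _ => trivial, fun N => ?_, ?_⟩⟩⟩
  · have hs : MeasurableSet {A : Mat q | A.trace ≤ N} :=
      measurableSet_le (measurable_matrix_trace measurable_id) measurable_const
    rw [gramLebesgue, Measure.map_apply (measurable_gram q m) hs]
    refine lt_of_le_of_lt (measure_mono (t := Metric.closedBall 0 (N + 1)) fun X hX => ?_)
      measure_closedBall_lt_top
    have hX' : ∑ i, ∑ j, X i j ^ 2 ≤ N := by
      rw [← trace_gram]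
      exact hX
    rw [mem_closedBall_zero_iff, pi_norm_le_iff_of_nonneg (by positivity)]
    refine fun i => (pi_norm_le_iff_of_nonneg (by positivity)).2 fun j => ?_
    have h1 : X i j ^ 2 ≤ N := (Finset.single_le_sum (f := fun j => X i j ^ 2)
      (fun _ _ => sq_nonneg _) (Finset.mem_univ j)).trans ((Finset.single_le_sum
      (f := fun i => ∑ j, X i j ^ 2) (fun _ _ => Finset.sum_nonneg fun _ _ => sq_nonneg _)
      (Finset.mem_univ i)).trans hX')
    rw [Real.norm_eq_abs]
    refine abs_le_of_sq_le_sq ?_ (by positivity)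
    have : (0 : ℝ) ≤ N := Nat.cast_nonneg N
    nlinarith
  · ext A
    simp only [mem_iUnion, mem_univ, iff_true]
    exact exists_nat_ge A.trace

instance (q : ℕ) (k : ℝ) : SigmaFinite (wishartBase q k) := by
  rw [wishartBase]
  split_ifs <;> infer_instance

instance (q : ℕ) (k : ℝ) : SigmaFinite (wishartHom q k) := by
  rw [wishartHom]
  split_ifs
  · exact SigmaFinite.withDensity_ofReal _
  · infer_instance

lemma ae_posDef_lebesguePosDef : ∀ᵐ A ∂lebesguePosDef q, A.PosDef :=
  ae_restrict_mem measurableSet_posDef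

lemma posSemidef_gram {m : ℕ} (X : Matrix (Fin q) (Fin m) ℝ) : (X * Xᵀ).PosSemidef := by
  have := Matrix.posSemidef_self_mul_conjTranspose X
  rwa [Matrix.conjTranspose_eq_transpose_of_trivial] at this

lemma ae_posSemidef_gramLebesgue (q m : ℕ) : ∀ᵐ A ∂gramLebesgue q m, A.PosSemidef := by
  rw [gramLebesgue, ae_map_iff (measurable_gram q m).aemeasurable measurableSet_posSemidef]
  exact ae_of_all _ fun X => posSemidef_gram _

lemma ae_posSemidef_wishartBase (q : ℕ) (k : ℝ) : ∀ᵐ A ∂wishartBase q k, A.PosSemidef := by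
  rw [wishartBase]
  split_ifs
  · exact ae_posDef_lebesguePosDef.mono fun A hA => hA.posSemidef
  · exact ae_posSemidef_gramLebesgue q _

lemma ae_posSemidef_wishartHom (q : ℕ) (k : ℝ) : ∀ᵐ A ∂wishartHom q k, A.PosSemidef := by
  rw [wishartHom]
  split_ifs
  · exact (withDensity_absolutelyContinuous _ _).ae_le
      (ae_posDef_lebesguePosDef.mono fun A hA => hA.posSemidef)
  · exact ae_posSemidef_gramLebesgue q _

lemma measurable_wishartPDF (q : ℕ) (k : ℝ) :
    Measurable fun p : Mat q × Mat q => wishartPDF q k p.1 p.2 := by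
  have h1 : Measurable fun p : Mat q × Mat q => p.1.det := measurable_matrix_det measurable_fst
  have h2 : Measurable fun p : Mat q × Mat q => p.2.det := measurable_matrix_det measurable_snd
  have h3 : Measurable fun p : Mat q × Mat q => (p.1⁻¹ * p.2).trace :=
    measurable_matrix_trace (measurable_matrix_mul (measurable_matrix_inv measurable_fst)
      measurable_snd)
  unfold wishartPDF
  split_ifs
  · exact (((measurable_const.mul (h1.pow_const _)).mul measurable_const).mul
      (h2.pow_const _)).mul (h3.neg.div_const 2).exp
  · exact (measurable_const.mul (h1.pow_const _)).mul (h3.neg.div_const 2).exp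

lemma measurable_wishartPDF_right (q : ℕ) (k : ℝ) (S : Mat q) : Measurable (wishartPDF q k S) :=
  Measurable.of_uncurry_left (f := wishartPDF q k) (measurable_wishartPDF q k)

/-- The part of the Wishart density that is relative to `wishartHom`. -/
def wishartKernel (q : ℕ) (k : ℝ) (S A : Mat q) : ℝ :=
  wishartConst q k * S.det ^ (-(k / 2)) * Real.exp (-(S⁻¹ * A).trace / 2)

lemma measurable_wishartKernel (q : ℕ) (k : ℝ) (S : Mat q) :
    Measurable (wishartKernel q k S) := by
  have h3 : Measurable fun A : Mat q => (S⁻¹ * A).trace :=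
    measurable_matrix_trace (measurable_matrix_mul measurable_const measurable_id)
  exact measurable_const.mul (h3.neg.div_const 2).exp

/-- With `|A|^{(k-q-1)/2}` moved from the density into the measure, the remaining kernel has the
same form in the singular and nonsingular cases, so later arguments need not separate them. -/
lemma lintegral_wishart (k : ℝ) (S : Mat q) {f : Mat q → ℝ≥0∞} (hf : Measurable f) :
    ∫⁻ A, f A ∂wishart q k S =
      ∫⁻ A, ENNReal.ofReal (wishartKernel q k S A) * f A ∂wishartHom q k := by
  have hK := (measurable_wishartKernel q k S).ennreal_ofReal
  rw [wishart, lintegral_withDensity_eq_lintegral_mul _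
    (measurable_wishartPDF_right q k S).ennreal_ofReal hf, wishartBase, wishartHom]
  split_ifs with h
  · rw [lintegral_withDensity_eq_lintegral_mul _ _
      (g := fun A => ENNReal.ofReal (wishartKernel q k S A) * f A) (hK.mul hf)]
    · refine lintegral_congr_ae (ae_posDef_lebesguePosDef.mono fun A hA => ?_)
      simp only [Pi.mul_apply]
      rw [← mul_assoc, ← ENNReal.ofReal_mul (Real.rpow_nonneg hA.det_pos.le _)]
      congr 2
      rw [wishartPDF, wishartKernel, wishartConst, if_pos h, if_pos h]
      ring
    · exact ((measurable_matrix_det measurable_id).pow_const _).ennreal_ofReal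
  · refine lintegral_congr fun A => ?_
    rw [Pi.mul_apply, wishartPDF, wishartKernel, wishartConst, if_neg h, if_neg h]

/-- `X ↦ T'X` on `q × m` matrices. -/
def mulLeftMap (T : Mat q) (m : ℕ) : (Fin q → Fin m → ℝ) →ₗ[ℝ] (Fin q → Fin m → ℝ) where
  toFun X := Tᵀ * Matrix.of X
  map_add' X Y := Matrix.mul_add Tᵀ (Matrix.of X) (Matrix.of Y)
  map_smul' c X := Matrix.mul_smul Tᵀ c (Matrix.of X)

lemma det_mulLeftMap (T : Mat q) (m : ℕ) : LinearMap.det (mulLeftMap T m) = T.det ^ m := by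
  -- `X ↦ T'X` acts on each column separately: after transposing coordinates it is a product of `m`
  -- copies of `T'`.
  let e : (Fin q → Fin m → ℝ) ≃ₗ[ℝ] (Fin m → Fin q → ℝ) :=
    Matrix.transposeLinearEquiv (Fin q) (Fin m) ℝ ℝ
  have h : (e : (Fin q → Fin m → ℝ) →ₗ[ℝ] (Fin m → Fin q → ℝ)) ∘ₗ mulLeftMap T m ∘ₗ
      (e.symm : (Fin m → Fin q → ℝ) →ₗ[ℝ] (Fin q → Fin m → ℝ)) =
      LinearMap.pi fun j => (Matrix.toLin' Tᵀ).comp (LinearMap.proj j) := by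
    refine LinearMap.ext fun Y => ?_
    ext j i
    rfl
  rw [← LinearMap.det_conj _ e, h, LinearMap.det_pi]
  simp

lemma lintegral_gramLebesgue_congr {T : Mat q} (hT : IsPosUpper T) (m : ℕ) {f : Mat q → ℝ≥0∞}
    (hf : Measurable f) :
    ∫⁻ A, f (Tᵀ * A * T) ∂gramLebesgue q m =
      ENNReal.ofReal (T.det ^ (-(m : ℝ))) * ∫⁻ A, f A ∂gramLebesgue q m := by
  have hmeas : Measurable fun A : Mat q => Tᵀ * A * T :=
    measurable_matrix_mul (measurable_matrix_mul measurable_const measurable_id) measurable_const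
  have hdet : LinearMap.det (mulLeftMap T m) ≠ 0 := by
    rw [det_mulLeftMap]
    exact pow_ne_zero _ hT.det_pos.ne'
  have hm := Measure.map_linearMap_addHaar_eq_smul_addHaar
    (volume : Measure (Fin q → Fin m → ℝ)) hdet
  have hc : Measurable (mulLeftMap T m) := (LinearMap.continuous_of_finiteDimensional _).measurable
  rw [gramLebesgue, lintegral_map hf (measurable_gram q m),
    lintegral_map (f := fun A => f (Tᵀ * A * T)) (hf.comp hmeas) (measurable_gram q m)]
  have h : ∀ X : Fin q → Fin m → ℝ, Tᵀ * (Matrix.of X * (Matrix.of X)ᵀ) * T =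
      Matrix.of (mulLeftMap T m X) * (Matrix.of (mulLeftMap T m X))ᵀ := by
    intro X
    change _ = (Tᵀ * Matrix.of X) * (Tᵀ * Matrix.of X)ᵀ
    simp [Matrix.transpose_mul, Matrix.mul_assoc]
  simp only [h]
  rw [← lintegral_map (f := fun X => f (Matrix.of X * (Matrix.of X)ᵀ))
    (hf.comp (measurable_gram q m)) hc, hm, lintegral_smul_measure, smul_eq_mul,
    det_mulLeftMap, abs_of_pos (inv_pos.2 (pow_pos hT.det_pos _)), Real.rpow_neg hT.det_pos.le,
    Real.rpow_natCast]

lemma WishartDof.pos {k : ℝ} (hq : 0 < q) (hk : WishartDof q k) : 0 < k := by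
  rcases hk with ⟨m, hm, _, rfl⟩ | hk
  · exact_mod_cast hm
  · have : (1 : ℝ) ≤ q := by exact_mod_cast hq
    linarith

lemma WishartDof.floor_eq {k : ℝ} (hk : WishartDof q k) (h : ¬ (q : ℝ) - 1 < k) :
    ((⌊k⌋₊ : ℕ) : ℝ) = k := by
  rcases hk with ⟨m, hm, _, rfl⟩ | hk
  · simp
  · exact absurd hk h

lemma measurable_congr_left (T : Mat q) : Measurable fun A : Mat q => Tᵀ * A * T :=
  measurable_matrix_mul (measurable_matrix_mul measurable_const measurable_id) measurable_const

lemma lintegral_wishartHom {k : ℝ} (hk : (q : ℝ) - 1 < k) {f : Mat q → ℝ≥0∞}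
    (hf : Measurable f) :
    ∫⁻ A, f A ∂wishartHom q k =
      ∫⁻ A, ({A : Mat q | A.PosDef}.indicator
        (fun A => ENNReal.ofReal (A.det ^ ((k - q - 1) / 2))) A) * f A ∂lebesgueSym q := by
  have hd : Measurable fun A : Mat q => ENNReal.ofReal (A.det ^ ((k - q - 1) / 2)) :=
    ((measurable_matrix_det measurable_id).pow_const _).ennreal_ofReal
  rw [wishartHom, if_pos hk, lintegral_withDensity_eq_lintegral_mul _ hd hf, lebesguePosDef_eq,
    ← lintegral_indicator measurableSet_posDef]
  refine lintegral_congr fun A => ?_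
  by_cases hA : A ∈ {A : Mat q | A.PosDef}
  · simp only [indicator_of_mem hA, Pi.mul_apply]
  · simp only [indicator_of_notMem hA, zero_mul]

/-- Relative invariance under the congruences `A ↦ T'AT`. -/
lemma lintegral_wishartHom_congr {k : ℝ} (hk : WishartDof q k) {T : Mat q} (hT : IsPosUpper T)
    {f : Mat q → ℝ≥0∞} (hf : Measurable f) :
    ∫⁻ A, f (Tᵀ * A * T) ∂wishartHom q k =
      ENNReal.ofReal (T.det ^ (-k)) * ∫⁻ A, f A ∂wishartHom q k := by
  by_cases h : (q : ℝ) - 1 < k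
  · have hd : Measurable fun A : Mat q => ENNReal.ofReal (A.det ^ ((k - q - 1) / 2)) :=
      ((measurable_matrix_det measurable_id).pow_const _).ennreal_ofReal
    rw [lintegral_wishartHom h hf, lintegral_wishartHom (f := fun A => f (Tᵀ * A * T)) h
      (hf.comp (measurable_congr_left T))]
    set g : Mat q → ℝ≥0∞ := fun A => {A : Mat q | A.PosDef}.indicator
        (fun A => ENNReal.ofReal (A.det ^ ((k - q - 1) / 2))) A * f A with hg
    have hgm : Measurable g := (hd.indicator measurableSet_posDef).mul hf
    -- The determinant weight contributes `|T|^{-(k-q-1)}` and the Jacobian of the congruence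
    -- `|T|^{-(q+1)}`; together they give `|T|^{-k}`.
    have e : ∀ A : Mat q, {A : Mat q | A.PosDef}.indicator
        (fun A => ENNReal.ofReal (A.det ^ ((k - q - 1) / 2))) A * f (Tᵀ * A * T) =
        ENNReal.ofReal (T.det ^ (-(k - q - 1))) * g (Tᵀ * A * T) := by
      intro A
      by_cases hA : A.PosDef
      · have hA' := hT.posDef_conj hA
        simp only [hg]
        rw [indicator_of_mem (by exact hA), indicator_of_mem (by exact hA'), ← mul_assoc,
          ← ENNReal.ofReal_mul (Real.rpow_nonneg hT.det_pos.le _)]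
        congr 2
        rw [Matrix.det_mul, Matrix.det_mul, Matrix.det_transpose,
          show T.det * A.det * T.det = T.det ^ (2 : ℝ) * A.det by
            rw [Real.rpow_two]; ring,
          Real.mul_rpow (Real.rpow_nonneg hT.det_pos.le _) hA.det_pos.le,
          ← Real.rpow_mul hT.det_pos.le, ← mul_assoc, ← Real.rpow_add hT.det_pos,
          show -(k - q - 1) + 2 * ((k - q - 1) / 2) = 0 by ring, Real.rpow_zero, one_mul]
      · have hA' : ¬ (Tᵀ * A * T).PosDef := fun h => hA (hT.posDef_conj_iff.1 h)
        simp only [hg]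
        rw [indicator_of_notMem (by exact hA), indicator_of_notMem (by exact hA')]
        simp
    simp only [e]
    rw [lintegral_const_mul (f := fun A => g (Tᵀ * A * T)) _ (hgm.comp (measurable_congr_left T)),
      lintegral_lebesgueSym_congr hT hgm, ← mul_assoc,
      ← ENNReal.ofReal_mul (Real.rpow_nonneg hT.det_pos.le _), ← Real.rpow_add hT.det_pos]
    congr 3
    ring
  · rw [wishartHom, if_neg h, lintegral_gramLebesgue_congr hT _ hf, hk.floor_eq h]

/-- `tr(S⁻¹A)` is unchanged when `S` and `A` undergo the same congruence, and the factor `|T|^{-k}`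
gained by `|S|^{-k/2}` matches the relative invariance of the measure. Triangular `T` suffice to
reach every positive definite scale from `I`. -/
lemma wishart_congr {k : ℝ} (hk : WishartDof q k) {T S : Mat q} (hT : IsPosUpper T)
    (hS : S.PosDef) : (wishart q k S).map (fun A => Tᵀ * A * T) = wishart q k (Tᵀ * S * T) := by
  refine Measure.ext_of_lintegral _ fun f hf => ?_
  rw [lintegral_map hf (measurable_congr_left T), lintegral_wishart _ _ hf,
    lintegral_wishart _ _ (f := fun A => f (Tᵀ * A * T)) (hf.comp (measurable_congr_left T))]
  set g : Mat q → ℝ≥0∞ := fun A => ENNReal.ofReal (wishartKernel q k (Tᵀ * S * T) A) * f A with hg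
  have hgm : Measurable g := (measurable_wishartKernel _ _ _).ennreal_ofReal.mul hf
  have hTd := hT.det_pos
  have e : ∀ A : Mat q, ENNReal.ofReal (wishartKernel q k S A) * f (Tᵀ * A * T) =
      ENNReal.ofReal (T.det ^ k) * g (Tᵀ * A * T) := by
    intro A
    simp only [hg]
    rw [← mul_assoc, ← ENNReal.ofReal_mul (Real.rpow_nonneg hTd.le _)]
    congr 2
    have h1 : (Tᵀ * S * T).det = T.det ^ (2 : ℝ) * S.det := by
      rw [Matrix.det_mul, Matrix.det_mul, Matrix.det_transpose, Real.rpow_two]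
      ring
    have h2 : ((Tᵀ * S * T)⁻¹ * (Tᵀ * A * T)).trace = (S⁻¹ * A).trace := by
      have hTu : IsUnit Tᵀ.det := by rw [Matrix.det_transpose]; exact hT.isUnit_det
      rw [Matrix.mul_inv_rev, Matrix.mul_inv_rev, Matrix.trace_mul_comm]
      have : Tᵀ * A * T * (T⁻¹ * (S⁻¹ * Tᵀ⁻¹)) = Tᵀ * (A * S⁻¹) * Tᵀ⁻¹ := by
        simp only [Matrix.mul_assoc]
        rw [← Matrix.mul_assoc T T⁻¹, Matrix.mul_nonsing_inv _ hT.isUnit_det, Matrix.one_mul]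
      rw [this, Matrix.trace_mul_comm, ← Matrix.mul_assoc, Matrix.nonsing_inv_mul _ hTu,
        Matrix.one_mul, Matrix.trace_mul_comm]
    rw [wishartKernel, wishartKernel, h1, h2,
      Real.mul_rpow (Real.rpow_nonneg hTd.le _) hS.det_pos.le, ← Real.rpow_mul hTd.le]
    have h3 : T.det ^ k * T.det ^ (2 * -(k / 2)) = 1 := by
      rw [← Real.rpow_add hTd, show k + 2 * -(k / 2) = 0 by ring, Real.rpow_zero]
    linear_combination (-(wishartConst q k * S.det ^ (-(k / 2)) *
      Real.exp (-(S⁻¹ * A).trace / 2))) * h3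
  simp only [e]
  rw [lintegral_const_mul (f := fun A => g (Tᵀ * A * T)) _ (hgm.comp (measurable_congr_left T)),
    lintegral_wishartHom_congr hk hT hgm, ← mul_assoc,
    ← ENNReal.ofReal_mul (Real.rpow_nonneg hTd.le _), ← Real.rpow_add hTd, add_neg_cancel,
    Real.rpow_zero, ENNReal.ofReal_one, one_mul]

/-! ### The Bartlett decomposition. -/

lemma prod_upperIndex_diag {M : Type*} [CommMonoid M] (f : Fin q → M) :
    ∏ p : UpperIndex q, (if p.1.1 = p.1.2 then f p.1.1 else 1) = ∏ i, f i := by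
  rw [prod_upperIndex fun i j => if i = j then f i else 1]
  refine Finset.prod_congr rfl fun i _ => ?_
  rw [Finset.prod_eq_single i]
  · simp
  · intro j _ hj
    simp [Ne.symm hj]
  · simp

/-- The law of the Bartlett factor of a `Wishart_q(k, I)` matrix, in the coordinates on and above
the diagonal. -/
def bartlettLaw (q : ℕ) (k : ℝ) : Measure (UpperIndex q → ℝ) :=
  Measure.pi fun p : UpperIndex q =>
    if p.1.1 = p.1.2 then chiMeasure (k - p.1.1) else gaussianReal 0 1

/-- The densities of the entries of the Bartlett factor. -/
def bartlettPDF (k : ℝ) (p : UpperIndex q) (r : ℝ) : ℝ≥0∞ :=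
  if p.1.1 = p.1.2 then chiPDF (k - p.1.1) r else gaussianPDF 0 1 r

lemma measurable_bartlettPDF (k : ℝ) (p : UpperIndex q) : Measurable (bartlettPDF k p) := by
  unfold bartlettPDF
  split_ifs
  · exact measurable_chiPDF _
  · exact measurable_gaussianPDF 0 1

lemma measurable_prod_bartlettPDF (k : ℝ) :
    Measurable fun v : UpperIndex q → ℝ => ∏ p, bartlettPDF k p (v p) :=
  Finset.measurable_prod _ fun p _ => (measurable_bartlettPDF k p).comp (measurable_pi_apply p)

lemma sub_index_pos {k : ℝ} (hk : (q : ℝ) - 1 < k) (i : Fin q) : 0 < k - (i : ℝ) := by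
  have : ((i : ℕ) : ℝ) + 1 ≤ q := by exact_mod_cast i.2
  linarith

lemma isProbabilityMeasure_bartlettEntry {k : ℝ} (hk : (q : ℝ) - 1 < k) (p : UpperIndex q) :
    IsProbabilityMeasure
      (if p.1.1 = p.1.2 then chiMeasure (k - p.1.1) else gaussianReal 0 1) := by
  split_ifs
  · exact isProbabilityMeasure_chiMeasure (sub_index_pos hk _)
  · infer_instance

lemma isProbabilityMeasure_bartlettLaw {k : ℝ} (hk : (q : ℝ) - 1 < k) :
    IsProbabilityMeasure (bartlettLaw q k) := by
  have := fun p : UpperIndex q => isProbabilityMeasure_bartlettEntry hk p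
  unfold bartlettLaw
  infer_instance

lemma bartlettLaw_eq {k : ℝ} (hk : (q : ℝ) - 1 < k) :
    bartlettLaw q k = volume.withDensity fun v => ∏ p, bartlettPDF k p (v p) := by
  have e : ∀ p : UpperIndex q,
      (if p.1.1 = p.1.2 then chiMeasure (k - p.1.1) else gaussianReal 0 1) =
        volume.withDensity (bartlettPDF k p) := by
    intro p
    unfold bartlettPDF
    split_ifs
    · rw [chiMeasure_eq]
    · rw [gaussianReal_of_var_ne_zero 0 one_ne_zero]
  have : ∀ p : UpperIndex q, SigmaFinite ((volume : Measure ℝ).withDensity (bartlettPDF k p)) := by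
    intro p
    rw [← e]
    have := isProbabilityMeasure_bartlettEntry hk p
    infer_instance
  rw [bartlettLaw, funext e, pi_withDensity _ (measurable_bartlettPDF k)]
  rfl

lemma trace_gram_triOfUpper (v : UpperIndex q → ℝ) :
    ((triOfUpper v)ᵀ * triOfUpper v).trace = ∑ p, v p ^ 2 := by
  have h : ∑ p : UpperIndex q, v p ^ 2 = ∑ i, ∑ j, if i ≤ j then triOfUpper v i j ^ 2 else 0 := by
    have := prod_upperIndex (M := Multiplicative ℝ)
      fun i j => Multiplicative.ofAdd (triOfUpper v i j ^ 2)
    simp only [triOfUpper_apply] at this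
    exact this
  rw [h, Matrix.trace, Finset.sum_comm]
  refine Finset.sum_congr rfl fun j _ => ?_
  rw [Matrix.diag_apply, Matrix.mul_apply]
  refine Finset.sum_congr rfl fun i _ => ?_
  rw [Matrix.transpose_apply]
  split_ifs with hij
  · ring
  · rw [triOfUpper_lower v i j (not_le.1 hij), zero_mul]

lemma sum_fin_cast (q : ℕ) : ∑ i : Fin q, ((i : ℕ) : ℝ) = q * (q - 1) / 2 := by
  induction q with
  | zero => simp
  | succ n ih =>
    rw [Fin.sum_univ_castSucc]
    simp only [Fin.val_castSucc, Fin.val_last, ih]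
    push_cast
    ring

/-- Row `i` of the Bartlett factor contributes one chi constant and `q - 1 - i` Gaussian constants
`(2π)^{-1/2}`. The powers of `π` add up to the prefactor of `multiGamma`, those of `2` to `-kq/2`.
-/
lemma bartlett_const (k : ℝ) :
    (2 : ℝ) ^ (-(k * q / 2)) * (multiGamma q (k / 2))⁻¹ =
      ∏ i : Fin q, ((1 / 2) ^ ((k - (i : ℝ)) / 2) / Real.Gamma ((k - (i : ℝ)) / 2) *
        (2 * Real.pi) ^ (-(((q : ℝ) - 1 - i) / 2))) := by
  have hpi := Real.pi_pos
  have h1 : ∀ i : Fin q, (1 / 2 : ℝ) ^ ((k - (i : ℝ)) / 2) / Real.Gamma ((k - (i : ℝ)) / 2) *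
      (2 * Real.pi) ^ (-(((q : ℝ) - 1 - i) / 2)) =
      (2 : ℝ) ^ (-(k - (i : ℝ)) / 2 - ((q : ℝ) - 1 - i) / 2) *
        Real.pi ^ (-(((q : ℝ) - 1 - i) / 2)) * (Real.Gamma (k / 2 - (i : ℝ) / 2))⁻¹ := by
    intro i
    rw [Real.mul_rpow two_pos.le hpi.le, one_div, Real.inv_rpow two_pos.le,
      ← Real.rpow_neg two_pos.le,
      show -(k - (i : ℝ)) / 2 - ((q : ℝ) - 1 - i) / 2 =
        -((k - (i : ℝ)) / 2) + -(((q : ℝ) - 1 - i) / 2) by ring, Real.rpow_add two_pos,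
      show (k - (i : ℝ)) / 2 = k / 2 - (i : ℝ) / 2 by ring]
    ring
  simp only [h1]
  rw [Finset.prod_mul_distrib, Finset.prod_mul_distrib, ← Real.rpow_sum_of_pos two_pos,
    ← Real.rpow_sum_of_pos hpi, multiGamma, mul_inv, Finset.prod_inv_distrib, mul_assoc,
    ← Real.rpow_neg hpi.le]
  have h2 : ∑ i : Fin q, (-(k - (i : ℝ)) / 2 - ((q : ℝ) - 1 - i) / 2) = -(k * q / 2) := by
    have : ∀ i : Fin q, -(k - (i : ℝ)) / 2 - ((q : ℝ) - 1 - i) / 2 =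
        (i : ℝ) + (-(k / 2) - ((q : ℝ) - 1) / 2) := fun i => by ring
    simp only [this]
    rw [Finset.sum_add_distrib, sum_fin_cast, Finset.sum_const, Finset.card_univ, Fintype.card_fin,
      nsmul_eq_mul]
    ring
  have h3 : ∑ i : Fin q, -(((q : ℝ) - 1 - i) / 2) = -((q : ℝ) * (q - 1) / 4) := by
    have : ∀ i : Fin q, -(((q : ℝ) - 1 - i) / 2) = (i : ℝ) * (1 / 2) + (-(((q : ℝ) - 1) / 2)) :=
      fun i => by ring
    simp only [this]
    rw [Finset.sum_add_distrib, ← Finset.sum_mul, sum_fin_cast, Finset.sum_const, Finset.card_univ,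
      Fintype.card_fin, nsmul_eq_mul]
    ring
  rw [h2, h3]

lemma det_gram_triOfUpper {v : UpperIndex q → ℝ} (hv : v ∈ posUpperSet q) :
    ((triOfUpper v)ᵀ * triOfUpper v).det = (∏ i, v ⟨(i, i), le_rfl⟩) ^ 2 := by
  rw [Matrix.det_mul, Matrix.det_transpose, (isPosUpper_triOfUpper hv).det_eq, sq]
  simp [triOfUpper]

/-- The densities of the entries of the Bartlett factor multiply to the Wishart density times the
Jacobian of `R ↦ R'R`. -/
lemma prod_bartlettPDF {k : ℝ} (hk : (q : ℝ) - 1 < k) {v : UpperIndex q → ℝ}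
    (hv : v ∈ posUpperSet q) :
    ∏ p, bartlettPDF k p (v p) =
      ENNReal.ofReal (∏ p : UpperIndex q, (if p.1.1 = p.1.2 then 2 else 1) *
        v ⟨(p.1.1, p.1.1), le_rfl⟩) *
      ENNReal.ofReal (wishartPDF q k 1 ((triOfUpper v)ᵀ * triOfUpper v)) := by
  set d : Fin q → ℝ := fun i => v ⟨(i, i), le_rfl⟩ with hd
  have hdpos : ∀ i, 0 < d i := hv
  set c : ℝ := (2 * Real.pi) ^ (-(1 / 2) : ℝ) with hc
  have h2pi : 0 < 2 * Real.pi := by positivity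
  have hcpos : 0 < c := Real.rpow_pos_of_pos h2pi _
  -- The chi density at `d i` is `2 * g i * exp(-(d i)²/2)`.
  set g : Fin q → ℝ := fun i => d i * ((1 / 2) ^ ((k - (i : ℝ)) / 2) /
    Real.Gamma ((k - (i : ℝ)) / 2) * (d i ^ 2) ^ ((k - (i : ℝ)) / 2 - 1)) with hg
  have hgpos : ∀ i, 0 < g i := by
    intro i
    have := Real.Gamma_pos_of_pos (half_pos (sub_index_pos hk i))
    have := hdpos i
    positivity
  -- Every entry is given the Gaussian constant `c` and a Gaussian exponential; the diagonal ones
  -- carry the correction `2 * g / c`. The exponentials then multiply to the trace term, and the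
  -- constants can be counted row by row.
  have e1 : ∀ p : UpperIndex q, bartlettPDF k p (v p) = ENNReal.ofReal
      ((if p.1.1 = p.1.2 then 2 else 1) * ((if p.1.1 = p.1.2 then g p.1.1 / c else 1) * c) *
        Real.exp (-(v p ^ 2) / 2)) := by
    rintro ⟨⟨i, j⟩, hij⟩
    by_cases h : i = j
    · subst h
      have hpos : (0 : ℝ) < d i := hdpos i
      simp only [bartlettPDF, if_true]
      rw [chiPDF, indicator_of_mem (by exact hpos), gammaPDFReal, if_pos (sq_nonneg _)]
      congr 1
      change 2 * d i * _ = 2 * (g i / c * c) * Real.exp (-(d i ^ 2) / 2)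
      rw [div_mul_cancel₀ _ hcpos.ne', hg, show -(d i ^ 2) / 2 = -(1 / 2 * d i ^ 2) by ring]
      ring
    · simp only [bartlettPDF, if_neg h, gaussianPDF, gaussianPDFReal]
      congr 1
      rw [hc, Real.rpow_neg h2pi.le, ← Real.sqrt_eq_rpow]
      simp
  have e2 : ∀ p : UpperIndex q, 0 ≤ (if p.1.1 = p.1.2 then 2 else 1) *
      ((if p.1.1 = p.1.2 then g p.1.1 / c else 1) * c) * Real.exp (-(v p ^ 2) / 2) := by
    intro p
    have := hgpos p.1.1
    split_ifs <;> positivity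
  simp only [e1]
  rw [← ENNReal.ofReal_prod_of_nonneg fun p _ => e2 p, ← ENNReal.ofReal_mul (Finset.prod_nonneg
    fun p _ => mul_nonneg (by split_ifs <;> norm_num) (hdpos _).le)]
  congr 1
  rw [Finset.prod_mul_distrib, Finset.prod_mul_distrib, Finset.prod_mul_distrib,
    Finset.prod_mul_distrib, prod_upperIndex_diag (fun i => g i / c),
    prod_upperIndex_fst (fun _ : Fin q => c), prod_upperIndex_fst (fun i => d i),
    ← Real.exp_sum, wishartPDF, if_pos hk, det_gram_triOfUpper hv]
  simp only [Matrix.det_one, Real.one_rpow, inv_one, Matrix.one_mul, trace_gram_triOfUpper, mul_one]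
  rw [bartlett_const, ← Finset.sum_div, Finset.sum_neg_distrib, ← Finset.prod_pow,
    ← Real.finsetProd_rpow _ _ fun i _ => sq_nonneg _]
  -- Row by row, `d i ^ (q - i)` from the Jacobian and `(d i ^ 2) ^ ((k - q - 1) / 2)` from the
  -- determinant combine to the power of `d i` in the chi density.
  have e3 : (∏ i, g i / c) * ∏ i : Fin q, c ^ (q - (i : ℕ)) =
      (∏ i, d i ^ (q - (i : ℕ))) * (∏ i : Fin q, ((1 / 2) ^ ((k - (i : ℝ)) / 2) /
        Real.Gamma ((k - (i : ℝ)) / 2) * (2 * Real.pi) ^ (-(((q : ℝ) - 1 - i) / 2)))) *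
        ∏ i, (d i ^ 2) ^ ((k - q - 1) / 2) := by
    rw [← Finset.prod_mul_distrib, ← Finset.prod_mul_distrib, ← Finset.prod_mul_distrib]
    refine Finset.prod_congr rfl fun i _ => ?_
    have hi : ((q - (i : ℕ) : ℕ) : ℝ) = q - i := by rw [Nat.cast_sub i.2.le]
    have e4 : c ^ (q - (i : ℕ)) = c * (2 * Real.pi) ^ (-(((q : ℝ) - 1 - i) / 2)) := by
      rw [← Real.rpow_natCast, hi, hc, ← Real.rpow_mul h2pi.le, ← Real.rpow_add h2pi]
      congr 1
      ring
    have e5 : d i ^ (q - (i : ℕ)) * (d i ^ 2) ^ ((k - q - 1) / 2) =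
        d i * (d i ^ 2) ^ ((k - (i : ℝ)) / 2 - 1) := by
      rw [← Real.rpow_natCast, hi, ← Real.rpow_two, ← Real.rpow_mul (hdpos i).le,
        ← Real.rpow_mul (hdpos i).le, ← Real.rpow_add (hdpos i)]
      nth_rewrite 2 [← Real.rpow_one (d i)]
      rw [← Real.rpow_add (hdpos i)]
      congr 1
      ring
    rw [e4, hg]
    have hc0 := hcpos.ne'
    calc _ = (d i * (d i ^ 2) ^ ((k - (i : ℝ)) / 2 - 1)) * ((1 / 2) ^ ((k - (i : ℝ)) / 2) /
        Real.Gamma ((k - (i : ℝ)) / 2) * (2 * Real.pi) ^ (-(((q : ℝ) - 1 - i) / 2))) := by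
          field_simp
      _ = _ := by rw [← e5]; ring
  rw [e3]
  ring

lemma measurable_gram_triOfUpper :
    Measurable fun v : UpperIndex q → ℝ => (triOfUpper v)ᵀ * triOfUpper v :=
  measurable_matrix_mul (measurable_matrix_transpose measurable_triOfUpper) measurable_triOfUpper

lemma prod_bartlettPDF_eq_zero {k : ℝ} {v : UpperIndex q → ℝ} (hv : v ∉ posUpperSet q) :
    ∏ p, bartlettPDF k p (v p) = 0 := by
  have : ∃ i, ¬ 0 < v ⟨(i, i), le_rfl⟩ := by
    by_contra! h
    exact hv h
  obtain ⟨i, hi⟩ := this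
  refine Finset.prod_eq_zero (Finset.mem_univ ⟨(i, i), le_rfl⟩) ?_
  rw [bartlettPDF, if_pos rfl, chiPDF, indicator_of_notMem (by exact hi)]

/-- The Bartlett decomposition of the Wishart distribution. -/
lemma wishart_one_eq_map {k : ℝ} (hk : (q : ℝ) - 1 < k) :
    wishart q k 1 = (bartlettLaw q k).map fun v => (triOfUpper v)ᵀ * triOfUpper v := by
  refine Measure.ext_of_lintegral _ fun f hf => ?_
  have hW := (measurable_wishartPDF_right q k 1).ennreal_ofReal
  rw [lintegral_map hf measurable_gram_triOfUpper, bartlettLaw_eq hk, wishart,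
    lintegral_withDensity_eq_lintegral_mul _ hW hf, wishartBase, if_pos hk,
    lintegral_lebesguePosDef (hW.mul hf), lintegral_withDensity_eq_lintegral_mul _
      (measurable_prod_bartlettPDF k)
      (g := fun v => f ((triOfUpper v)ᵀ * triOfUpper v)) (hf.comp measurable_gram_triOfUpper),
    ← lintegral_indicator measurableSet_posUpperSet]
  refine lintegral_congr fun v => ?_
  by_cases hv : v ∈ posUpperSet q
  · rw [indicator_of_mem hv, Pi.mul_apply, Pi.mul_apply, prod_bartlettPDF hk hv, mul_assoc]
  · rw [indicator_of_notMem hv, Pi.mul_apply, prod_bartlettPDF_eq_zero hv, zero_mul]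

lemma ae_bartlettLaw_mem {k : ℝ} (hk : (q : ℝ) - 1 < k) :
    ∀ᵐ v ∂bartlettLaw q k, v ∈ posUpperSet q := by
  rw [bartlettLaw_eq hk, ae_withDensity_iff (measurable_prod_bartlettPDF k)]
  refine ae_of_all _ fun v h => ?_
  by_contra hv
  exact h (prod_bartlettPDF_eq_zero hv)

/-- For `k > q - 1` this comes from the Bartlett decomposition. In the singular case the density
pulled back to `X` is that of independent standard normal entries. -/
lemma isProbabilityMeasure_wishart_one {k : ℝ} (hk : WishartDof q k) :
    IsProbabilityMeasure (wishart q k 1) := by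
  by_cases h : (q : ℝ) - 1 < k
  · have := isProbabilityMeasure_bartlettLaw h
    rw [wishart_one_eq_map h]
    exact Measure.isProbabilityMeasure_map measurable_gram_triOfUpper.aemeasurable
  · constructor
    have hW := (measurable_wishartPDF_right q k 1).ennreal_ofReal
    rw [wishart, withDensity_apply _ MeasurableSet.univ, Measure.restrict_univ, wishartBase, if_neg h,
      gramLebesgue, lintegral_map hW (measurable_gram q _)]
    set m := ⌊k⌋₊ with hm
    have hkm : (m : ℝ) = k := hk.floor_eq h
    have h2pi : 0 < 2 * Real.pi := by positivity
    have e : ∀ X : Fin q → Fin m → ℝ,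
        ENNReal.ofReal (wishartPDF q k 1 (Matrix.of X * (Matrix.of X)ᵀ)) =
          ∏ i, ∏ j, gaussianPDF 0 1 (X i j) := by
      intro X
      have e1 : ∀ x, gaussianPDF 0 1 x =
          ENNReal.ofReal ((2 * Real.pi) ^ (-(1 / 2) : ℝ) * Real.exp (-(x ^ 2) / 2)) := by
        intro x
        rw [gaussianPDF, gaussianPDFReal, Real.rpow_neg h2pi.le, ← Real.sqrt_eq_rpow]
        simp
      have hc := Real.rpow_pos_of_pos h2pi (-(1 / 2) : ℝ)
      simp only [e1]
      have e2 : ∀ i, ∏ j, ENNReal.ofReal ((2 * Real.pi) ^ (-(1 / 2) : ℝ) *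
          Real.exp (-(X i j ^ 2) / 2)) = ENNReal.ofReal (∏ j, ((2 * Real.pi) ^ (-(1 / 2) : ℝ) *
          Real.exp (-(X i j ^ 2) / 2))) := fun i =>
        (ENNReal.ofReal_prod_of_nonneg fun j _ => by positivity).symm
      simp only [e2]
      rw [← ENNReal.ofReal_prod_of_nonneg fun i _ => Finset.prod_nonneg fun j _ => by positivity]
      congr 1
      rw [wishartPDF, if_neg h]
      simp only [Matrix.det_one, Real.one_rpow, inv_one, Matrix.one_mul, trace_gram, mul_one,
        Finset.prod_mul_distrib, Finset.prod_const, Finset.card_univ, Fintype.card_fin,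
        ← Real.exp_sum, ← Finset.sum_div, Finset.sum_neg_distrib]
      rw [← pow_mul, ← Real.rpow_natCast, ← Real.rpow_mul h2pi.le]
      congr 2
      push_cast
      rw [hkm]
      ring
    simp only [e]
    have hg := measurable_gaussianPDF 0 1
    rw [volume_pi, lintegral_pi_prod _ (f := fun (_ : Fin q) (x : Fin m → ℝ) =>
      ∏ j, gaussianPDF 0 1 (x j)) fun i => Finset.measurable_prod _ fun j _ =>
        hg.comp (measurable_pi_apply j)]
    refine Finset.prod_eq_one fun i _ => ?_
    rw [volume_pi, lintegral_pi_prod _ fun _ => hg]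
    exact Finset.prod_eq_one fun j _ => lintegral_gaussianPDF_eq_one 0 one_ne_zero

lemma isProbabilityMeasure_wishart {k : ℝ} (hk : WishartDof q k) {S : Mat q} (hS : S.PosDef) :
    IsProbabilityMeasure (wishart q k S) := by
  obtain ⟨hP, e⟩ := uchol_spec hS
  have h := wishart_congr hk hP Matrix.PosDef.one
  rw [Matrix.mul_one, e] at h
  have := isProbabilityMeasure_wishart_one hk
  rw [← h]
  exact Measure.isProbabilityMeasure_map (measurable_congr_left _).aemeasurable

lemma wishart_smul {k : ℝ} (hk : WishartDof q k) {S : Mat q} (hS : S.PosDef) {c : ℝ} (hc : 0 < c) :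
    (wishart q k S).map (fun A => c • A) = wishart q k (c • S) := by
  have h := wishart_congr hk (IsPosUpper.smul_one (Real.sqrt_pos.2 hc)) hS
  have e : ∀ A : Mat q, (√c • (1 : Mat q))ᵀ * A * (√c • (1 : Mat q)) = c • A := by
    intro A
    simp [smul_smul, Real.mul_self_sqrt hc.le]
  simpa only [e] using h

lemma ae_posDef_wishart {k : ℝ} (hk : (q : ℝ) - 1 < k) (S : Mat q) :
    ∀ᵐ A ∂wishart q k S, A.PosDef := by
  rw [wishart, wishartBase, if_pos hk]
  exact (withDensity_absolutelyContinuous _ _).ae_le ae_posDef_lebesguePosDef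

instance (q : ℕ) (k : ℝ) (S : Mat q) : SigmaFinite (wishart q k S) :=
  SigmaFinite.withDensity_ofReal _

/-! ### Sum and ratio of independent Wishart matrices; the Uhlig evolution. -/

/-- The density of `wishartHom` relative to Lebesgue measure on symmetric matrices. -/
def wishartWeight (n : ℝ) (A : Mat q) : ℝ≥0∞ :=
  {A : Mat q | A.PosDef}.indicator (fun A => ENNReal.ofReal (A.det ^ ((n - q - 1) / 2))) A

lemma measurable_wishartWeight (n : ℝ) : Measurable (wishartWeight n : Mat q → ℝ≥0∞) :=
  Measurable.indicator ((measurable_matrix_det measurable_id).pow_const _).ennreal_ofReal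
    measurableSet_posDef

lemma wishartWeight_of_not_posDef (n : ℝ) {A : Mat q} (hA : ¬ A.PosDef) :
    wishartWeight n A = 0 :=
  indicator_of_notMem (by exact hA) _

lemma wishartWeight_of_posDef (n : ℝ) {A : Mat q} (hA : A.PosDef) :
    wishartWeight n A = ENNReal.ofReal (A.det ^ ((n - q - 1) / 2)) :=
  indicator_of_mem (by exact hA) _

lemma wishartWeight_congr (n : ℝ) {T : Mat q} (hT : IsPosUpper T) (A : Mat q) :
    wishartWeight n (Tᵀ * A * T) = ENNReal.ofReal (T.det ^ (n - q - 1)) * wishartWeight n A := by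
  by_cases hA : A.PosDef
  · rw [wishartWeight_of_posDef n hA, wishartWeight_of_posDef n (hT.posDef_conj hA),
      ← ENNReal.ofReal_mul (Real.rpow_nonneg hT.det_pos.le _)]
    congr 1
    rw [Matrix.det_mul, Matrix.det_mul, Matrix.det_transpose,
      show T.det * A.det * T.det = T.det ^ (2 : ℝ) * A.det by rw [Real.rpow_two]; ring,
      Real.mul_rpow (Real.rpow_nonneg hT.det_pos.le _) hA.det_pos.le,
      ← Real.rpow_mul hT.det_pos.le]
    congr 2
    ring
  · rw [wishartWeight_of_not_posDef n hA,
      wishartWeight_of_not_posDef n fun h => hA (hT.posDef_conj_iff.1 h), mul_zero]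

lemma lintegral_wishartHom' {n : ℝ} (hn : (q : ℝ) - 1 < n) {f : Mat q → ℝ≥0∞}
    (hf : Measurable f) :
    ∫⁻ A, f A ∂wishartHom q n = ∫⁻ A, wishartWeight n A * f A ∂lebesgueSym q :=
  lintegral_wishartHom hn hf

/-- Change of variables `(A₁, A₂) ↦ (A₁ + A₂, (T⁻¹)' A₂ T⁻¹)`, `T = uchol (A₁ + A₂)`. -/
lemma lintegral_wishartHom_add (hq : 0 < q) {n k : ℝ} (hn : (q : ℝ) - 1 < n)
    (hk : WishartDof q k) {F : Mat q × Mat q → ℝ≥0∞} (hF : Measurable F) :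
    ∫⁻ A₂, ∫⁻ A₁, F (A₁ + A₂, A₁) ∂wishartHom q n ∂wishartHom q k =
      ∫⁻ A, ∫⁻ B, wishartWeight n (1 - B) * F (A, (uchol A)ᵀ * (1 - B) * uchol A)
        ∂wishartHom q k ∂wishartHom q (n + k) := by
  have hw := measurable_wishartWeight (q := q) n
  have hkpos := hk.pos hq
  -- For fixed `A₂` only `A₁` is translated, so `A₂` may be singular. The indicator of `A.PosDef` is
  -- free: `A - A₂` positive definite and `A₂` positive semidefinite force it.
  have h1 : ∀ A₂ : Mat q, A₂.PosSemidef → ∫⁻ A₁, F (A₁ + A₂, A₁) ∂wishartHom q n =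
      ∫⁻ A, {A : Mat q | A.PosDef}.indicator 1 A * (wishartWeight n (A - A₂) * F (A, A - A₂))
        ∂lebesgueSym q := by
    intro A₂ hA₂
    have hs : A₂ᵀ = A₂ := by
      have := hA₂.isHermitian
      rwa [Matrix.IsHermitian, Matrix.conjTranspose_eq_transpose_of_trivial] at this
    have hm : Measurable fun A : Mat q => A - A₂ := measurable_matrix_sub measurable_id measurable_const
    have hm' : Measurable fun A : Mat q => A + A₂ := measurable_matrix_add measurable_id measurable_const
    have hg : Measurable fun A : Mat q => wishartWeight n (A - A₂) * F (A, A - A₂) :=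
      (hw.comp hm).mul (hF.comp (measurable_id.prodMk hm))
    rw [lintegral_wishartHom' hn (f := fun A₁ => F (A₁ + A₂, A₁)) (hF.comp (hm'.prodMk measurable_id))]
    have := lintegral_lebesgueSym_add hs hg
    simp only [add_sub_cancel_right] at this
    rw [this]
    refine lintegral_congr fun A => ?_
    by_cases hA : A.PosDef
    · rw [indicator_of_mem (by exact hA), Pi.one_apply, one_mul]
    · rw [wishartWeight_of_not_posDef, indicator_of_notMem (by exact hA), zero_mul, zero_mul]
      intro h
      exact hA (by simpa using h.add_posSemidef hA₂)
  rw [lintegral_congr_ae ((ae_posSemidef_wishartHom q k).mono h1)]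
  have hsub : Measurable fun p : Mat q × Mat q => p.2 - p.1 :=
    measurable_matrix_sub measurable_snd measurable_fst
  rw [lintegral_lintegral_swap]
  · have hone : Measurable fun B : Mat q => 1 - B := measurable_matrix_sub measurable_const measurable_id
    have hI : Measurable fun A : Mat q => ∫⁻ B, wishartWeight n (1 - B) *
        F (A, (uchol A)ᵀ * (1 - B) * uchol A) ∂wishartHom q k := by
      have : Measurable fun p : Mat q × Mat q => wishartWeight n (1 - p.2) *
          F (p.1, (uchol p.1)ᵀ * (1 - p.2) * uchol p.1) := by
        have hu : Measurable fun p : Mat q × Mat q => uchol p.1 := measurable_uchol.comp measurable_fst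
        have h1 : Measurable fun p : Mat q × Mat q => 1 - p.2 := hone.comp measurable_snd
        exact (hw.comp h1).mul (hF.comp (measurable_fst.prodMk (measurable_matrix_mul
          (measurable_matrix_mul (measurable_matrix_transpose hu) h1) hu)))
      exact this.lintegral_prod_right'
    rw [lintegral_wishartHom' (by linarith) hI]
    refine lintegral_congr fun A => ?_
    by_cases hA : A.PosDef
    · obtain ⟨hT, hTA⟩ := uchol_spec hA
      have hg : Measurable fun B : Mat q => wishartWeight n (A - B) * F (A, A - B) := by
        have hm : Measurable fun B : Mat q => A - B := measurable_matrix_sub measurable_const measurable_id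
        exact (hw.comp hm).mul (hF.comp (measurable_const.prodMk hm))
      simp only [indicator_of_mem (show A ∈ {A : Mat q | A.PosDef} from hA), Pi.one_apply, one_mul]
      set T := uchol A
      -- Now `A = T'T` is fixed and `A₂ = T'BT` is substituted. This produces `|T|^k` from the
      -- measure and `|T|^{n-q-1}` from the weight, in total `|A|^{(n+k-q-1)/2}`, the weight for `n
      -- + k` degrees of freedom.
      have h2 := lintegral_wishartHom_congr hk hT hg
      have h3 : ∀ B : Mat q, A - Tᵀ * B * T = Tᵀ * (1 - B) * T := by
        intro B
        rw [Matrix.mul_sub, Matrix.sub_mul, Matrix.mul_one, hTA]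
      have h5 : ∀ B : Mat q, wishartWeight n (A - Tᵀ * B * T) * F (A, A - Tᵀ * B * T) =
          ENNReal.ofReal (T.det ^ (n - q - 1)) *
            (wishartWeight n (1 - B) * F (A, Tᵀ * (1 - B) * T)) := by
        intro B
        rw [h3, wishartWeight_congr n hT, mul_assoc]
      simp only [h5] at h2
      rw [lintegral_const_mul] at h2
      · have h4 : ∫⁻ B, wishartWeight n (A - B) * F (A, A - B) ∂wishartHom q k =
            ENNReal.ofReal (T.det ^ k) * (ENNReal.ofReal (T.det ^ (-k)) *
              ∫⁻ B, wishartWeight n (A - B) * F (A, A - B) ∂wishartHom q k) := by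
          rw [← mul_assoc, ← ENNReal.ofReal_mul (Real.rpow_nonneg hT.det_pos.le _),
            ← Real.rpow_add hT.det_pos, add_neg_cancel, Real.rpow_zero, ENNReal.ofReal_one, one_mul]
        rw [h4, ← h2, ← mul_assoc, ← ENNReal.ofReal_mul (Real.rpow_nonneg hT.det_pos.le _),
          ← Real.rpow_add hT.det_pos, wishartWeight_of_posDef _ hA]
        congr 2
        rw [← hTA, Matrix.det_mul, Matrix.det_transpose, ← sq, ← Real.rpow_two,
          ← Real.rpow_mul hT.det_pos.le]
        congr 1
        ring
      · exact (hw.comp hone).mul (hF.comp (measurable_const.prodMk (measurable_matrix_mul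
          (measurable_matrix_mul measurable_const hone) measurable_const)))
    · rw [wishartWeight_of_not_posDef _ hA]
      simp only [indicator_of_notMem (show A ∉ {A : Mat q | A.PosDef} from hA), zero_mul,
        lintegral_zero]
  · refine Measurable.aemeasurable (Measurable.mul ?_ ((hw.comp hsub).mul
      (hF.comp (measurable_snd.prodMk hsub))))
    exact (measurable_one.indicator measurableSet_posDef).comp measurable_snd

/-- `(A₁ + A₂, (T⁻¹)' A₁ T⁻¹)` with `T = uchol (A₁ + A₂)`. -/
def sumRatio (A : Mat q × Mat q) : Mat q × Mat q :=
  (A.1 + A.2, ((uchol (A.1 + A.2))⁻¹)ᵀ * A.1 * (uchol (A.1 + A.2))⁻¹)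

lemma measurable_sumRatio : Measurable (sumRatio : Mat q × Mat q → _) := by
  have h : Measurable fun A : Mat q × Mat q => A.1 + A.2 :=
    measurable_matrix_add measurable_fst measurable_snd
  have h' := measurable_matrix_inv (measurable_uchol.comp h)
  exact h.prodMk (measurable_matrix_mul (measurable_matrix_mul (measurable_matrix_transpose h')
    measurable_fst) h')

/-- The sum and the ratio of independent Wishart matrices with a common scale are independent, and
the law of the ratio does not depend on the scale. -/
lemma exists_map_sumRatio (hq : 0 < q) {n k : ℝ} (hn : (q : ℝ) - 1 < n) (hk : WishartDof q k) :
    ∃ κ : Measure (Mat q), SFinite κ ∧ ∀ S : Mat q, S.PosDef →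
      ((wishart q n S).prod (wishart q k S)).map sumRatio = (wishart q (n + k) S).prod κ := by
  have hw := measurable_wishartWeight (q := q) n
  have hkpos := hk.pos hq
  have hone : Measurable fun B : Mat q => 1 - B := measurable_matrix_sub measurable_const measurable_id
  set ρ : ℝ := wishartConst q n * wishartConst q k / wishartConst q (n + k) with hρ
  have hc := wishartConst_pos q (n + k)
  have hρ0 : 0 ≤ ρ := (div_pos (mul_pos (wishartConst_pos q n) (wishartConst_pos q k)) hc).le
  have hd : Measurable fun B : Mat q => ENNReal.ofReal ρ * wishartWeight n (1 - B) :=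
    measurable_const.mul (hw.comp hone)
  -- The ratio is `1 - B` with `B = (T⁻¹)' A₂ T⁻¹`. Its law is chosen before `S`, and `ρ` collects
  -- the three normalizing constants.
  refine ⟨((wishartHom q k).withDensity fun B => ENNReal.ofReal ρ * wishartWeight n (1 - B)).map
    fun B => 1 - B, inferInstance, fun S hS => Measure.ext_of_lintegral _ fun G hG => ?_⟩
  rw [lintegral_map hG measurable_sumRatio,
    lintegral_prod_symm' (fun A => G (sumRatio A)) (hG.comp measurable_sumRatio), lintegral_prod _ hG.aemeasurable]
  have hKn := (measurable_wishartKernel q n S).ennreal_ofReal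
  have hKk := (measurable_wishartKernel q k S).ennreal_ofReal
  have hKnk := (measurable_wishartKernel q (n + k) S).ennreal_ofReal
  have hsec : ∀ A₂ : Mat q, Measurable fun A₁ : Mat q => G (sumRatio (A₁, A₂)) := fun A₂ =>
    (hG.comp measurable_sumRatio).comp (measurable_id.prodMk measurable_const)
  have hGr : Measurable fun A₂ : Mat q => ∫⁻ A₁, G (sumRatio (A₁, A₂)) ∂wishart q n S :=
    (hG.comp measurable_sumRatio).lintegral_prod_left'
  have hGκ : Measurable fun A : Mat q => ∫⁻ Ψ, G (A, Ψ)
      ∂(((wishartHom q k).withDensity fun B => ENNReal.ofReal ρ * wishartWeight n (1 - B)).map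
        fun B => 1 - B) := hG.lintegral_prod_right'
  rw [lintegral_wishart _ _ hGr, lintegral_wishart _ _ hGκ]
  set F : Mat q × Mat q → ℝ≥0∞ := fun p =>
    ENNReal.ofReal ρ * ENNReal.ofReal (wishartKernel q (n + k) S p.1) *
      G (p.1, ((uchol p.1)⁻¹)ᵀ * p.2 * (uchol p.1)⁻¹) with hFdef
  have hF : Measurable F := by
    have h' : Measurable fun p : Mat q × Mat q => (uchol p.1)⁻¹ :=
      measurable_matrix_inv (measurable_uchol.comp measurable_fst)
    exact (measurable_const.mul (hKnk.comp measurable_fst)).mul (hG.comp (measurable_fst.prodMk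
      (measurable_matrix_mul (measurable_matrix_mul (measurable_matrix_transpose h')
        measurable_snd) h')))
  have hL : ∀ A₂ : Mat q, ENNReal.ofReal (wishartKernel q k S A₂) *
      ∫⁻ A₁, G (sumRatio (A₁, A₂)) ∂wishart q n S =
      ∫⁻ A₁, F (A₁ + A₂, A₁) ∂wishartHom q n := by
    intro A₂
    rw [lintegral_wishart _ _ (hsec A₂), ← lintegral_const_mul
      (f := fun A₁ => ENNReal.ofReal (wishartKernel q n S A₁) * G (sumRatio (A₁, A₂))) _
      (hKn.mul (hsec A₂))]
    refine lintegral_congr fun A₁ => ?_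
    simp only [hFdef]
    rw [← mul_assoc]
    congr 1
    have hdS := Real.rpow_nonneg hS.det_pos.le (-(k / 2))
    have hck := wishartConst_pos q k
    have hk0 : 0 ≤ wishartKernel q k S A₂ :=
      mul_nonneg (mul_nonneg hck.le hdS) (Real.exp_nonneg _)
    rw [← ENNReal.ofReal_mul hk0,
      ← ENNReal.ofReal_mul hρ0]
    congr 1
    -- With a common scale, the product of the two kernels depends on `A₁` and `A₂` only through
    -- their sum.
    simp only [wishartKernel, hρ, Matrix.mul_add, Matrix.trace_add]
    rw [show -((n + k) / 2) = -(n / 2) + -(k / 2) by ring, Real.rpow_add hS.det_pos,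
      show -((S⁻¹ * A₁).trace + (S⁻¹ * A₂).trace) / 2 =
        -(S⁻¹ * A₁).trace / 2 + -(S⁻¹ * A₂).trace / 2 by ring, Real.exp_add]
    field_simp
  simp only [hL]
  rw [lintegral_wishartHom_add hq hn hk hF]
  have hPD : ∀ᵐ A ∂wishartHom q (n + k), A.PosDef := by
    rw [wishartHom, if_pos (by linarith)]
    exact (withDensity_absolutelyContinuous _ _).ae_le ae_posDef_lebesguePosDef
  refine lintegral_congr_ae (hPD.mono fun A hA => ?_)
  obtain ⟨hT, -⟩ := uchol_spec hA
  have hGA : Measurable fun Ψ : Mat q => G (A, Ψ) := hG.comp (measurable_const.prodMk measurable_id)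
  dsimp only
  rw [lintegral_map hGA hone, lintegral_withDensity_eq_lintegral_mul _ hd
    (g := fun B => G (A, 1 - B)) (hGA.comp hone),
    ← lintegral_const_mul (f := (fun B => ENNReal.ofReal ρ * wishartWeight n (1 - B)) *
      fun B => G (A, 1 - B)) _ (hd.mul (hGA.comp hone))]
  refine lintegral_congr fun B => ?_
  have hTu : IsUnit (uchol A)ᵀ.det := by rw [Matrix.det_transpose]; exact hT.isUnit_det
  have e : ((uchol A)⁻¹)ᵀ * ((uchol A)ᵀ * (1 - B) * uchol A) * (uchol A)⁻¹ = 1 - B := by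
    rw [Matrix.transpose_nonsing_inv, Matrix.mul_assoc _ _ (uchol A),
      Matrix.nonsing_inv_mul_cancel_left _ _ hTu,
      Matrix.mul_nonsing_inv_cancel_right _ _ hT.isUnit_det]
  simp only [hFdef, Pi.mul_apply, e]
  ring

/-- The law of the ratio is the same for all scales, and at `S = 1` it is `matrixBeta` by
definition. -/
lemma map_sumRatio (hq : 0 < q) {n k : ℝ} (hn : (q : ℝ) - 1 < n) (hk : WishartDof q k) {S : Mat q}
    (hS : S.PosDef) : ((wishart q n S).prod (wishart q k S)).map sumRatio =
      (wishart q (n + k) S).prod (matrixBeta q n k) := by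
  obtain ⟨κ, hκ, h⟩ := exists_map_sumRatio hq hn hk
  have hnk : (q : ℝ) - 1 < n + k := by linarith [hk.pos hq]
  have := isProbabilityMeasure_wishart_one (q := q) (Or.inr hnk)
  have e : matrixBeta q n k = κ := by
    have h1 := h 1 Matrix.PosDef.one
    have h2 : matrixBeta q n k =
        (((wishart q n 1).prod (wishart q k 1)).map sumRatio).map Prod.snd := by
      rw [Measure.map_map measurable_snd measurable_sumRatio]
      rfl
    rw [h2, h1, Measure.map_snd_prod, measure_univ, one_smul]
  rw [h S hS, e]

lemma isProbabilityMeasure_matrixBeta {n k : ℝ} (hn : (q : ℝ) - 1 < n) (hk : WishartDof q k) :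
    IsProbabilityMeasure (matrixBeta q n k) := by
  have := isProbabilityMeasure_wishart_one (q := q) (Or.inr hn)
  have := isProbabilityMeasure_wishart_one hk
  exact Measure.isProbabilityMeasure_map (measurable_snd.comp measurable_sumRatio).aemeasurable

lemma measurable_map_of_uncurry {α β γ : Type*} [MeasurableSpace α] [MeasurableSpace β]
    [MeasurableSpace γ] (μ : Measure β) [SFinite μ] {F : α → β → γ}
    (hF : Measurable (Function.uncurry F)) : Measurable fun x => μ.map (F x) := by
  refine Measure.measurable_of_measurable_coe _ fun s hs => ?_
  have : ∀ x, μ.map (F x) s = μ (Prod.mk x ⁻¹' (Function.uncurry F ⁻¹' s)) := fun x =>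
    Measure.map_apply hF.of_uncurry_left hs
  simp only [this]
  exact measurable_measure_prodMk_left (hF hs)

lemma ae_posSemidef_wishart (q : ℕ) (k : ℝ) (S : Mat q) :
    ∀ᵐ A ∂wishart q k S, A.PosSemidef := by
  rw [wishart]
  exact (withDensity_absolutelyContinuous _ _).ae_le (ae_posSemidef_wishartBase q k)

/-- The evolution of the Uhlig extended model. -/
lemma wishart_bind_matrixBeta (hq : 0 < q) {n k : ℝ} (hn : (q : ℝ) - 1 < n) (hk : WishartDof q k)
    {S : Mat q} (hS : S.PosDef) {c : ℝ} (hc : 0 < c) :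
    ((wishart q (n + k) S).bind fun Φ =>
      (matrixBeta q n k).map fun Ψ => c • ((uchol Φ)ᵀ * Ψ * uchol Φ)) = wishart q n (c • S) := by
  have := isProbabilityMeasure_matrixBeta hn hk
  have hk1 := isProbabilityMeasure_wishart hk hS
  have hm : Measurable fun p : Mat q × Mat q => c • ((uchol p.1)ᵀ * p.2 * uchol p.1) := by
    have hu : Measurable fun p : Mat q × Mat q => uchol p.1 := measurable_uchol.comp measurable_fst
    exact measurable_matrix_smul (measurable_matrix_mul (measurable_matrix_mul
      (measurable_matrix_transpose hu) measurable_snd) hu)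
  have hms : ∀ Φ : Mat q, Measurable fun Ψ : Mat q => c • ((uchol Φ)ᵀ * Ψ * uchol Φ) := fun Φ =>
    measurable_matrix_smul (measurable_congr_left (uchol Φ))
  refine Measure.ext_of_lintegral _ fun f hf => ?_
  rw [Measure.lintegral_bind
    (measurable_map_of_uncurry (matrixBeta q n k)
      (F := fun Φ Ψ => c • ((uchol Φ)ᵀ * Ψ * uchol Φ)) hm).aemeasurable hf.aemeasurable]
  simp only [lintegral_map hf (hms _)]
  -- The independent pair `(Φ, Ψ)` is replaced by the sum and ratio of `(A₁, A₂)`. Multiplying back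
  -- by the Cholesky factor of the sum leaves `A₁`, and `A₂` integrates out.
  rw [← lintegral_prod (fun p : Mat q × Mat q => f (c • ((uchol p.1)ᵀ * p.2 * uchol p.1)))
    (hf.comp hm).aemeasurable, ← map_sumRatio hq hn hk hS,
    lintegral_map (f := fun p : Mat q × Mat q => f (c • ((uchol p.1)ᵀ * p.2 * uchol p.1)))
      (hf.comp hm) measurable_sumRatio,
    lintegral_prod_symm' (fun A : Mat q × Mat q => f (c • ((uchol (sumRatio A).1)ᵀ *
      (sumRatio A).2 * uchol (sumRatio A).1))) ((hf.comp hm).comp measurable_sumRatio),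
    ← wishart_smul (Or.inr hn) hS hc,
    lintegral_map (g := fun A : Mat q => c • A) hf (measurable_matrix_smul measurable_id)]
  have e : ∀ᵐ A₂ ∂wishart q k S, ∫⁻ A₁, f (c • ((uchol (sumRatio (A₁, A₂)).1)ᵀ *
      (sumRatio (A₁, A₂)).2 * uchol (sumRatio (A₁, A₂)).1)) ∂wishart q n S =
      ∫⁻ A, f (c • A) ∂wishart q n S := by
    refine (ae_posSemidef_wishart q k S).mono fun A₂ hA₂ => lintegral_congr_ae ((ae_posDef_wishart hn S).mono fun A₁ hA₁ => ?_)
    have hT := (uchol_spec (hA₁.add_posSemidef hA₂)).1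
    have hTu : IsUnit (uchol (A₁ + A₂))ᵀ.det := by
      rw [Matrix.det_transpose]; exact hT.isUnit_det
    simp only [sumRatio]
    rw [Matrix.transpose_nonsing_inv, Matrix.mul_assoc _ _ (uchol (A₁ + A₂)),
      Matrix.nonsing_inv_mul_cancel_right _ _ hT.isUnit_det,
      Matrix.mul_nonsing_inv_cancel_left _ _ hTu]
  rw [lintegral_congr_ae e, lintegral_const, measure_univ, mul_one]

/-! ### Beta-gamma algebra and the beta-Bartlett evolution. -/

section BetaGamma

lemma lintegral_comp_div {u : ℝ} (hu : 0 < u) (g : ℝ → ℝ≥0∞) (hg : Measurable g) :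
    ∫⁻ η, g η = ∫⁻ x, ENNReal.ofReal u⁻¹ * g (x / u) := by
  have h := Real.smul_map_volume_mul_right (inv_ne_zero hu.ne')
  have hm : Measurable fun x : ℝ => x * u⁻¹ := measurable_id.mul_const _
  have hgm : Measurable fun x : ℝ => g (x / u) := hg.comp (measurable_id.div_const u)
  conv_lhs => rw [← h]
  rw [lintegral_smul_measure, lintegral_map hg hm, abs_of_pos (inv_pos.2 hu), smul_eq_mul,
    lintegral_const_mul _ hgm]
  rfl

/-- With `x = ηu`, the joint density of `(x, u)` is that of `x` and `u - x` as independent gamma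
variables. The excluded values `u = 0`, `x = 0`, `x = u` are null, and there the boundary
conventions of the densities may disagree. -/
lemma gammaPDF_mul_betaPDF {a b r u x : ℝ} (ha : 0 < a) (hb : 0 < b) (hr : 0 < r) (hu : u ≠ 0)
    (hx : x ≠ 0) (hxu : x ≠ u) :
    gammaPDF (a + b) r u * (ENNReal.ofReal u⁻¹ * betaPDF a b (x / u)) =
      gammaPDF a r x * gammaPDF b r (u - x) := by
  rcases lt_or_gt_of_ne hu with hu | hu
  · rw [gammaPDF_of_neg hu, zero_mul]
    rcases lt_or_gt_of_ne hx with hx | hx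
    · rw [gammaPDF_of_neg hx, zero_mul]
    · rw [gammaPDF_of_neg (show u - x < 0 by linarith), mul_zero]
  rcases lt_or_gt_of_ne hx with hx | hx
  · rw [gammaPDF_of_neg hx, zero_mul, betaPDF_eq_zero_of_nonpos (div_neg_of_neg_of_pos hx hu).le,
      mul_zero, mul_zero]
  rcases lt_or_gt_of_ne hxu with hxu | hxu
  · have hux : 0 < u - x := sub_pos.2 hxu
    rw [gammaPDF_of_nonneg hu.le, gammaPDF_of_nonneg hx.le, gammaPDF_of_nonneg hux.le,
      betaPDF_of_pos_lt_one (div_pos hx hu) ((div_lt_one hu).2 hxu)]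
    have hΓ := Real.Gamma_pos_of_pos (add_pos ha hb)
    have hΓa := Real.Gamma_pos_of_pos ha
    have hΓb := Real.Gamma_pos_of_pos hb
    rw [← ENNReal.ofReal_mul (inv_pos.2 hu).le, ← ENNReal.ofReal_mul (by positivity),
      ← ENNReal.ofReal_mul (by positivity)]
    congr 1
    rw [beta, show 1 - x / u = (u - x) / u by field_simp, Real.div_rpow hx.le hu.le,
      Real.div_rpow hux.le hu.le, Real.rpow_add hr,
      show u ^ (a + b - 1) = u ^ (a - 1) * u ^ (b - 1) * u by
        rw [← Real.rpow_add hu]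
        nth_rewrite 3 [← Real.rpow_one u]
        rw [← Real.rpow_add hu]
        congr 1
        ring,
      show Real.exp (-(r * u)) = Real.exp (-(r * x)) * Real.exp (-(r * (u - x))) by
        rw [← Real.exp_add]
        congr 1
        ring]
    have h1 := (Real.rpow_pos_of_pos hu (a - 1)).ne'
    have h2 := (Real.rpow_pos_of_pos hu (b - 1)).ne'
    field_simp
  · rw [gammaPDF_of_neg (show u - x < 0 by linarith), mul_zero,
      betaPDF_eq_zero_of_one_le ((one_le_div hu).2 hxu.le), mul_zero, mul_zero]

/-- The product of independent `Beta(a, b)` and `Gamma(a + b)` variables is `Gamma(a)`. -/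
lemma lintegral_beta_gamma {a b r : ℝ} (ha : 0 < a) (hb : 0 < b) (hr : 0 < r) {f : ℝ → ℝ≥0∞}
    (hf : Measurable f) :
    ∫⁻ η, ∫⁻ u, f (η * u) ∂gammaMeasure (a + b) r ∂betaMeasure a b =
      ∫⁻ x, f x ∂gammaMeasure a r := by
  have hγ : ∀ c, Measurable (gammaPDF c r) := fun c => (measurable_gammaPDFReal c r).ennreal_ofReal
  have hβ : Measurable (betaPDF a b) := (measurable_betaPDFReal a b).ennreal_ofReal
  have := isProbabilityMeasure_gammaMeasure (add_pos ha hb) hr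
  have := isProbabilityMeasureBeta ha hb
  have h0 : Measurable (Function.uncurry fun η u : ℝ => f (η * u)) :=
    hf.comp (measurable_fst.mul measurable_snd)
  rw [lintegral_lintegral_swap h0.aemeasurable]
  have h1 : ∀ u, Measurable fun η => f (η * u) := fun u => hf.comp (measurable_id.mul_const u)
  have h2 : Measurable fun u => ∫⁻ η, f (η * u) ∂betaMeasure a b :=
    (hf.comp (measurable_snd.mul measurable_fst)).lintegral_prod_right'
  rw [gammaMeasure, gammaMeasure, lintegral_withDensity_eq_lintegral_mul _ (hγ _) h2,
    lintegral_withDensity_eq_lintegral_mul _ (hγ _) hf]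
  have h3 : ∀ᵐ u : ℝ, (gammaPDF (a + b) r * fun u => ∫⁻ η, f (η * u) ∂betaMeasure a b) u =
      ∫⁻ x, gammaPDF a r x * gammaPDF b r (u - x) * f x := by
    have h0 : ∀ᵐ u : ℝ, u ≠ 0 := by
      simp [ae_iff]
    refine h0.mono fun u hu => ?_
    rw [Pi.mul_apply]
    rcases lt_or_gt_of_ne hu with hneg | hpos
    · rw [gammaPDF_of_neg hneg, zero_mul, eq_comm, lintegral_eq_zero_iff]
      · refine ae_of_all _ fun x => ?_
        dsimp only [Pi.zero_apply]
        by_cases hx : x < 0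
        · rw [gammaPDF_of_neg hx, zero_mul, zero_mul]
        · rw [gammaPDF_of_neg (show u - x < 0 by linarith), mul_zero, zero_mul]
      · exact ((hγ a).mul ((hγ b).comp (measurable_const.sub measurable_id))).mul hf
    · have hm : Measurable fun x => ENNReal.ofReal u⁻¹ * (betaPDF a b (x / u) * f x) :=
        measurable_const.mul ((hβ.comp (measurable_id.div_const u)).mul hf)
      rw [betaMeasure, lintegral_withDensity_eq_lintegral_mul _ hβ (h1 u),
        lintegral_comp_div hpos _ (hβ.mul (h1 u))]
      simp only [Pi.mul_apply, div_mul_cancel₀ _ hpos.ne']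
      rw [← lintegral_const_mul _ hm]
      have h4 : ∀ᵐ x : ℝ, x ≠ 0 := by simp [ae_iff]
      have h5 : ∀ᵐ x : ℝ, x ≠ u := by simp [ae_iff]
      refine lintegral_congr_ae ?_
      filter_upwards [h4, h5] with x hx hxu
      rw [← gammaPDF_mul_betaPDF ha hb hr hu hx hxu]
      ring
  -- For fixed `x` the integral over `u` is the total mass of the gamma density of `u - x`, which is
  -- one.
  rw [lintegral_congr_ae h3, lintegral_lintegral_swap]
  · refine lintegral_congr fun x => ?_
    have h6 : Measurable fun u => gammaPDF b r (u - x) := (hγ b).comp (measurable_id.sub_const x)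
    have : ∀ u, gammaPDF a r x * gammaPDF b r (u - x) * f x =
        gammaPDF a r x * f x * gammaPDF b r (u - x) := fun u => by ring
    simp only [this]
    rw [lintegral_const_mul _ h6, lintegral_sub_right_eq_self (gammaPDF b r) x,
      lintegral_gammaPDF_eq_one hb hr, mul_one, Pi.mul_apply]
  · exact (((hγ a).comp measurable_snd).mul ((hγ b).comp
      (measurable_fst.sub measurable_snd))).mul (hf.comp measurable_snd) |>.aemeasurable

lemma lintegral_beta_chi {a b : ℝ} (ha : 0 < a) (hb : 0 < b) {f : ℝ → ℝ≥0∞}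
    (hf : Measurable f) :
    ∫⁻ η, ∫⁻ x, f (√η * x) ∂chiMeasure (a + b) ∂betaMeasure (a / 2) (b / 2) =
      ∫⁻ x, f x ∂chiMeasure a := by
  have hs := Real.continuous_sqrt.measurable
  rw [chiMeasure, chiMeasure, lintegral_map hf hs,
    ← lintegral_beta_gamma (half_pos ha) (half_pos hb) (half_pos one_pos)
      (f := fun x => f (√x)) (hf.comp hs), ← add_div]
  have h0 : ∀ᵐ η ∂betaMeasure (a / 2) (b / 2), 0 ≤ η := by
    have hm : Measurable (betaPDF (a / 2) (b / 2)) := (measurable_betaPDFReal _ _).ennreal_ofReal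
    rw [betaMeasure, ae_withDensity_iff hm]
    refine ae_of_all _ fun η h => ?_
    by_contra hη
    exact h (betaPDF_eq_zero_of_nonpos (not_le.1 hη).le)
  refine lintegral_congr_ae (h0.mono fun η hη => ?_)
  dsimp only
  rw [lintegral_map (f := fun x => f (√η * x)) (hf.comp (measurable_id.const_mul _)) hs]
  simp only [Real.sqrt_mul hη]

end BetaGamma

/-- Multiply the diagonal coordinates by `√η_i`. -/
def shrinkCoord (x : (UpperIndex q → ℝ) × (Fin q → ℝ)) : UpperIndex q → ℝ :=
  fun p => if p.1.1 = p.1.2 then √(x.2 p.1.1) * x.1 p else x.1 p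

lemma measurable_shrinkCoord :
    Measurable (shrinkCoord : (UpperIndex q → ℝ) × (Fin q → ℝ) → _) := by
  refine measurable_pi_lambda _ fun p => ?_
  unfold shrinkCoord
  split_ifs
  · exact ((measurable_pi_apply _).comp measurable_snd).sqrt.mul
      ((measurable_pi_apply _).comp measurable_fst)
  · exact (measurable_pi_apply _).comp measurable_fst

/-- Shrinking the diagonal of the Bartlett factor by beta variables lowers the degrees of
freedom. -/
lemma map_shrinkCoord {n k : ℝ} (hn : (q : ℝ) - 1 < n) (hk : 0 < k) :
    ((bartlettLaw q (n + k)).prod (Measure.pi fun i : Fin q =>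
      betaMeasure ((n - (i : ℝ)) / 2) (k / 2))).map shrinkCoord = bartlettLaw q n := by
  have hnk : (q : ℝ) - 1 < n + k := by linarith
  have hi := fun p : UpperIndex q => isProbabilityMeasure_bartlettEntry hn p
  have hi' := fun p : UpperIndex q => isProbabilityMeasure_bartlettEntry hnk p
  have hB := isProbabilityMeasure_bartlettLaw hnk
  have hβ := fun i : Fin q => isProbabilityMeasureBeta (half_pos (sub_index_pos hn i)) (half_pos hk)
  symm
  refine Measure.pi_eq fun s hs => ?_
  have hS : MeasurableSet (univ.pi s) := MeasurableSet.univ_pi hs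
  rw [Measure.map_apply measurable_shrinkCoord hS,
    Measure.prod_apply_symm (measurable_shrinkCoord hS)]
  -- For fixed `η`, the preimage of a box is again a box: its diagonal sides depend on one `η i`
  -- each, giving `F i`, and its off-diagonal sides do not change, giving `C`. Hence the integral
  -- over `η` factorises.
  set F : Fin q → ℝ → ℝ≥0∞ := fun i η =>
    chiMeasure (n + k - i) ((fun x => √η * x) ⁻¹' s ⟨(i, i), le_rfl⟩) with hF
  set C : ℝ≥0∞ := ∏ p : UpperIndex q, if p.1.1 = p.1.2 then 1 else gaussianReal 0 1 (s p) with hC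
  have hχ : ∀ i : Fin q, IsProbabilityMeasure (chiMeasure (n + k - i)) := fun i =>
    isProbabilityMeasure_chiMeasure (sub_index_pos hnk i)
  have hFm : ∀ i, Measurable (F i) := by
    intro i
    have : MeasurableSet ((fun x : ℝ × ℝ => √x.1 * x.2) ⁻¹' s ⟨(i, i), le_rfl⟩) :=
      (measurable_fst.sqrt.mul measurable_snd) (hs _)
    exact measurable_measure_prodMk_left this
  have h1 : ∀ η : Fin q → ℝ, bartlettLaw q (n + k)
      ((fun v => (v, η)) ⁻¹' (shrinkCoord ⁻¹' univ.pi s)) = (∏ i, F i (η i)) * C := by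
    intro η
    have : (fun v => (v, η)) ⁻¹' (shrinkCoord ⁻¹' univ.pi s) = univ.pi fun p : UpperIndex q =>
        if p.1.1 = p.1.2 then (fun x => √(η p.1.1) * x) ⁻¹' s p else s p := by
      ext v
      simp only [mem_preimage, mem_univ_pi, shrinkCoord]
      refine forall_congr' fun p => ?_
      split_ifs <;> rfl
    rw [this, bartlettLaw, Measure.pi_pi, ← prod_upperIndex_diag (fun i => F i (η i)), hC,
      ← Finset.prod_mul_distrib]
    refine Finset.prod_congr rfl ?_
    rintro ⟨⟨i, j⟩, hij⟩ -
    by_cases h : i = j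
    · subst h
      simp [hF]
    · simp [h]
  simp only [h1]
  have hFp : Measurable fun η : Fin q → ℝ => ∏ i, F i (η i) :=
    Finset.measurable_prod _ fun i _ => (hFm i).comp (measurable_pi_apply i)
  rw [lintegral_mul_const _ hFp, lintegral_pi_prod _ hFm]
  have h2 : ∀ i : Fin q, ∫⁻ η, F i η ∂betaMeasure ((n - (i : ℝ)) / 2) (k / 2) =
      chiMeasure (n - i) (s ⟨(i, i), le_rfl⟩) := by
    intro i
    have := lintegral_beta_chi (sub_index_pos hn i) hk
      (f := (s ⟨(i, i), le_rfl⟩).indicator 1) (measurable_one.indicator (hs _))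
    rw [lintegral_indicator_one (hs _)] at this
    rw [← this]
    refine lintegral_congr fun η => ?_
    simp only [hF]
    rw [show n + k - (i : ℝ) = n - i + k by ring,
      ← lintegral_indicator_one (s := (fun x => √η * x) ⁻¹' s ⟨(i, i), le_rfl⟩)
        ((measurable_id.const_mul (√η)) (hs _))]
    rfl
  simp only [h2]
  rw [← prod_upperIndex_diag (fun i : Fin q => chiMeasure (n - i) (s ⟨(i, i), le_rfl⟩)), hC,
    ← Finset.prod_mul_distrib]
  refine Finset.prod_congr rfl ?_
  rintro ⟨⟨i, j⟩, hij⟩ -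
  by_cases h : i = j
  · subst h
    simp
  · simp [h]

lemma triOfUpper_shrinkCoord (v : UpperIndex q → ℝ) (η : Fin q → ℝ) :
    triOfUpper (shrinkCoord (v, η)) = BBParam.shrinkDiag η (triOfUpper v) := by
  ext i j
  by_cases h : i = j
  · subst h
    simp [triOfUpper, shrinkCoord, BBParam.shrinkDiag]
  · simp [triOfUpper, shrinkCoord, BBParam.shrinkDiag, h]

lemma measurable_gram_shrinkDiag {α : Type*} [MeasurableSpace α] {U P : α → Mat q}
    {η : α → Fin q → ℝ} (hU : Measurable U) (hP : Measurable P) (hη : Measurable η) (c : ℝ) :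
    Measurable fun x => c • ((BBParam.shrinkDiag (η x) (U x) * P x)ᵀ *
      (BBParam.shrinkDiag (η x) (U x) * P x)) := by
  have h : Measurable fun x => BBParam.shrinkDiag (η x) (U x) := by
    rw [measurable_matrix_iff] at hU ⊢
    intro i j
    simp only [BBParam.shrinkDiag, Matrix.of_apply]
    split_ifs
    · exact ((measurable_pi_apply i).comp hη).sqrt.mul (hU i i)
    · exact hU i j
  have h' := measurable_matrix_mul h hP
  exact measurable_matrix_smul (measurable_matrix_mul (measurable_matrix_transpose h') h')

/-- The evolution of the beta-Bartlett model. -/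
lemma wishart_bind_shrinkDiag {n k : ℝ} (hn : (q : ℝ) - 1 < n) (hk : 0 < k) {S : Mat q}
    (hS : S.PosDef) {c : ℝ} (hc : 0 < c) :
    ((wishart q (n + k) S).bind fun Φ =>
      (Measure.pi fun i : Fin q => betaMeasure ((n - (i : ℝ)) / 2) (k / 2)).map fun η =>
        c • ((BBParam.shrinkDiag η (uchol Φ * (uchol S)⁻¹) * uchol S)ᵀ *
          (BBParam.shrinkDiag η (uchol Φ * (uchol S)⁻¹) * uchol S))) = wishart q n (c • S) := by
  have hnk : (q : ℝ) - 1 < n + k := by linarith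
  have hβ := fun i : Fin q => isProbabilityMeasureBeta (half_pos (sub_index_pos hn i)) (half_pos hk)
  have hB := isProbabilityMeasure_bartlettLaw hnk
  obtain ⟨hP, hPS⟩ := uchol_spec hS
  set P := uchol S
  set β : Measure (Fin q → ℝ) := Measure.pi fun i : Fin q => betaMeasure ((n - (i : ℝ)) / 2) (k / 2)
  have hbart : ∀ m : ℝ, (q : ℝ) - 1 < m → wishart q m S =
      (bartlettLaw q m).map fun v => Pᵀ * ((triOfUpper v)ᵀ * triOfUpper v) * P := by
    intro m hm
    have h := Measure.map_map (μ := bartlettLaw q m) (measurable_congr_left P)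
      measurable_gram_triOfUpper
    rw [Function.comp_def] at h
    rw [← h, ← wishart_one_eq_map hm, wishart_congr (Or.inr hm) hP Matrix.PosDef.one, Matrix.mul_one, hPS]
  have hU : Measurable fun x : Mat q × (Fin q → ℝ) => uchol x.1 * P⁻¹ :=
    measurable_matrix_mul (measurable_uchol.comp measurable_fst) measurable_const
  have hm := measurable_gram_shrinkDiag hU (measurable_const (a := P)) measurable_snd c
  refine Measure.ext_of_lintegral _ fun f hf => ?_
  have hker := measurable_map_of_uncurry β (F := fun Φ η =>
    c • ((BBParam.shrinkDiag η (uchol Φ * P⁻¹) * P)ᵀ *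
      (BBParam.shrinkDiag η (uchol Φ * P⁻¹) * P))) hm
  have hI : Measurable fun Φ : Mat q => ∫⁻ A, f A ∂β.map fun η =>
      c • ((BBParam.shrinkDiag η (uchol Φ * P⁻¹) * P)ᵀ *
      (BBParam.shrinkDiag η (uchol Φ * P⁻¹) * P)) := (Measure.measurable_lintegral hf).comp hker
  set g : (UpperIndex q → ℝ) → ℝ≥0∞ := fun v =>
    f (c • (Pᵀ * ((triOfUpper v)ᵀ * triOfUpper v) * P)) with hgdef
  have hPm : Measurable fun v : UpperIndex q → ℝ => Pᵀ * ((triOfUpper v)ᵀ * triOfUpper v) * P :=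
    (measurable_congr_left P).comp measurable_gram_triOfUpper
  have hg : Measurable g := hf.comp (measurable_matrix_smul hPm)
  have hsm : Measurable fun A : Mat q => c • A := measurable_matrix_smul measurable_id
  rw [Measure.lintegral_bind hker.aemeasurable hf.aemeasurable, ← wishart_smul (Or.inr hn) hS hc,
    lintegral_map hf hsm, hbart _ hnk, hbart _ hn,
    lintegral_map hI hPm, lintegral_map (f := fun A => f (c • A)) (hf.comp hsm) hPm]
  change _ = ∫⁻ v, g v ∂bartlettLaw q n
  rw [← map_shrinkCoord hn hk, lintegral_map hg measurable_shrinkCoord,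
    lintegral_prod (fun x => g (shrinkCoord x)) (hg.comp measurable_shrinkCoord).aemeasurable]
  refine lintegral_congr_ae ((ae_bartlettLaw_mem hnk).mono fun v hv => ?_)
  have hR := isPosUpper_triOfUpper hv
  have e1 : Pᵀ * ((triOfUpper v)ᵀ * triOfUpper v) * P =
      (triOfUpper v * P)ᵀ * (triOfUpper v * P) := by
    simp only [Matrix.transpose_mul, Matrix.mul_assoc]
  -- Uniqueness of the Cholesky factor: `uchol Φ * P⁻¹` recovers the Bartlett factor with
  -- independent entries.
  have e2 : uchol (Pᵀ * ((triOfUpper v)ᵀ * triOfUpper v) * P) * P⁻¹ = triOfUpper v := by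
    rw [e1, uchol_gram (hR.mul hP), Matrix.mul_nonsing_inv_cancel_right _ _ hP.isUnit_det]
  have hηm : Measurable fun η : Fin q → ℝ => c • ((BBParam.shrinkDiag η (triOfUpper v) * P)ᵀ *
      (BBParam.shrinkDiag η (triOfUpper v) * P)) :=
    measurable_gram_shrinkDiag measurable_const measurable_const measurable_id c
  simp only [e2]
  rw [lintegral_map hf hηm]
  refine lintegral_congr fun η => ?_
  simp only [hgdef, triOfUpper_shrinkCoord, Matrix.transpose_mul, Matrix.mul_assoc]

/-! ### Conjugate updating of a Wishart prior on the precision. -/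

/-- The part of the Wishart density that does not depend on the scale matrix. -/
def wishartObsConst (q : ℕ) (k : ℝ) (y : Mat q) : ℝ :=
  wishartConst q k * if (q : ℝ) - 1 < k then y.det ^ ((k - q - 1) / 2) else 1

lemma wishartPDF_eq (k : ℝ) (S y : Mat q) : wishartPDF q k S y =
    wishartObsConst q k y * S.det ^ (-(k / 2)) * Real.exp (-(S⁻¹ * y).trace / 2) := by
  rw [wishartPDF, wishartObsConst, wishartConst]
  split_ifs <;> ring

lemma wishartObsConst_nonneg (k : ℝ) {y : Mat q} (hy : y.PosSemidef) :
    0 ≤ wishartObsConst q k y := by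
  refine mul_nonneg (wishartConst_pos q k).le ?_
  split_ifs
  · exact Real.rpow_nonneg hy.det_nonneg _
  · exact zero_le_one

lemma wishartPDF_nonneg (k : ℝ) {S y : Mat q} (hS : S.PosDef) (hy : y.PosSemidef) :
    0 ≤ wishartPDF q k S y := by
  rw [wishartPDF_eq]
  exact mul_nonneg (mul_nonneg (wishartObsConst_nonneg k hy) (Real.rpow_nonneg hS.det_pos.le _))
    (Real.exp_nonneg _)

lemma measurable_wishartObs (q : ℕ) (k : ℝ) :
    Measurable fun p : Mat q × Mat q => ENNReal.ofReal (wishartPDF q k (k • p.1)⁻¹ p.2) :=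
  ((measurable_wishartPDF q k).comp ((measurable_matrix_inv
    (measurable_matrix_smul measurable_fst)).prodMk measurable_snd)).ennreal_ofReal

lemma measurable_wishartObs_left (k : ℝ) (y : Mat q) :
    Measurable fun Φ : Mat q => ENNReal.ofReal (wishartPDF q k (k • Φ)⁻¹ y) :=
  Measurable.of_uncurry_right
    (f := fun Φ y : Mat q => ENNReal.ofReal (wishartPDF q k (k • Φ)⁻¹ y)) (measurable_wishartObs q k)

/-- As a function of `Φ`, the likelihood is a multiple of `|Φ|^{k/2} exp(-k tr(Φy)/2)`, singular
case included. It therefore adds `k` to the degrees of freedom and `y` to `D`. -/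
lemma wishartPDF_mul_wishartPDF {n k : ℝ} (hk : 0 < k) (hn : (q : ℝ) - 1 < n) {D y Φ : Mat q}
    (hD : D.PosDef) (hy : y.PosSemidef) (hΦ : Φ.PosDef) :
    wishartPDF q k (k • Φ)⁻¹ y * wishartPDF q n (k • D)⁻¹ Φ =
      wishartObsConst q k y * ((k ^ q) ^ (k / 2)) * wishartConst q n * (k • D)⁻¹.det ^ (-(n / 2)) *
        (wishartConst q (n + k) * (k • (D + y))⁻¹.det ^ (-((n + k) / 2)))⁻¹ *
        wishartPDF q (n + k) (k • (D + y))⁻¹ Φ := by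
  have hDy : (D + y).PosDef := hD.add_posSemidef hy
  have hkΦ : (k • Φ).PosDef := hΦ.smul hk
  have hkDy : (k • (D + y)).PosDef := hDy.smul hk
  have hkD : (k • D).PosDef := hD.smul hk
  have inv_inv' : ∀ M : Mat q, M.PosDef → M⁻¹⁻¹ = M := fun M hM =>
    Matrix.nonsing_inv_nonsing_inv M hM.det_pos.ne'.isUnit
  have hdet : (k • Φ)⁻¹.det ^ (-(k / 2)) = (k ^ q) ^ (k / 2) * Φ.det ^ (k / 2) := by
    rw [Matrix.det_nonsing_inv, Ring.inverse_eq_inv', Real.inv_rpow hkΦ.det_pos.le,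
      Real.rpow_neg hkΦ.det_pos.le, inv_inv, Matrix.det_smul, Fintype.card_fin,
      Real.mul_rpow (pow_nonneg hk.le _) hΦ.det_pos.le]
  have hc := (wishartConst_pos q (n + k)).ne'
  have hd : (k • (D + y))⁻¹.det ^ (-((n + k) / 2)) ≠ 0 :=
    (Real.rpow_pos_of_pos hkDy.inv.det_pos _).ne'
  have hnk : (q : ℝ) - 1 < n + k := by linarith
  rw [wishartPDF_eq, wishartPDF_eq, wishartPDF_eq, inv_inv' _ hkΦ, inv_inv' _ hkD, inv_inv' _ hkDy,
    hdet, wishartObsConst, wishartObsConst.eq_def q n, wishartObsConst.eq_def q (n + k), if_pos hn,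
    if_pos hnk]
  have h1 : Φ.det ^ ((n + k - q - 1) / 2) = Φ.det ^ (k / 2) * Φ.det ^ ((n - q - 1) / 2) := by
    rw [← Real.rpow_add hΦ.det_pos]
    congr 1
    ring
  have h2 : Real.exp (-(k • (D + y) * Φ).trace / 2) =
      Real.exp (-(k • Φ * y).trace / 2) * Real.exp (-(k • D * Φ).trace / 2) := by
    rw [← Real.exp_add]
    congr 1
    rw [smul_add, Matrix.add_mul, Matrix.trace_add, Matrix.smul_mul k y Φ, Matrix.smul_mul k Φ y,
      Matrix.trace_smul, Matrix.trace_smul, Matrix.trace_mul_comm y Φ]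
    ring
  rw [h1, h2]
  field_simp

/-- Conjugate updating: the product of a Wishart prior on the precision and a Wishart likelihood
is a multiple of a Wishart distribution. -/
lemma lintegral_wishartObs {n k : ℝ} (hk : 0 < k) (hn : (q : ℝ) - 1 < n) {D y : Mat q}
    (hD : D.PosDef) (hy : y.PosSemidef) {f : Mat q → ℝ≥0∞} (hf : Measurable f) :
    ∫⁻ Φ, ENNReal.ofReal (wishartPDF q k (k • Φ)⁻¹ y) * f Φ ∂wishart q n (k • D)⁻¹ =
      (∫⁻ Φ, ENNReal.ofReal (wishartPDF q k (k • Φ)⁻¹ y) ∂wishart q n (k • D)⁻¹) *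
        ∫⁻ Φ, f Φ ∂wishart q (n + k) (k • (D + y))⁻¹ := by
  have hDy : (D + y).PosDef := hD.add_posSemidef hy
  have hnk : (q : ℝ) - 1 < n + k := by linarith
  have hprob : IsProbabilityMeasure (wishart q (n + k) (k • (D + y))⁻¹) :=
    isProbabilityMeasure_wishart (Or.inr hnk) (hDy.smul hk).inv
  obtain ⟨r, hr⟩ : ∃ r : ℝ≥0∞, ∀ f : Mat q → ℝ≥0∞, Measurable f →
      ∫⁻ Φ, ENNReal.ofReal (wishartPDF q k (k • Φ)⁻¹ y) * f Φ ∂wishart q n (k • D)⁻¹ =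
        r * ∫⁻ Φ, f Φ ∂wishart q (n + k) (k • (D + y))⁻¹ := by
    refine ⟨ENNReal.ofReal (wishartObsConst q k y * ((k ^ q) ^ (k / 2)) * wishartConst q n *
      (k • D)⁻¹.det ^ (-(n / 2)) *
        (wishartConst q (n + k) * (k • (D + y))⁻¹.det ^ (-((n + k) / 2)))⁻¹), fun f hf => ?_⟩
    have hp := measurable_wishartObs_left k y
    have h1 := (measurable_wishartPDF_right q n (k • D)⁻¹).ennreal_ofReal
    have h2 := (measurable_wishartPDF_right q (n + k) (k • (D + y))⁻¹).ennreal_ofReal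
    rw [wishart, lintegral_withDensity_eq_lintegral_mul _ h1
      (g := fun Φ => ENNReal.ofReal (wishartPDF q k (k • Φ)⁻¹ y) * f Φ) (hp.mul hf), wishart,
      lintegral_withDensity_eq_lintegral_mul _ h2 hf, wishartBase, wishartBase, if_pos hn,
      if_pos hnk, ← lintegral_const_mul _ (h2.mul hf)]
    refine lintegral_congr_ae (ae_posDef_lebesguePosDef.mono fun Φ hΦ => ?_)
    simp only [Pi.mul_apply]
    rw [← mul_assoc, ← mul_assoc, mul_comm (ENNReal.ofReal _),
      ← ENNReal.ofReal_mul (wishartPDF_nonneg k (hΦ.smul hk).inv hy),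
      ← ENNReal.ofReal_mul' (wishartPDF_nonneg _ (hDy.smul hk).inv hΦ.posSemidef),
      wishartPDF_mul_wishartPDF hk hn hD hy hΦ]
  -- The updated Wishart law has mass one, so testing against `1` identifies `r` as the forecast
  -- density at `y`.
  have h1 := hr (fun _ => 1) measurable_const
  simp only [mul_one, lintegral_one, measure_univ] at h1
  rw [hr f hf, h1]

lemma measurable_wishart (q : ℕ) (k : ℝ) : Measurable (wishart q k) := by
  refine Measure.measurable_of_measurable_coe _ fun s hs => ?_
  simp only [wishart, withDensity_apply _ hs]
  exact Measurable.lintegral_prod_right' (ν := (wishartBase q k).restrict s)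
    (f := fun p : Mat q × Mat q => ENNReal.ofReal (wishartPDF q k p.1 p.2))
    (measurable_wishartPDF q k).ennreal_ofReal

lemma scale_posDef {c : ℝ} (hc : 0 < c) {D0 : Mat q} (hD0 : D0.PosDef) (t : ℕ) (y : Fin t → Mat q)
    (hy : ∀ j, (y j).PosSemidef) : (scale c D0 t y).PosDef := by
  induction t with
  | zero => exact hD0
  | succ t ih => exact ((ih (Fin.init y) fun j => hy _).smul hc).add_posSemidef (hy _)

lemma measurable_fin_init {t : ℕ} :
    Measurable fun y : Fin (t + 1) → Mat q => (Fin.init y : Fin t → Mat q) :=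
  measurable_pi_lambda _ fun j => measurable_pi_apply (Fin.castSucc j)

lemma measurable_scale (c : ℝ) (D0 : Mat q) (t : ℕ) : Measurable (scale c D0 t) := by
  induction t with
  | zero => exact measurable_const
  | succ t ih =>
    exact measurable_matrix_add (measurable_matrix_smul (ih.comp measurable_fin_init))
      (measurable_pi_apply (Fin.last t))

/-! ### Regular conditional laws and measurability of kernels. -/

/-- Criterion for a family of measures to be a regular conditional distribution. -/
lemma HasCondLaw.of_lintegral {Ω E F : Type*} [MeasurableSpace Ω] [MeasurableSpace E]
    [MeasurableSpace F] [Nonempty E] {Y : Ω → E} {X : Ω → F} {κ : F → Measure E} {P : Measure Ω}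
    {ν : Measure F} [SFinite ν] (hY : Measurable Y) (hX : Measurable X) (hκ : Measurable κ)
    (hprob : ∀ᵐ x ∂ν, IsProbabilityMeasure (κ x))
    (h : ∀ G : F × E → ℝ≥0∞, Measurable G →
      ∫⁻ ω, G (X ω, Y ω) ∂P = ∫⁻ x, ∫⁻ y, G (x, y) ∂κ x ∂ν) : HasCondLaw Y X κ P := by
  classical
  obtain ⟨e⟩ := ‹Nonempty E›
  have hs : MeasurableSet {x | κ x univ = 1} :=
    (Measure.measurable_coe MeasurableSet.univ).comp hκ (measurableSet_singleton 1)
  -- `κ x` is a probability measure only for almost every `x`; elsewhere it is replaced by a Dirac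
  -- mass to obtain a Markov kernel.
  let K : Kernel F E :=
    ⟨fun x => if x ∈ {x | κ x univ = 1} then κ x else Measure.dirac e,
      Measurable.ite hs hκ measurable_const⟩
  have hKe : ∀ x, κ x univ = 1 → K x = κ x := fun x hx => if_pos hx
  have hK : IsMarkovKernel K := by
    refine ⟨fun x => ?_⟩
    by_cases hx : κ x univ = 1
    · rw [hKe x hx]
      exact ⟨hx⟩
    · rw [show K x = Measure.dirac e from if_neg hx]
      infer_instance
  have hae : ∀ᵐ x ∂ν, K x = κ x := hprob.mono fun x hx => hKe x hx.measure_univ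
  have hν : P.map X = ν := by
    refine Measure.ext_of_lintegral _ fun f hf => ?_
    rw [lintegral_map hf hX, h (fun p => f p.1) (hf.comp measurable_fst)]
    refine lintegral_congr_ae (hprob.mono fun x hx => ?_)
    have := hx
    simp
  refine ⟨K, hK, ⟨(hX.prodMk hY).aemeasurable, ?_⟩, by rw [hν]; exact hae⟩
  refine Measure.ext_of_lintegral _ fun G hG => ?_
  rw [lintegral_map hG (hX.prodMk hY), h G hG, hν, Measure.lintegral_compProd hG]
  exact lintegral_congr_ae (hae.mono fun x hx => by simp only [hx])

section Kernels

variable {α β γ : Type*} [MeasurableSpace α] [MeasurableSpace β] [MeasurableSpace γ]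
  {m : α → Measure β}

lemma measurable_map_of_prob (hm : Measurable m) (hp : ∀ a, IsProbabilityMeasure (m a))
    {F : α → β → γ} (hF : Measurable (Function.uncurry F)) :
    Measurable fun a => (m a).map (F a) := by
  have hK : IsMarkovKernel (⟨m, hm⟩ : Kernel α β) := ⟨hp⟩
  refine Measure.measurable_of_measurable_coe _ fun s hs => ?_
  simp only [Measure.map_apply hF.of_uncurry_left hs]
  exact Kernel.measurable_kernel_prodMk_left (κ := (⟨m, hm⟩ : Kernel α β)) (hF hs)

lemma measurable_lintegral_of_prob (hm : Measurable m) (hp : ∀ a, IsProbabilityMeasure (m a))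
    {f : α × β → ℝ≥0∞} (hf : Measurable f) : Measurable fun a => ∫⁻ b, f (a, b) ∂m a := by
  have hK : IsMarkovKernel (⟨m, hm⟩ : Kernel α β) := ⟨hp⟩
  exact hf.lintegral_kernel_prod_right' (κ := (⟨m, hm⟩ : Kernel α β))

lemma measurable_bind_of_prob (hm : Measurable m) (hp : ∀ a, IsProbabilityMeasure (m a))
    {κ : α × β → Measure γ} (hκ : Measurable κ) :
    Measurable fun a => (m a).bind fun b => κ (a, b) := by
  refine Measure.measurable_of_measurable_coe _ fun s hs => ?_
  have hκa : ∀ a, Measurable fun b => κ (a, b) := fun a => hκ.comp measurable_prodMk_left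
  simp only [Measure.bind_apply hs (hκa _).aemeasurable]
  exact measurable_lintegral_of_prob hm hp ((Measure.measurable_coe hs).comp hκ)

lemma isProbabilityMeasure_bind {μ : Measure β} [IsProbabilityMeasure μ] {κ : β → Measure γ}
    (hκ : Measurable κ) (hp : ∀ b, IsProbabilityMeasure (κ b)) :
    IsProbabilityMeasure (μ.bind κ) := by
  constructor
  rw [Measure.bind_apply MeasurableSet.univ hκ.aemeasurable]
  simp

end Kernels

/-! ### General state-space models: joint law and state law. -/

lemma lintegral_pi_snoc (μ : Measure (Mat q)) [SigmaFinite μ] (t : ℕ)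
    {f : (Fin (t + 1) → Mat q) → ℝ≥0∞} (hf : Measurable f) :
    ∫⁻ y, f y ∂Measure.pi (fun _ : Fin (t + 1) => μ) =
      ∫⁻ y, ∫⁻ z, f (Fin.snoc (α := fun _ => Mat q) y z) ∂μ ∂Measure.pi (fun _ : Fin t => μ) := by
  have h := (measurePreserving_piFinSuccAbove (fun _ : Fin (t + 1) => μ) (Fin.last t)).symm
  have hm : Measurable fun a => f ((MeasurableEquiv.piFinSuccAbove (fun _ => Mat q)
      (Fin.last t)).symm a) := hf.comp (MeasurableEquiv.measurable _)
  rw [← h.lintegral_comp_emb (MeasurableEquiv.measurableEmbedding _), lintegral_prod_symm' _ hm]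
  refine lintegral_congr fun y => lintegral_congr fun z => ?_
  congr 1
  exact Fin.insertNth_last' z y

lemma measurable_snoc {α : Type*} [MeasurableSpace α] {t : ℕ} {f : α → Fin t → Mat q}
    {g : α → Mat q} (hf : Measurable f) (hg : Measurable g) :
    Measurable fun a => (Fin.snoc (α := fun _ => Mat q) (f a) (g a) : Fin (t + 1) → Mat q) := by
  refine measurable_pi_lambda _ fun j => ?_
  refine Fin.lastCases ?_ (fun i => ?_) j
  · simpa using hg
  · simpa [Function.comp_def] using (measurable_pi_apply i).comp hf

lemma measurable_extend {α : Type*} [MeasurableSpace α] {t : ℕ} {h : α → Path q t}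
    {Φ y : α → Mat q} (hh : Measurable h) (hΦ : Measurable Φ) (hy : Measurable y) :
    Measurable fun a => (h a).extend (Φ a) (y a) :=
  (measurable_snoc (measurable_fst.comp hh) hΦ).prodMk (measurable_snoc (measurable_snd.comp hh) hy)

lemma measurable_eval_last {t : ℕ} : Measurable fun h : Fin (t + 1) → Mat q => h (Fin.last t) :=
  measurable_pi_apply _

/-- The initial law and the transition laws of a state-space model are probability measures, and
the transition laws depend measurably on the past. -/
structure IsMarkovEvolution (init : Measure (Mat q))
    (trans : (t : ℕ) → (Fin t → Mat q) → Mat q → Measure (Mat q)) : Prop where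
  init_prob : IsProbabilityMeasure init
  trans_prob : ∀ t y Φ, IsProbabilityMeasure (trans t y Φ)
  measurable_trans : ∀ t, Measurable fun p : (Fin t → Mat q) × Mat q => trans t p.1 p.2

section StateSpace

variable {init : Measure (Mat q)} {trans : (t : ℕ) → (Fin t → Mat q) → Mat q → Measure (Mat q)}

namespace IsMarkovEvolution

lemma measurable_transPath (H : IsMarkovEvolution init trans) (t : ℕ) :
    Measurable fun p : (Fin t → Mat q) × (Fin (t + 1) → Mat q) =>
      (trans t p.1 (p.2 (Fin.last t))).map fun Φ =>
        (Fin.snoc (α := fun _ => Mat q) p.2 Φ : Fin (t + 2) → Mat q) := by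
  have h : Measurable fun p : (Fin t → Mat q) × (Fin (t + 1) → Mat q) =>
      trans t p.1 (p.2 (Fin.last t)) :=
    (H.measurable_trans t).comp
      (measurable_fst.prodMk (measurable_eval_last.comp measurable_snd))
  exact measurable_map_of_prob h (fun p => H.trans_prob t _ _)
    (F := fun (p : (Fin t → Mat q) × (Fin (t + 1) → Mat q)) Φ =>
      (Fin.snoc (α := fun _ => Mat q) p.2 Φ : Fin (t + 2) → Mat q))
    (measurable_snoc (measurable_snd.comp measurable_fst) measurable_snd)

lemma stateLaw_regular (H : IsMarkovEvolution init trans) (t : ℕ) :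
    Measurable (stateLaw init trans t) ∧ ∀ y, IsProbabilityMeasure (stateLaw init trans t y) := by
  induction t with
  | zero =>
    refine ⟨measurable_const, fun y => ?_⟩
    have := H.init_prob
    exact Measure.isProbabilityMeasure_map
      (measurable_pi_lambda _ fun _ => measurable_id).aemeasurable
  | succ t ih =>
    have hk := H.measurable_transPath t
    refine ⟨(measurable_bind_of_prob ih.1 ih.2 hk).comp measurable_fin_init, fun y => ?_⟩
    have := ih.2 (Fin.init y)
    refine isProbabilityMeasure_bind (hk.comp measurable_prodMk_left) fun h => ?_
    have := H.trans_prob t (Fin.init y) (h (Fin.last t))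
    exact Measure.isProbabilityMeasure_map
      (measurable_snoc measurable_const measurable_id).aemeasurable

lemma lintegral_stateLaw_succ (H : IsMarkovEvolution init trans) (t : ℕ) (y : Fin (t + 1) → Mat q)
    {f : (Fin (t + 2) → Mat q) → ℝ≥0∞} (hf : Measurable f) :
    ∫⁻ h, f h ∂stateLaw init trans (t + 1) y =
      ∫⁻ h, ∫⁻ Φ, f (Fin.snoc (α := fun _ => Mat q) h Φ) ∂trans t (Fin.init y) (h (Fin.last t))
        ∂stateLaw init trans t (Fin.init y) := by
  have hk : Measurable fun h : Fin (t + 1) → Mat q =>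
      (trans t (Fin.init y) (h (Fin.last t))).map fun Φ =>
        (Fin.snoc (α := fun _ => Mat q) h Φ : Fin (t + 2) → Mat q) :=
    (H.measurable_transPath t).comp measurable_prodMk_left
  rw [stateLaw, Measure.lintegral_bind hk.aemeasurable hf.aemeasurable]
  refine lintegral_congr fun h => ?_
  have hs : Measurable fun Φ : Mat q => (Fin.snoc (α := fun _ => Mat q) h Φ : Fin (t + 2) → Mat q) :=
    measurable_snoc measurable_const measurable_id
  rw [lintegral_map hf hs]

end IsMarkovEvolution

variable {base : Measure (Mat q)} [SigmaFinite base] {p : Mat q → Mat q → ℝ≥0∞}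

lemma measurable_obsPath (hp : Measurable (Function.uncurry p)) (t : ℕ) :
    Measurable fun a : Path q t × Mat q =>
      (base.withDensity (p a.2)).map fun y => a.1.extend a.2 y := by
  refine Measure.measurable_of_measurable_coe _ fun s hs => ?_
  have hext : ∀ a : Path q t × Mat q, Measurable fun y => a.1.extend a.2 y := fun a =>
    measurable_extend measurable_const measurable_const measurable_id
  have hext' : Measurable fun b : (Path q t × Mat q) × Mat q => b.1.1.extend b.1.2 b.2 :=
    measurable_extend (measurable_fst.comp measurable_fst) (measurable_snd.comp measurable_fst)
      measurable_snd
  have hp' : Measurable fun b : (Path q t × Mat q) × Mat q => p b.1.2 b.2 :=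
    hp.comp ((measurable_snd.comp measurable_fst).prodMk measurable_snd)
  have e : ∀ a : Path q t × Mat q, (base.withDensity (p a.2)).map (fun y => a.1.extend a.2 y) s =
      ∫⁻ y, ((fun b : (Path q t × Mat q) × Mat q => b.1.1.extend b.1.2 b.2) ⁻¹' s).indicator
        (fun b => p b.1.2 b.2) (a, y) ∂base := by
    intro a
    rw [Measure.map_apply (hext a) hs, withDensity_apply _ (hext a hs),
      ← lintegral_indicator (hext a hs)]
    rfl
  simp only [e]
  exact (hp'.indicator (hext' hs)).lintegral_prod_right'

namespace IsMarkovEvolution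

lemma measurable_pathStep (H : IsMarkovEvolution init trans) (hp : Measurable (Function.uncurry p))
    (t : ℕ) : Measurable fun h : Path q t => (trans t h.2 (h.1 (Fin.last t))).bind fun Φ =>
      (base.withDensity (p Φ)).map fun y => h.extend Φ y := by
  have h : Measurable fun h : Path q t => trans t h.2 (h.1 (Fin.last t)) :=
    (H.measurable_trans t).comp
      (measurable_snd.prodMk (measurable_eval_last.comp measurable_fst))
  exact measurable_bind_of_prob (m := fun h : Path q t => trans t h.2 (h.1 (Fin.last t)))
    (κ := fun a : Path q t × Mat q =>
      (base.withDensity (p a.2)).map fun y => a.1.extend a.2 y)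
    h (fun _ => H.trans_prob t _ _) (measurable_obsPath hp t)

lemma lintegral_ssmLaw_succ (H : IsMarkovEvolution init trans)
    (hp : Measurable (Function.uncurry p)) (t : ℕ) {F : Path q (t + 1) → ℝ≥0∞}
    (hF : Measurable F) :
    ∫⁻ h, F h ∂ssmLaw init trans (fun Φ => base.withDensity (p Φ)) (t + 1) =
      ∫⁻ h, ∫⁻ Φ, ∫⁻ y, F (h.extend Φ y) ∂base.withDensity (p Φ) ∂trans t h.2 (h.1 (Fin.last t))
        ∂ssmLaw init trans (fun Φ => base.withDensity (p Φ)) t := by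
  rw [ssmLaw, Measure.lintegral_bind (H.measurable_pathStep hp t).aemeasurable hF.aemeasurable]
  refine lintegral_congr fun h => ?_
  have hk : Measurable fun Φ : Mat q => (base.withDensity (p Φ)).map fun y => h.extend Φ y :=
    (measurable_obsPath hp t).comp measurable_prodMk_left
  rw [Measure.lintegral_bind hk.aemeasurable hF.aemeasurable]
  refine lintegral_congr fun Φ => ?_
  have hext : Measurable fun y => h.extend Φ y :=
    measurable_extend measurable_const measurable_const measurable_id
  rw [lintegral_map hF hext]

end IsMarkovEvolution

lemma measurable_prod_obs (hp : Measurable (Function.uncurry p)) (t : ℕ) :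
    Measurable fun a : (Fin t → Mat q) × (Fin (t + 1) → Mat q) =>
      ∏ j : Fin t, p (a.2 j.succ) (a.1 j) := by
  refine Finset.measurable_prod _ fun j _ => ?_
  have h : Measurable fun a : (Fin t → Mat q) × (Fin (t + 1) → Mat q) => (a.2 j.succ, a.1 j) :=
    ((measurable_pi_apply j.succ).comp measurable_snd).prodMk
      ((measurable_pi_apply j).comp measurable_fst)
  exact hp.comp h

lemma prod_obs_snoc (t : ℕ) (h : Fin (t + 1) → Mat q) (y : Fin t → Mat q) (Φ z : Mat q) :
    ∏ j : Fin (t + 1), p ((Fin.snoc (α := fun _ => Mat q) h Φ : Fin (t + 2) → Mat q) j.succ)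
      ((Fin.snoc (α := fun _ => Mat q) y z : Fin (t + 1) → Mat q) j) =
      (∏ j : Fin t, p (h j.succ) (y j)) * p Φ z := by
  rw [Fin.prod_univ_castSucc]
  simp only [Fin.snoc_castSucc, Fin.succ_last, Fin.snoc_last, Fin.succ_castSucc]

/-- The joint law of a state-space model, with the observations integrated last. -/
lemma IsMarkovEvolution.lintegral_ssmLaw (H : IsMarkovEvolution init trans)
    (hp : Measurable (Function.uncurry p)) (t : ℕ) {F : Path q t → ℝ≥0∞} (hF : Measurable F) :
    ∫⁻ h, F h ∂ssmLaw init trans (fun Φ => base.withDensity (p Φ)) t =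
      ∫⁻ y, ∫⁻ h, (∏ j : Fin t, p (h j.succ) (y j)) * F (h, y) ∂stateLaw init trans t y
        ∂Measure.pi fun _ : Fin t => base := by
  induction t with
  | zero =>
    have h1 : Measurable fun Φ : Mat q => ((fun _ => Φ, Fin.elim0) : Path q 0) :=
      (measurable_pi_lambda _ fun _ => measurable_id).prodMk measurable_const
    have h2 : Measurable fun (Φ : Mat q) (_ : Fin 1) => Φ :=
      measurable_pi_lambda _ fun _ => measurable_id
    have h3 : ∀ y : Fin 0 → Mat q, Measurable fun h : Fin 1 → Mat q => F (h, y) := fun y =>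
      hF.comp (measurable_id.prodMk measurable_const)
    rw [ssmLaw, lintegral_map hF h1, Measure.pi_of_empty, lintegral_dirac]
    simp only [stateLaw, Finset.univ_eq_empty, Finset.prod_empty, one_mul]
    rw [lintegral_map (h3 _) h2]
    refine lintegral_congr fun Φ => ?_
    congr 2
  | succ t ih =>
    have hreg := H.stateLaw_regular t
    have hreg' := H.stateLaw_regular (t + 1)
    have hpl : ∀ Φ, Measurable (p Φ) := fun Φ => hp.of_uncurry_left
    have hext : ∀ (h : Path q t) (Φ : Mat q), Measurable fun y => F (h.extend Φ y) := fun h Φ =>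
      hF.comp (measurable_extend measurable_const measurable_const measurable_id)
    have hobs : Measurable fun a : Path q t × Mat q =>
        ∫⁻ y, p a.2 y * F (a.1.extend a.2 y) ∂base := by
      refine Measurable.lintegral_prod_right' (f := fun b : (Path q t × Mat q) × Mat q =>
        p b.1.2 b.2 * F (b.1.1.extend b.1.2 b.2)) (Measurable.mul ?_ (hF.comp ?_))
      · exact hp.comp ((measurable_snd.comp measurable_fst).prodMk measurable_snd)
      · exact measurable_extend (measurable_fst.comp measurable_fst)
          (measurable_snd.comp measurable_fst) measurable_snd
    have hG : Measurable fun h : Path q t => ∫⁻ Φ, ∫⁻ y, p Φ y * F (h.extend Φ y) ∂base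
        ∂trans t h.2 (h.1 (Fin.last t)) :=
      measurable_lintegral_of_prob ((H.measurable_trans t).comp
        (measurable_snd.prodMk (measurable_eval_last.comp measurable_fst)))
        (fun _ => H.trans_prob t _ _) hobs
    rw [H.lintegral_ssmLaw_succ hp t hF]
    simp only [lintegral_withDensity_eq_lintegral_mul _ (hpl _) (hext _ _), Pi.mul_apply]
    rw [ih hG]
    have hint : Measurable fun a : (Fin (t + 1) → Mat q) × (Fin (t + 2) → Mat q) =>
        (∏ j : Fin (t + 1), p (a.2 j.succ) (a.1 j)) * F (a.2, a.1) :=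
      (measurable_prod_obs hp (t + 1)).mul (hF.comp (measurable_snd.prodMk measurable_fst))
    rw [lintegral_pi_snoc base t (measurable_lintegral_of_prob hreg'.1 hreg'.2 hint)]
    refine lintegral_congr fun y => ?_
    -- `Φ_{t+1}` depends on the data up to `y_t` only, so the state law does not see the last
    -- observation, and the integral over it can be interchanged with that over the states.
    have hlaw : ∀ z, stateLaw init trans (t + 1) (Fin.snoc (α := fun _ => Mat q) y z) =
        stateLaw init trans (t + 1) (Fin.snoc (α := fun _ => Mat q) y 0) := by
      intro z
      rw [stateLaw, stateLaw, Fin.init_snoc, Fin.init_snoc]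
    have := hreg'.2 (Fin.snoc (α := fun _ => Mat q) y 0)
    simp only [hlaw]
    have hint' : Measurable fun b : Mat q × (Fin (t + 2) → Mat q) =>
        (∏ j : Fin (t + 1), p (b.2 j.succ)
          ((Fin.snoc (α := fun _ => Mat q) y b.1 : Fin (t + 1) → Mat q) j)) *
          F (b.2, Fin.snoc (α := fun _ => Mat q) y b.1) :=
      hint.comp ((measurable_snoc measurable_const measurable_fst).prodMk measurable_snd)
    rw [lintegral_lintegral_swap hint'.aemeasurable,
      H.lintegral_stateLaw_succ t _ hint'.lintegral_prod_left']
    rw [Fin.init_snoc]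
    refine lintegral_congr fun h => ?_
    have hsec : Measurable fun Φ => ∫⁻ z, p Φ z * F (Path.extend (h, y) Φ z) ∂base :=
      hobs.comp measurable_prodMk_left
    rw [← lintegral_const_mul _ hsec]
    refine lintegral_congr fun Φ => ?_
    have hsec' : Measurable fun z => p Φ z * F (Path.extend (h, y) Φ z) := (hpl Φ).mul (hext _ _)
    rw [← lintegral_const_mul _ hsec']
    refine lintegral_congr fun z => ?_
    rw [prod_obs_snoc, mul_assoc]
    rfl

end StateSpace

/-! ### Filtering in a model with a conjugate evolution. -/

/-- The Wishart observation density, as a function of the precision matrix and the observation. -/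
def obsDensity (k : ℝ) (Φ y : Mat q) : ℝ≥0∞ := ENNReal.ofReal (wishartPDF q k (k • Φ)⁻¹ y)

lemma measurable_obsDensity (k : ℝ) :
    Measurable (Function.uncurry (obsDensity k : Mat q → Mat q → ℝ≥0∞)) :=
  measurable_wishartObs q k

lemma measurable_uncurry_comp {α : Type*} [MeasurableSpace α] {p : Mat q → Mat q → ℝ≥0∞}
    (hp : Measurable (Function.uncurry p)) {f g : α → Mat q} (hf : Measurable f)
    (hg : Measurable g) : Measurable fun a => p (f a) (g a) :=
  hp.comp (hf.prodMk hg)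

lemma measurable_prod_obs_right {p : Mat q → Mat q → ℝ≥0∞} (hp : Measurable (Function.uncurry p))
    {t : ℕ} (y : Fin t → Mat q) :
    Measurable fun h : Fin (t + 1) → Mat q => ∏ j : Fin t, p (h j.succ) (y j) :=
  Finset.measurable_prod _ fun j _ =>
    measurable_uncurry_comp hp (measurable_pi_apply j.succ) measurable_const

lemma measurable_lintegral_wishart {α : Type*} [MeasurableSpace α] {k : ℝ} {S : α → Mat q}
    (hS : Measurable S) {f : α × Mat q → ℝ≥0∞} (hf : Measurable f) :
    Measurable fun a => ∫⁻ A, f (a, A) ∂wishart q k (S a) := by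
  have hd : Measurable fun p : α × Mat q => ENNReal.ofReal (wishartPDF q k (S p.1) p.2) :=
    ((measurable_wishartPDF q k).comp
      ((hS.comp measurable_fst).prodMk measurable_snd)).ennreal_ofReal
  have e : ∀ a, ∫⁻ A, f (a, A) ∂wishart q k (S a) =
      ∫⁻ A, ENNReal.ofReal (wishartPDF q k (S a) A) * f (a, A) ∂wishartBase q k := fun a =>
    lintegral_withDensity_eq_lintegral_mul _
      (measurable_wishartPDF_right q k (S a)).ennreal_ofReal (hf.comp measurable_prodMk_left)
  simp only [e]
  exact (hd.mul hf).lintegral_prod_right'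

namespace UEParam

/-- The forward-filtered law of the state. -/
def filterLaw (θ : UEParam q) (t : ℕ) (y : Fin t → Mat q) : Measure (Mat q) :=
  wishart q (θ.n + θ.k) (θ.k • scale θ.lam θ.D0 t y)⁻¹

/-- The one-step-ahead law of the state. -/
def priorLaw (θ : UEParam q) (t : ℕ) (y : Fin t → Mat q) : Measure (Mat q) :=
  wishart q θ.n (θ.k • θ.lam • scale θ.lam θ.D0 t y)⁻¹

/-- The marginal likelihood as a product of one-step-ahead forecast densities. -/
def forecastLikelihood (θ : UEParam q) : (t : ℕ) → (Fin t → Mat q) → ℝ≥0∞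
  | 0, _ => 1
  | t + 1, y => forecastLikelihood θ t (Fin.init y) *
      ∫⁻ Φ, obsDensity θ.k Φ (y (Fin.last t)) ∂θ.priorLaw t (Fin.init y)

/-- An evolution of the states which carries the filtered law into the one-step-ahead law. -/
structure IsConjugateEvolution (θ : UEParam q)
    (trans : (t : ℕ) → (Fin t → Mat q) → Mat q → Measure (Mat q)) : Prop where
  isMarkov : IsMarkovEvolution θ.init trans
  bind_trans : ∀ t y, (∀ j, (y j).PosSemidef) → (θ.filterLaw t y).bind (trans t y) = θ.priorLaw t y

section Laws

variable {θ : UEParam q}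

lemma Admissible.k_pos (hq : 0 < q) (hθ : θ.Admissible) : 0 < θ.k := hθ.2.1.pos hq

lemma measurable_filterLaw (θ : UEParam q) (t : ℕ) : Measurable (θ.filterLaw t) :=
  (measurable_wishart q _).comp (measurable_matrix_inv
    (measurable_matrix_smul (measurable_scale θ.lam θ.D0 t)))

lemma measurable_priorLaw (θ : UEParam q) (t : ℕ) : Measurable (θ.priorLaw t) :=
  (measurable_wishart q _).comp (measurable_matrix_inv (measurable_matrix_smul
    (measurable_matrix_smul (measurable_scale θ.lam θ.D0 t))))

lemma Admissible.scale_posDef (hθ : θ.Admissible) {t : ℕ} {y : Fin t → Mat q}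
    (hy : ∀ j, (y j).PosSemidef) : (scale θ.lam θ.D0 t y).PosDef :=
  StochVol.scale_posDef hθ.2.2.1 hθ.2.2.2.2 t y hy

lemma Admissible.isProbabilityMeasure_filterLaw (hθ : θ.Admissible) (hq : 0 < q) {t : ℕ}
    {y : Fin t → Mat q} (hy : ∀ j, (y j).PosSemidef) : IsProbabilityMeasure (θ.filterLaw t y) :=
  isProbabilityMeasure_wishart (Or.inr (by linarith [hθ.1, hθ.k_pos hq]))
    ((hθ.scale_posDef hy).smul (hθ.k_pos hq)).inv

lemma Admissible.isProbabilityMeasure_priorLaw (hθ : θ.Admissible) (hq : 0 < q) {t : ℕ}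
    {y : Fin t → Mat q} (hy : ∀ j, (y j).PosSemidef) : IsProbabilityMeasure (θ.priorLaw t y) :=
  isProbabilityMeasure_wishart (Or.inr hθ.1)
    (((hθ.scale_posDef hy).smul hθ.2.2.1).smul (hθ.k_pos hq)).inv

lemma Admissible.ae_isProbabilityMeasure_obs (hθ : θ.Admissible) (hq : 0 < q) (t : ℕ)
    (y : Fin t → Mat q) :
    ∀ᵐ Φ ∂θ.priorLaw t y, IsProbabilityMeasure (wishart q θ.k (θ.k • Φ)⁻¹) :=
  (ae_posDef_wishart hθ.1 _).mono fun _ hΦ =>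
    isProbabilityMeasure_wishart hθ.2.1 (hΦ.smul (hθ.k_pos hq)).inv

lemma measurable_forecastLikelihood (θ : UEParam q) (t : ℕ) :
    Measurable (θ.forecastLikelihood t) := by
  induction t with
  | zero => exact measurable_const
  | succ t ih =>
    refine (ih.comp measurable_fin_init).mul ?_
    refine measurable_lintegral_wishart (S := fun y : Fin (t + 1) → Mat q =>
      (θ.k • θ.lam • scale θ.lam θ.D0 t (Fin.init y))⁻¹)
      (f := fun p : (Fin (t + 1) → Mat q) × Mat q => obsDensity θ.k p.2 (p.1 (Fin.last t))) ?_ ?_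
    · exact measurable_matrix_inv (measurable_matrix_smul
        (measurable_matrix_smul ((measurable_scale θ.lam θ.D0 t).comp measurable_fin_init)))
    · exact measurable_uncurry_comp (measurable_obsDensity θ.k) measurable_snd
        (measurable_eval_last.comp measurable_fst)

end Laws

/-- The law of the observations in a model with a conjugate evolution. -/
def dataLaw (θ : UEParam q) (t : ℕ) : Measure (Fin t → Mat q) :=
  (Measure.pi fun _ : Fin t => wishartBase q θ.k).withDensity (θ.forecastLikelihood t)

lemma ae_posSemidef_pi_wishartBase (k : ℝ) (t : ℕ) :
    ∀ᵐ y ∂Measure.pi fun _ : Fin t => wishartBase q k, ∀ j, (y j).PosSemidef :=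
  ae_all_iff.2 fun j => (Measure.quasiMeasurePreserving_eval _ j).ae (ae_posSemidef_wishartBase q k)

lemma ae_posSemidef_dataLaw (θ : UEParam q) (t : ℕ) :
    ∀ᵐ y ∂θ.dataLaw t, ∀ j, (y j).PosSemidef :=
  (withDensity_absolutelyContinuous _ _).ae_le (ae_posSemidef_pi_wishartBase θ.k t)

instance (θ : UEParam q) (t : ℕ) : SFinite (θ.dataLaw t) :=
  inferInstanceAs (SFinite (Measure.withDensity _ _))

namespace IsConjugateEvolution

variable {θ : UEParam q} {trans : (t : ℕ) → (Fin t → Mat q) → Mat q → Measure (Mat q)}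

/-- The filter in unnormalised form. It holds at every positive semidefinite data sequence, not just
almost everywhere, which is what makes the likelihoods equal pointwise. The test function `f` varies
in the induction, because integrating out the newest state produces a new one. -/
lemma lintegral_stateLaw (H : θ.IsConjugateEvolution trans) (hq : 0 < q) (hθ : θ.Admissible)
    (t : ℕ) (y : Fin t → Mat q) (hy : ∀ j, (y j).PosSemidef) {f : Mat q → ℝ≥0∞}
    (hf : Measurable f) :
    ∫⁻ h, (∏ j : Fin t, obsDensity θ.k (h j.succ) (y j)) * f (h (Fin.last t))
      ∂stateLaw θ.init trans t y = θ.forecastLikelihood t y * ∫⁻ Φ, f Φ ∂θ.filterLaw t y := by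
  induction t generalizing f with
  | zero =>
    have h2 : Measurable fun (Φ : Mat q) (_ : Fin 1) => Φ :=
      measurable_pi_lambda _ fun _ => measurable_id
    simp only [stateLaw, Finset.univ_eq_empty, Finset.prod_empty, one_mul, forecastLikelihood]
    rw [lintegral_map (f := fun h : Fin 1 → Mat q => f (h (Fin.last 0)))
      (hf.comp measurable_eval_last) h2]
    rfl
  | succ t ih =>
    have hy' : ∀ j, (Fin.init y j : Mat q).PosSemidef := fun j => hy _
    have hp := measurable_obsDensity (q := q) θ.k
    have hpy : Measurable fun Φ => obsDensity θ.k Φ (y (Fin.last t)) := hp.of_uncurry_right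
    have htr : Measurable (trans t (Fin.init y)) :=
      (H.isMarkov.measurable_trans t).comp measurable_prodMk_left
    have hg : Measurable fun Φ' => ∫⁻ Φ, obsDensity θ.k Φ (y (Fin.last t)) * f Φ
        ∂trans t (Fin.init y) Φ' :=
      (Measure.measurable_lintegral (hpy.mul hf)).comp htr
    have hprod : Measurable fun h : Fin (t + 2) → Mat q =>
        ∏ j : Fin (t + 1), obsDensity θ.k (h j.succ) (y j) :=
      measurable_prod_obs_right hp y
    have hpf : Measurable fun h : Fin (t + 2) → Mat q =>
        (∏ j : Fin (t + 1), obsDensity θ.k (h j.succ) (y j)) * f (h (Fin.last (t + 1))) :=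
      hprod.mul (hf.comp measurable_eval_last)
    rw [H.isMarkov.lintegral_stateLaw_succ t y hpf]
    have e : ∀ h Φ, (∏ j : Fin (t + 1), obsDensity θ.k
        ((Fin.snoc (α := fun _ => Mat q) h Φ : Fin (t + 2) → Mat q) j.succ) (y j)) *
        f ((Fin.snoc (α := fun _ => Mat q) h Φ : Fin (t + 2) → Mat q) (Fin.last (t + 1))) =
        (∏ j : Fin t, obsDensity θ.k (h j.succ) (Fin.init y j : Mat q)) *
          (obsDensity θ.k Φ (y (Fin.last t)) * f Φ) := by
      intro h Φ
      have := prod_obs_snoc (p := obsDensity θ.k) t h (Fin.init y) Φ (y (Fin.last t))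
      rw [Fin.snoc_init_self] at this
      rw [this, Fin.snoc_last, mul_assoc]
    refine (lintegral_congr fun h => lintegral_congr fun Φ => e h Φ).trans ?_
    have hpyf : Measurable fun Φ => obsDensity θ.k Φ (y (Fin.last t)) * f Φ := hpy.mul hf
    simp only [lintegral_const_mul _ hpyf]
    -- The filtered law at time `t` is pushed through the evolution and becomes the prior; the
    -- updating lemma then splits off the forecast density and leaves the new filtered law.
    rw [ih (Fin.init y) hy' hg, ← Measure.lintegral_bind htr.aemeasurable hpyf.aemeasurable,
      H.bind_trans t _ hy', forecastLikelihood, mul_assoc]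
    congr 1
    exact lintegral_wishartObs (hθ.k_pos hq) hθ.1 ((hθ.scale_posDef hy').smul hθ.2.2.1)
      (hy (Fin.last t)) hf

lemma marginalLikelihood_eq (H : θ.IsConjugateEvolution trans) (hq : 0 < q) (hθ : θ.Admissible)
    (t : ℕ) (y : Fin t → Mat q) (hy : ∀ j, (y j).PosSemidef) :
    marginalLikelihood θ.k θ.init trans t y = θ.forecastLikelihood t y := by
  have h := H.lintegral_stateLaw hq hθ t y hy (f := fun _ => 1) measurable_const
  have := hθ.isProbabilityMeasure_filterLaw hq hy
  simp only [mul_one, lintegral_one, measure_univ] at h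
  exact h

/-- The joint law of `(Φ_{0:t}, y_{1:t})` in the model with evolution `trans`. -/
lemma lintegral_law (H : θ.IsConjugateEvolution trans) (hq : 0 < q) (hθ : θ.Admissible)
    (t : ℕ) {G : (Fin t → Mat q) × Mat q → ℝ≥0∞} (hG : Measurable G) :
    ∫⁻ h, G (h.2, h.1 (Fin.last t))
      ∂ssmLaw θ.init trans (fun Φ => wishart q θ.k (θ.k • Φ)⁻¹) t =
      ∫⁻ y, ∫⁻ Φ, G (y, Φ) ∂θ.filterLaw t y ∂θ.dataLaw t := by
  have hF : Measurable fun h : Path q t => G (h.2, h.1 (Fin.last t)) :=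
    hG.comp (measurable_snd.prodMk (measurable_eval_last.comp measurable_fst))
  have hGf : Measurable fun y => ∫⁻ Φ, G (y, Φ) ∂θ.filterLaw t y :=
    measurable_lintegral_wishart (measurable_matrix_inv
      (measurable_matrix_smul (measurable_scale θ.lam θ.D0 t))) hG
  rw [dataLaw, lintegral_withDensity_eq_lintegral_mul _ (θ.measurable_forecastLikelihood t) hGf]
  refine (H.isMarkov.lintegral_ssmLaw (measurable_obsDensity θ.k) t hF).trans ?_
  refine lintegral_congr_ae ((ae_posSemidef_pi_wishartBase θ.k t).mono fun y hy => ?_)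
  exact H.lintegral_stateLaw hq hθ t y hy (hG.comp measurable_prodMk_left)

lemma map_snd_law (H : θ.IsConjugateEvolution trans) (hq : 0 < q) (hθ : θ.Admissible) (t : ℕ) :
    (ssmLaw θ.init trans (fun Φ => wishart q θ.k (θ.k • Φ)⁻¹) t).map Prod.snd = θ.dataLaw t := by
  refine Measure.ext_of_lintegral _ fun f hf => ?_
  rw [lintegral_map hf measurable_snd,
    H.lintegral_law hq hθ t (G := fun p => f p.1) (hf.comp measurable_fst)]
  refine lintegral_congr_ae ((θ.ae_posSemidef_dataLaw t).mono fun y hy => ?_)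
  have := hθ.isProbabilityMeasure_filterLaw hq hy
  simp

/-- The factorisation data, prior, observation of the law of `(y_{1:t}, Φ_{t+1}, y_{t+1})`; the
prior and the forecast are read off as its marginals. -/
lemma lintegral_law_succ (H : θ.IsConjugateEvolution trans) (hq : 0 < q) (hθ : θ.Admissible)
    (t : ℕ) {G : (Fin t → Mat q) × Mat q × Mat q → ℝ≥0∞} (hG : Measurable G) :
    ∫⁻ h, G (Fin.init h.2, h.1 (Fin.last (t + 1)), h.2 (Fin.last t))
      ∂ssmLaw θ.init trans (fun Φ => wishart q θ.k (θ.k • Φ)⁻¹) (t + 1) =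
      ∫⁻ y, ∫⁻ Φ, ∫⁻ z, G (y, Φ, z) ∂wishart q θ.k (θ.k • Φ)⁻¹ ∂θ.priorLaw t y ∂θ.dataLaw t := by
  have hF : Measurable fun h : Path q (t + 1) =>
      G (Fin.init h.2, h.1 (Fin.last (t + 1)), h.2 (Fin.last t)) :=
    hG.comp ((measurable_fin_init.comp measurable_snd).prodMk
      ((measurable_eval_last.comp measurable_fst).prodMk
        (measurable_eval_last.comp measurable_snd)))
  obtain ⟨g, hg, hgG⟩ : ∃ g : (Fin t → Mat q) × Mat q → ℝ≥0∞, Measurable g ∧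
      ∀ y Φ, ∫⁻ z, G (y, Φ, z) ∂wishart q θ.k (θ.k • Φ)⁻¹ = g (y, Φ) :=
    ⟨_, measurable_lintegral_wishart (S := fun p : (Fin t → Mat q) × Mat q => (θ.k • p.2)⁻¹)
      (f := fun a => G (a.1.1, a.1.2, a.2))
      (measurable_matrix_inv (measurable_matrix_smul measurable_snd))
      (hG.comp ((measurable_fst.comp measurable_fst).prodMk
        ((measurable_snd.comp measurable_fst).prodMk measurable_snd))), fun _ _ => rfl⟩
  have hint : Measurable fun p : (Fin t → Mat q) × Mat q => ∫⁻ Φ, g (p.1, Φ) ∂trans t p.1 p.2 :=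
    measurable_lintegral_of_prob (m := fun p : (Fin t → Mat q) × Mat q => trans t p.1 p.2)
      (H.isMarkov.measurable_trans t) (fun _ => H.isMarkov.trans_prob t _ _)
      (f := fun a : ((Fin t → Mat q) × Mat q) × Mat q => g (a.1.1, a.2))
      (hg.comp ((measurable_fst.comp measurable_fst).prodMk measurable_snd))
  have h1 := H.isMarkov.lintegral_ssmLaw_succ (base := wishartBase q θ.k)
    (measurable_obsDensity θ.k) t hF
  refine h1.trans ?_
  simp only [Path.extend, Fin.init_snoc, Fin.snoc_last]
  have h2 := H.lintegral_law hq hθ t hint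
  simp only [hgG]
  refine Eq.trans (lintegral_congr fun h => lintegral_congr fun Φ => hgG h.2 Φ) (h2.trans ?_)
  refine lintegral_congr_ae ((θ.ae_posSemidef_dataLaw t).mono fun y hy => ?_)
  have htr : Measurable (trans t y) :=
    (H.isMarkov.measurable_trans t).comp measurable_prodMk_left
  have hgy : Measurable fun Φ => g (y, Φ) := hg.comp measurable_prodMk_left
  have h3 := Measure.lintegral_bind (m := θ.filterLaw t y) htr.aemeasurable hgy.aemeasurable
  rw [H.bind_trans t y hy] at h3
  exact h3.symm

/-- The observation law is known to have mass one only for positive definite `Φ`. The mass is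
therefore computed through the prior, under which `Φ` is almost surely positive definite. -/
lemma isProbabilityMeasure_law (H : θ.IsConjugateEvolution trans) (hq : 0 < q)
    (hθ : θ.Admissible) (t : ℕ) : IsProbabilityMeasure
      (ssmLaw θ.init trans (fun Φ => wishart q θ.k (θ.k • Φ)⁻¹) t) := by
  induction t with
  | zero =>
    have := H.isMarkov.init_prob
    exact Measure.isProbabilityMeasure_map
      ((measurable_pi_lambda _ fun _ => measurable_id).prodMk measurable_const).aemeasurable
  | succ t ih =>
    have hd : IsProbabilityMeasure (θ.dataLaw t) := by
      rw [← H.map_snd_law hq hθ t]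
      exact Measure.isProbabilityMeasure_map measurable_snd.aemeasurable
    have h := H.lintegral_law_succ hq hθ t (G := fun _ => 1) measurable_const
    rw [lintegral_one] at h
    refine ⟨h.trans (Eq.trans ?_ (lintegral_one.trans hd.measure_univ))⟩
    refine lintegral_congr_ae ((θ.ae_posSemidef_dataLaw t).mono fun y hy => ?_)
    have := hθ.isProbabilityMeasure_priorLaw hq hy
    have e : ∫⁻ Φ, ∫⁻ _, 1 ∂wishart q θ.k (θ.k • Φ)⁻¹ ∂θ.priorLaw t y =
        ∫⁻ _, 1 ∂θ.priorLaw t y :=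
      lintegral_congr_ae ((hθ.ae_isProbabilityMeasure_obs hq t y).mono fun Φ hΦ => by simp)
    exact e.trans (lintegral_one.trans measure_univ)

lemma hasPosterior (H : θ.IsConjugateEvolution trans) (hq : 0 < q) (hθ : θ.Admissible) (t : ℕ) :
    HasPosterior (ssmLaw θ.init trans (fun Φ => wishart q θ.k (θ.k • Φ)⁻¹) t) (θ.filterLaw t) :=
  HasCondLaw.of_lintegral (ν := θ.dataLaw t) (measurable_eval_last.comp measurable_fst)
    measurable_snd (θ.measurable_filterLaw t)
    ((θ.ae_posSemidef_dataLaw t).mono fun _ hy => hθ.isProbabilityMeasure_filterLaw hq hy)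
    fun _ hG => H.lintegral_law hq hθ t hG

lemma hasPrior (H : θ.IsConjugateEvolution trans) (hq : 0 < q) (hθ : θ.Admissible) (t : ℕ) :
    HasPrior (ssmLaw θ.init trans (fun Φ => wishart q θ.k (θ.k • Φ)⁻¹) (t + 1)) (θ.priorLaw t) := by
  refine HasCondLaw.of_lintegral (ν := θ.dataLaw t) (measurable_eval_last.comp measurable_fst)
    (measurable_fin_init.comp measurable_snd) (θ.measurable_priorLaw t)
    ((θ.ae_posSemidef_dataLaw t).mono fun _ hy => hθ.isProbabilityMeasure_priorLaw hq hy)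
    fun G hG => ?_
  have h : Measurable fun p : (Fin t → Mat q) × Mat q × Mat q => G (p.1, p.2.1) :=
    hG.comp (measurable_fst.prodMk (measurable_fst.comp measurable_snd))
  refine (H.lintegral_law_succ hq hθ t h).trans ?_
  refine lintegral_congr fun y => ?_
  refine lintegral_congr_ae ((hθ.ae_isProbabilityMeasure_obs hq t y).mono fun Φ hΦ => ?_)
  simp

lemma hasForecast (H : θ.IsConjugateEvolution trans) (hq : 0 < q) (hθ : θ.Admissible) (t : ℕ) :
    HasForecast (ssmLaw θ.init trans (fun Φ => wishart q θ.k (θ.k • Φ)⁻¹) (t + 1))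
      (fun y => (θ.priorLaw t y).bind fun Φ => wishart q θ.k (θ.k • Φ)⁻¹) := by
  have hobs : Measurable fun Φ : Mat q => wishart q θ.k (θ.k • Φ)⁻¹ :=
    (measurable_wishart q θ.k).comp (measurable_matrix_inv (measurable_matrix_smul measurable_id))
  refine HasCondLaw.of_lintegral (ν := θ.dataLaw t) (measurable_eval_last.comp measurable_snd)
    (measurable_fin_init.comp measurable_snd)
    ((Measure.measurable_bind' hobs).comp (θ.measurable_priorLaw t))
    ((θ.ae_posSemidef_dataLaw t).mono fun y hy => ?_) fun G hG => ?_
  · have := hθ.isProbabilityMeasure_priorLaw hq hy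
    constructor
    rw [Measure.bind_apply MeasurableSet.univ hobs.aemeasurable,
      ← (measure_univ : θ.priorLaw t y univ = 1), ← lintegral_one]
    exact lintegral_congr_ae ((hθ.ae_isProbabilityMeasure_obs hq t y).mono fun Φ hΦ =>
      hΦ.measure_univ)
  · have h : Measurable fun p : (Fin t → Mat q) × Mat q × Mat q => G (p.1, p.2.2) :=
      hG.comp (measurable_fst.prodMk (measurable_snd.comp measurable_snd))
    refine (H.lintegral_law_succ hq hθ t h).trans ?_
    refine lintegral_congr fun y => ?_
    have hGy : Measurable fun z => G (y, z) := hG.comp measurable_prodMk_left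
    rw [Measure.lintegral_bind hobs.aemeasurable hGy.aemeasurable]

/-- The Wishart reference measures live on positive semidefinite matrices, so agreement of the two
densities there is enough. -/
lemma dataLaw_eq_withDensity (H : θ.IsConjugateEvolution trans) (hq : 0 < q) (hθ : θ.Admissible)
    (t : ℕ) : θ.dataLaw t = (Measure.pi fun _ : Fin t => wishartBase q θ.k).withDensity
      (marginalLikelihood θ.k θ.init trans t) :=
  withDensity_congr_ae ((ae_posSemidef_pi_wishartBase θ.k t).mono fun y hy =>
    (H.marginalLikelihood_eq hq hθ t y hy).symm)

end IsConjugateEvolution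

end UEParam

/-! ### Both evolutions are conjugate; the correspondence of hyperparameters. -/

lemma inv_smul_inv_smul {k c : ℝ} (hk : 0 < k) (hc : 0 < c) {D : Mat q} (hD : D.PosDef) :
    c⁻¹ • (k • D)⁻¹ = (k • c • D)⁻¹ := by
  refine (Matrix.inv_eq_right_inv ?_).symm
  rw [smul_comm k c D, Matrix.smul_mul, Matrix.mul_smul,
    Matrix.mul_nonsing_inv _ (hD.smul hk).det_pos.ne'.isUnit, smul_smul, mul_inv_cancel₀ hc.ne',
    one_smul]

namespace UEParam

variable {θ : UEParam q}

lemma Admissible.isProbabilityMeasure_init (hθ : θ.Admissible) (hq : 0 < q) :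
    IsProbabilityMeasure θ.init :=
  hθ.isProbabilityMeasure_filterLaw hq (t := 0) (y := Fin.elim0) fun j => j.elim0

lemma Admissible.isConjugateEvolution (hθ : θ.Admissible) (hq : 0 < q) :
    θ.IsConjugateEvolution θ.trans := by
  have hprob := isProbabilityMeasure_matrixBeta hθ.1 hθ.2.1
  have hF : Measurable (Function.uncurry fun Φ Ψ : Mat q =>
      θ.lam⁻¹ • ((uchol Φ)ᵀ * Ψ * uchol Φ)) :=
    have hu := measurable_uchol.comp (measurable_fst (α := Mat q) (β := Mat q))
    measurable_matrix_smul (measurable_matrix_mul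
      (measurable_matrix_mul (measurable_matrix_transpose hu) measurable_snd) hu)
  refine ⟨⟨hθ.isProbabilityMeasure_init hq, fun t y Φ => ?_, fun t => ?_⟩, fun t y hy => ?_⟩
  · exact Measure.isProbabilityMeasure_map hF.of_uncurry_left.aemeasurable
  · exact (measurable_map_of_uncurry (matrixBeta q θ.n θ.k) hF).comp measurable_snd
  · have hD := hθ.scale_posDef hy
    rw [priorLaw, ← inv_smul_inv_smul (hθ.k_pos hq) hθ.2.2.1 hD]
    exact wishart_bind_matrixBeta hq hθ.1 hθ.2.1 (hD.smul (hθ.k_pos hq)).inv (inv_pos.2 hθ.2.2.1)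

lemma Admissible.add_pos (hθ : θ.Admissible) (hq : 0 < q) : 0 < θ.n + θ.k := by
  have h1 : (1 : ℝ) ≤ q := by exact_mod_cast hq
  linarith [hθ.1, hθ.k_pos hq]

lemma Admissible.n_pos (hθ : θ.Admissible) (hq : 0 < q) : 0 < θ.n := by
  have h1 : (1 : ℝ) ≤ q := by exact_mod_cast hq
  linarith [hθ.1]

/-- `n + k` is the fixed point of `x ↦ β x + k` when `β = n / (n + k)`. -/
lemma toBB_dof (h : θ.n + θ.k ≠ 0) (t : ℕ) : θ.toBB.dof t = θ.n + θ.k := by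
  induction t with
  | zero => rfl
  | succ t ih =>
    rw [BBParam.dof, ih]
    simp only [toBB]
    rw [div_mul_cancel₀ _ h]

lemma toBB_trans (h : θ.n + θ.k ≠ 0) (t : ℕ) (y : Fin t → Mat q) (Φ : Mat q) :
    θ.toBB.trans t y Φ =
      (Measure.pi fun i : Fin q => betaMeasure ((θ.n - (i : ℝ)) / 2) (θ.k / 2)).map fun η =>
        θ.lam⁻¹ • ((BBParam.shrinkDiag η (uchol Φ *
            (uchol (θ.k • scale θ.lam θ.D0 t y)⁻¹)⁻¹) * uchol (θ.k • scale θ.lam θ.D0 t y)⁻¹)ᵀ *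
          (BBParam.shrinkDiag η (uchol Φ *
            (uchol (θ.k • scale θ.lam θ.D0 t y)⁻¹)⁻¹) * uchol (θ.k • scale θ.lam θ.D0 t y)⁻¹)) := by
  have h1 : θ.toBB.β * θ.toBB.dof t = θ.n := by
    rw [toBB_dof h]
    exact div_mul_cancel₀ _ h
  have h2 : (1 - θ.toBB.β) * θ.toBB.dof t = θ.k := by
    rw [sub_mul, h1, toBB_dof h]
    ring
  rw [BBParam.trans, h1, h2]
  rfl

/-- The matrix `P_t` of the model is the Cholesky factor of the scale of the filtered law. This is
why the factor `U_t` has the independent entries on which the beta variables act. -/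
lemma Admissible.isConjugateEvolution_toBB (hθ : θ.Admissible) (hq : 0 < q) :
    θ.IsConjugateEvolution θ.toBB.trans := by
  have hk := hθ.k_pos hq
  have h0 := (hθ.add_pos hq).ne'
  have hbeta : ∀ i : Fin q, IsProbabilityMeasure (betaMeasure ((θ.n - (i : ℝ)) / 2) (θ.k / 2)) :=
    fun i => isProbabilityMeasureBeta (half_pos (sub_index_pos hθ.1 i)) (half_pos hk)
  have hF : ∀ t, Measurable (Function.uncurry fun (p : (Fin t → Mat q) × Mat q) (η : Fin q → ℝ) =>
        θ.lam⁻¹ • ((BBParam.shrinkDiag η (uchol p.2 *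
          (uchol (θ.k • scale θ.lam θ.D0 t p.1)⁻¹)⁻¹) * uchol (θ.k • scale θ.lam θ.D0 t p.1)⁻¹)ᵀ *
        (BBParam.shrinkDiag η (uchol p.2 *
          (uchol (θ.k • scale θ.lam θ.D0 t p.1)⁻¹)⁻¹) *
            uchol (θ.k • scale θ.lam θ.D0 t p.1)⁻¹))) := by
    intro t
    have hP : Measurable fun p : ((Fin t → Mat q) × Mat q) × (Fin q → ℝ) =>
        uchol (θ.k • scale θ.lam θ.D0 t p.1.1)⁻¹ :=
      measurable_uchol.comp (measurable_matrix_inv (measurable_matrix_smul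
        ((measurable_scale θ.lam θ.D0 t).comp (measurable_fst.comp measurable_fst))))
    have hU : Measurable fun p : ((Fin t → Mat q) × Mat q) × (Fin q → ℝ) => uchol p.1.2 :=
      measurable_uchol.comp (measurable_snd.comp measurable_fst)
    exact measurable_gram_shrinkDiag (measurable_matrix_mul hU (measurable_matrix_inv hP)) hP
      measurable_snd _
  refine ⟨⟨hθ.isProbabilityMeasure_init hq, fun t y Φ => ?_, fun t => ?_⟩, fun t y hy => ?_⟩
  · rw [toBB_trans h0]
    exact Measure.isProbabilityMeasure_map
      ((hF t).of_uncurry_left (x := (y, Φ))).aemeasurable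
  · simp only [toBB_trans h0]
    exact measurable_map_of_uncurry _ (hF t)
  · have hD := hθ.scale_posDef hy
    rw [priorLaw, ← inv_smul_inv_smul hk hθ.2.2.1 hD, show θ.toBB.trans t y = _ from
      funext fun Φ => toBB_trans h0 t y Φ]
    exact wishart_bind_shrinkDiag hθ.1 hk (hD.smul hk).inv (inv_pos.2 hθ.2.2.1)

lemma Admissible.likelihood_eq (hθ : θ.Admissible) (hq : 0 < q) (t : ℕ) (y : Fin t → Mat q)
    (hy : ∀ j, (y j).PosSemidef) : θ.likelihood t y = θ.toBB.likelihood t y :=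
  ((hθ.isConjugateEvolution hq).marginalLikelihood_eq hq hθ t y hy).trans
    ((hθ.isConjugateEvolution_toBB hq).marginalLikelihood_eq hq hθ t y hy).symm

/-- `k_0 = k / (1 - β)` is the fixed-point equation `β k_0 + k = k_0`, under which the degrees of
freedom stay constant. The inverse map takes `n = β k_0`. -/
lemma bijOn_toBB (hq : 0 < q) : Set.BijOn (toBB (q := q)) {θ | θ.Admissible}
    {ϑ | ϑ.Admissible ∧ ϑ.k0 = ϑ.k / (1 - ϑ.β)} := by
  have hq1 : (1 : ℝ) ≤ q := by exact_mod_cast hq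
  refine ⟨fun θ hθ => ?_, fun θ _ θ' _ h => ?_, fun ϑ hϑ => ?_⟩
  · replace hθ : θ.Admissible := hθ
    have hs := hθ.add_pos hq
    have hn := hθ.n_pos hq
    have hk := hθ.k_pos hq
    refine ⟨⟨hs, hθ.2.1, div_pos hn hs, (div_lt_one hs).2 (by linarith), hθ.2.2.1, hθ.2.2.2.1,
      hθ.2.2.2.2, fun t => ?_⟩, ?_⟩
    · rw [toBB_dof hs.ne']
      exact hθ.1.trans_eq (div_mul_cancel₀ _ hs.ne').symm
    · simp only [toBB]
      rw [eq_div_iff (by rw [sub_ne_zero]; exact ((div_lt_one hs).2 (by linarith)).ne'), mul_sub,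
        mul_div_cancel₀ _ hs.ne']
      ring
  · obtain ⟨n, k, l, D⟩ := θ
    obtain ⟨n', k', l', D'⟩ := θ'
    simp only [toBB, BBParam.mk.injEq] at h
    obtain ⟨h1, rfl, -, rfl, rfl⟩ := h
    rw [add_right_cancel h1]
  · obtain ⟨⟨hk0, hk, hβ, hβ1, hb, hb1, hD, hdof⟩, he⟩ := hϑ
    have hsum : ϑ.β * ϑ.k0 + ϑ.k = ϑ.k0 := by
      have h1 : 1 - ϑ.β ≠ 0 := (sub_pos.2 hβ1).ne'
      rw [eq_div_iff h1] at he
      linarith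
    -- The bound `n > q - 1` is the beta-Bartlett condition at `t = 0`.
    refine ⟨⟨ϑ.β * ϑ.k0, ϑ.k, ϑ.b, ϑ.D0⟩, ⟨hdof 0, hk, hb, hb1, hD⟩, ?_⟩
    simp only [toBB, hsum, mul_div_cancel_right₀ _ hk0.ne']

end UEParam

/-- Only `f = f' ∘ g` on `S` is used: comparisons over `g '' S` are comparisons over `S`, whether or
not `g` is injective. -/
lemma image_setOf_isMaxOn {α β γ : Type*} [Preorder γ] {g : α → β} {f : α → γ} {f' : β → γ}
    {S : Set α} (h : ∀ x ∈ S, f x = f' (g x)) :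
    {z | z ∈ g '' S ∧ IsMaxOn f' (g '' S) z} = g '' {x | x ∈ S ∧ IsMaxOn f S x} := by
  ext z
  constructor
  · rintro ⟨⟨x, hx, rfl⟩, hz⟩
    refine ⟨x, ⟨hx, fun x' hx' => ?_⟩, rfl⟩
    have := hz (mem_image_of_mem g hx')
    change f x' ≤ f x
    rw [h x hx, h x' hx']
    exact this
  · rintro ⟨x, ⟨hx, hm⟩, rfl⟩
    refine ⟨mem_image_of_mem g hx, ?_⟩
    rintro _ ⟨x', hx', rfl⟩
    have : f x' ≤ f x := hm hx'
    rw [h x hx, h x' hx'] at this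
    exact this

end StochVol

end

theorem mainTheorem1 (q : ℕ) (hq : 0 < q) :
    -- matched models: priors, filtered posteriors, forecasts and marginal likelihoods agree
    (∀ θ : StochVol.UEParam q, θ.Admissible →
      (∀ t : ℕ, IsProbabilityMeasure (θ.law t) ∧ IsProbabilityMeasure (θ.toBB.law t)) ∧
      -- prior `Φ_{t+1} | y_{1:t}`
      (∀ t : ℕ,
        StochVol.HasPrior (θ.law (t + 1)) (fun y =>
          StochVol.wishart q θ.n (θ.k • θ.lam • StochVol.scale θ.lam θ.D0 t y)⁻¹) ∧
        StochVol.HasPrior (θ.toBB.law (t + 1)) (fun y =>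
          StochVol.wishart q θ.n (θ.k • θ.lam • StochVol.scale θ.lam θ.D0 t y)⁻¹)) ∧
      -- forward-filtered posterior `Φ_t | y_{1:t}` (for `t = 0`: the initial prior)
      (∀ t : ℕ,
        StochVol.HasPosterior (θ.law t) (fun y =>
          StochVol.wishart q (θ.n + θ.k) (θ.k • StochVol.scale θ.lam θ.D0 t y)⁻¹) ∧
        StochVol.HasPosterior (θ.toBB.law t) (fun y =>
          StochVol.wishart q (θ.n + θ.k) (θ.k • StochVol.scale θ.lam θ.D0 t y)⁻¹)) ∧
      -- one-step-ahead forecast `y_{t+1} | y_{1:t}`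
      (∀ t : ℕ,
        StochVol.HasForecast (θ.law (t + 1)) (fun y =>
          (StochVol.wishart q θ.n (θ.k • θ.lam • StochVol.scale θ.lam θ.D0 t y)⁻¹).bind
            fun Φ => StochVol.wishart q θ.k (θ.k • Φ)⁻¹) ∧
        StochVol.HasForecast (θ.toBB.law (t + 1)) (fun y =>
          (StochVol.wishart q θ.n (θ.k • θ.lam • StochVol.scale θ.lam θ.D0 t y)⁻¹).bind
            fun Φ => StochVol.wishart q θ.k (θ.k • Φ)⁻¹)) ∧
      -- the data `y_{1:T}` have the same law in both models
      (∀ T : ℕ, (θ.law T).map Prod.snd = (θ.toBB.law T).map Prod.snd) ∧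
      -- the marginal likelihoods are densities of the law of the data, and are equal
      (∀ T : ℕ,
        (θ.law T).map Prod.snd =
          (Measure.pi fun _ : Fin T => StochVol.wishartBase q θ.k).withDensity
            (θ.likelihood T) ∧
        (θ.toBB.law T).map Prod.snd =
          (Measure.pi fun _ : Fin T => StochVol.wishartBase q θ.k).withDensity
            (θ.toBB.likelihood T) ∧
        ∀ y : Fin T → StochVol.Mat q, (∀ j, (y j).PosSemidef) →
          θ.likelihood T y = θ.toBB.likelihood T y)) ∧
    -- the change of hyperparameters is a bijection onto the beta-Bartlett hyperparameters with
    -- `k_0 = k / (1 - β)`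
    Set.BijOn (StochVol.UEParam.toBB (q := q)) {θ | θ.Admissible}
      {ϑ | ϑ.Admissible ∧ ϑ.k0 = ϑ.k / (1 - ϑ.β)} ∧
    -- hence maximisers of the marginal likelihoods are matched
    (∀ (T : ℕ) (y : Fin T → StochVol.Mat q), (∀ j, (y j).PosSemidef) →
      ∀ S : Set (StochVol.UEParam q), (∀ θ ∈ S, θ.Admissible) →
        {ϑ | ϑ ∈ StochVol.UEParam.toBB '' S ∧
            IsMaxOn (fun ϑ' : StochVol.BBParam q => ϑ'.likelihood T y)
              (StochVol.UEParam.toBB '' S) ϑ} =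
          StochVol.UEParam.toBB '' {θ | θ ∈ S ∧
            IsMaxOn (fun θ' : StochVol.UEParam q => θ'.likelihood T y) S θ}) := by
  refine ⟨fun θ hθ => ?_, StochVol.UEParam.bijOn_toBB hq, fun T y hy S hS =>
    StochVol.image_setOf_isMaxOn fun θ hθ => (hS θ hθ).likelihood_eq hq T y hy⟩
  have hU := hθ.isConjugateEvolution hq
  -- The initial and observation laws of `θ.toBB` are definitionally those of `θ`, so the
  -- conjugate-evolution lemmas stated for `θ` apply to `θ.toBB.law`.
  have hB := hθ.isConjugateEvolution_toBB hq
  exact ⟨fun t => ⟨hU.isProbabilityMeasure_law hq hθ t, hB.isProbabilityMeasure_law hq hθ t⟩,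
    fun t => ⟨hU.hasPrior hq hθ t, hB.hasPrior hq hθ t⟩,
    fun t => ⟨hU.hasPosterior hq hθ t, hB.hasPosterior hq hθ t⟩,
    fun t => ⟨hU.hasForecast hq hθ t, hB.hasForecast hq hθ t⟩,
    fun T => (hU.map_snd_law hq hθ T).trans (hB.map_snd_law hq hθ T).symm,
    fun T => ⟨(hU.map_snd_law hq hθ T).trans (hU.dataLaw_eq_withDensity hq hθ T),
      (hB.map_snd_law hq hθ T).trans (hB.dataLaw_eq_withDensity hq hθ T),
      hθ.likelihood_eq hq T⟩⟩
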